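/- Let $p,q\ge 1$ and let $a(z)=\sum_{j=-q}^{p}a_jz^j$ be a Laurent polynomial with complex coefficients, $a_p\neq 0$, $a_{-q}\neq 0$ and $\gcd\{j\in\mathbb Z: a_j\ne 0\}=1$. For $\lambda\in\mathbb C$ let $z_1(\lambda),\dots,z_{p+q}(\lambda)$ be the solutions of $a(z)=\lambda$, repeated according to multiplicity and numbered so that $0<|z_1(\lambda)|\le\cdots\le|z_{p+q}(\lambda)|$. Fix an integer $k\in\{-q+1,\dots,p-1\}$ and put $$\Gamma_k=\{\lambda\in\mathbb C: |z_{q+k}(\lambda)|=|z_{q+k+1}(\lambda)|\},\qquad w_k(\lambda)=\prod_{j=1}^{q+k}z_j(\lambda).$$ For $n\ge1$ let $P_{k,n}(\lambda)=\det T_n(z^{-k}(a-\lambda))$, where $T_n(b)=(b_{i-j})_{i,j=1}^n$ is the Toeplitz matrix of the Laurent polynomial $b(z)=\sum_m b_mz^m$. Let $\operatorname{sp}_kT_n(a)=\{\lambda\in\mathbb C: P_{k,n}(\lambda)=0\}$, and let $\mu_{k,n}=\frac1n\sum_\lambda\delta_\lambda$, the sum being over the zeros of $P_{k,n}$ counted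 with multiplicity (defined whenever $P_{k,n}\not\equiv0$, which holds for all large $n$). Let $\liminf_n\operatorname{sp}_kT_n(a)$ be the set of limits of convergent sequences $(\lambda_n)$ with $\lambda_n\in\operatorname{sp}_kT_n(a)$ for all sufficiently large $n$, and let $\limsup_n\operatorname{sp}_kT_n(a)$ be the set of limits of convergent sequences $(\lambda_{i})_{i}$ with $\lambda_{i}\in\operatorname{sp}_kT_{n_i}(a)$ for some $n_1<n_2<\cdots$. A regular arc of $\Gamma_k$ is a regularly parametrized, embedded open analytic arc that equals $\Gamma_k\cap U$ for some open set $U$ and contains no $\lambda$ for which $a(z)-\lambda$ has a multiple root; a point of $\Gamma_k$ is exceptional if it lies on no regular arc. There is exactly one finite positive Borel measure $\mu_k$ on $\mathbb C$ that vanishes on $\mathbb C\setminus\Gamma_k$ and on the set of exceptional points and is given on every (oriented) regular arc by $$d\mu_k(\lambda)=\frac1{2\pi i}\sum_{j=1}^{q+k}\left(\frac{z_{j+}'(\lambda)}{z_{j+}(\lambda)}-\frac{z_{j-}'(\lambda)}{z_{j-}(\lambda)}\right)d\lambda=\frac1{2\pi i}\left(\frac{w_{k+}'(\lambda)}{w_{k+}(\lambda)}-\frac{w_{k-}'(\lambda)}{w_{k-}(\lambda)}\right)d\lambda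 ,$$ where $d\lambda$ is the complex line element and the subscripts $+$ and $-$ denote limiting values from the left-hand and the right-hand side of the arc; the limiting values of $w_k'/w_k$ exist at every point of a regular arc, and there the last expression is the meaning of the formula. Moreover $$\liminf_{n\to\infty}\operatorname{sp}_kT_n(a)=\limsup_{n\to\infty}\operatorname{sp}_kT_n(a)=\Gamma_k,$$ and $$\lim_{n\to\infty}\int_{\mathbb C}\phi\,d\mu_{k,n}=\int_{\mathbb C}\phi\,d\mu_k$$ for every bounded continuous function $\phi$ on $\mathbb C$. -/

import Mathlib

open Filter Topology MeasureTheory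
open scoped LaurentPolynomial Polynomial BoundedContinuousFunction ENNReal NNReal

noncomputable section

namespace BandedToeplitz

/-- The `n × n` Toeplitz matrix `T_n(f)` of a Laurent polynomial symbol `f = ∑ f_m z^m`:
its `(i, j)` entry is `f_{i-j}`. -/
def toeplitz {R : Type*} [CommRing R] (n : ℕ) (f : R[T;T⁻¹]) : Matrix (Fin n) (Fin n) R :=
  Matrix.of fun i j => f.coeff ((i : ℤ) - (j : ℤ))

/-- The symbol `z^{-k} (a - λ)`. -/
def shiftedSymbol {R : Type*} [CommRing R] (a : R[T;T⁻¹]) (k : ℤ) (lam : R) : R[T;T⁻¹] :=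
  LaurentPolynomial.T (-k) * (a - LaurentPolynomial.C lam)

/-- The polynomial `P_{k,n}(λ) = det T_n(z^{-k}(a - λ))`, with `λ` the polynomial variable. -/
def P (a : ℂ[T;T⁻¹]) (k : ℤ) (n : ℕ) : ℂ[X] :=
  (toeplitz n (shiftedSymbol
    (AddMonoidAlgebra.mapRingHom ℤ (Polynomial.C : ℂ →+* ℂ[X]) a) k Polynomial.X)).det

/-- As a function of `λ`, `P_{k,n}` is the determinant of the complex Toeplitz matrix. -/
theorem eval_P (a : ℂ[T;T⁻¹]) (k : ℤ) (n : ℕ) (lam : ℂ) :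
    (P a k n).eval lam = (toeplitz n (shiftedSymbol a k lam)).det := by
  unfold P
  rw [← Polynomial.coe_evalRingHom, RingHom.map_det]
  congr 1
  ext i j
  have hf : AddMonoidAlgebra.mapRingHom ℤ (Polynomial.evalRingHom lam)
      (shiftedSymbol (AddMonoidAlgebra.mapRingHom ℤ (Polynomial.C : ℂ →+* ℂ[X]) a) k
        Polynomial.X) = shiftedSymbol a k lam := by
    have hC : AddMonoidAlgebra.mapRingHom ℤ (Polynomial.evalRingHom lam)
        (AddMonoidAlgebra.mapRingHom ℤ (Polynomial.C : ℂ →+* ℂ[X]) a) = a := by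
      ext m
      simp
    rw [shiftedSymbol, shiftedSymbol, map_mul, map_sub, hC]
    congr 1
    · simp [LaurentPolynomial.T, -LaurentPolynomial.single_eq_C_mul_T]
    · congr 1
      simp [← LaurentPolynomial.single_eq_C, -LaurentPolynomial.single_eq_C_mul_T]
  rw [← hf]
  simp [toeplitz]

/-- The `k`-th generalized spectrum of `T_n(a)`. -/
def genSpec (a : ℂ[T;T⁻¹]) (k : ℤ) (n : ℕ) : Set ℂ :=
  {lam | (P a k n).eval lam = 0}

/-- The normalized zero counting measure `μ_{k,n}`; zeros are counted with multiplicity. -/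
def countingMeasure (a : ℂ[T;T⁻¹]) (k : ℤ) (n : ℕ) : Measure ℂ :=
  (n : ℝ≥0∞)⁻¹ • ((P a k n).roots.map Measure.dirac).sum

/-- The limits of convergent sequences `u` with `u n ∈ S n` (for all large `n`). -/
def setLiminf (S : ℕ → Set ℂ) : Set ℂ :=
  {x | ∃ u : ℕ → ℂ, (∀ᶠ n in atTop, u n ∈ S n) ∧ Tendsto u atTop (𝓝 x)}

/-- The limits of subsequences of sequences `u` with `u n ∈ S n`. -/
def setLimsup (S : ℕ → Set ℂ) : Set ℂ :=
  {x | ∃ (m : ℕ → ℕ) (u : ℕ → ℂ), StrictMono m ∧ (∀ i, u i ∈ S (m i)) ∧ Tendsto u atTop (𝓝 x)}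

/-- The polynomial `z^q (a(z) - λ)`, whose roots are the solutions of `a(z) = λ`
when `a` has lowest degree `-q`. -/
def algPoly (a : ℂ[T;T⁻¹]) (q : ℕ) (lam : ℂ) : ℂ[X] :=
  LaurentPolynomial.trunc (LaurentPolynomial.T (q : ℤ) * (a - LaurentPolynomial.C lam))

/-- The solutions of `a(z) = λ`, repeated according to multiplicity and listed by increasing
absolute value (ties in an arbitrary order). -/
def sortedSolutions (a : ℂ[T;T⁻¹]) (q : ℕ) (lam : ℂ) : List ℂ :=
  (algPoly a q lam).roots.toList.insertionSort (fun x y => ‖x‖ ≤ ‖y‖)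

/-- The solution `z_j(λ)`, numbered from `j = 1`. -/
def sol (a : ℂ[T;T⁻¹]) (q : ℕ) (j : ℤ) (lam : ℂ) : ℂ :=
  (sortedSolutions a q lam).getD (j - 1).toNat 0

/-- The set `Γ_k = {λ : |z_{q+k}(λ)| = |z_{q+k+1}(λ)|}`. -/
def Gam (a : ℂ[T;T⁻¹]) (q : ℕ) (k : ℤ) : Set ℂ :=
  {lam | ‖sol a q (q + k) lam‖ = ‖sol a q (q + k + 1) lam‖}

/-- The function `w_k = z_1 z_2 ⋯ z_{q+k}`. On `ℂ \ Γ_k` it does not depend on the numbering,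
and its logarithmic derivative is `∑_{j=1}^{q+k} z_j' / z_j`. -/
def w (a : ℂ[T;T⁻¹]) (q : ℕ) (k : ℤ) (lam : ℂ) : ℂ :=
  ∏ j ∈ Finset.Icc (1 : ℤ) (q + k), sol a q j lam

/-- `λ` is a branch point: `a(z) - λ` has a multiple root. -/
def IsBranchPoint (a : ℂ[T;T⁻¹]) (q : ℕ) (lam : ℂ) : Prop :=
  ∃ z : ℂ, 1 < (algPoly a q lam).rootMultiplicity z

/-- `γ`, restricted to the open interval `(s, t)`, parametrizes an open analytic arc of `Γ_k`
consisting of regular points: it is a regular real analytic embedding, its image is the part of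
`Γ_k` in some open set `U`, and it contains no branch point. The arc is oriented by `γ`. -/
structure IsRegularArc (a : ℂ[T;T⁻¹]) (q : ℕ) (k : ℤ) (γ : ℝ → ℂ) (s t : ℝ) : Prop where
  analytic : AnalyticOnNhd ℝ γ (Set.Ioo s t)
  deriv_ne_zero : ∀ x ∈ Set.Ioo s t, deriv γ x ≠ 0
  embedding : IsEmbedding (fun x : Set.Ioo s t => γ x)
  image_eq : ∃ U : Set ℂ, IsOpen U ∧ γ '' Set.Ioo s t = Gam a q k ∩ U
  not_branch : ∀ x ∈ Set.Ioo s t, ¬ IsBranchPoint a q (γ x)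

/-- The exceptional points of `Γ_k`: the points that lie on no open analytic arc
of regular points. -/
def exceptionalPoints (a : ℂ[T;T⁻¹]) (q : ℕ) (k : ℤ) : Set ℂ :=
  {lam ∈ Gam a q k | ¬ ∃ (γ : ℝ → ℂ) (s t : ℝ), IsRegularArc a q k γ s t ∧
    lam ∈ γ '' Set.Ioo s t}

/-- `L` is the limiting value at `γ x` of `f` from the left-hand side (for `σ = 1`), or from the
right-hand side (for `σ = -1`), of the curve `γ`: near `γ x` the points on that side
are `γ y + σ i ε γ'(y)` with `y` near `x` and `ε > 0` small. -/
def HasSideLimit (f : ℂ → ℂ) (γ : ℝ → ℂ) (σ : ℝ) (x : ℝ) (L : ℂ) : Prop :=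
  Tendsto (fun v : ℝ × ℝ => f (γ v.1 + (σ : ℂ) * Complex.I * (v.2 : ℂ) * deriv γ v.1))
    (𝓝 x ×ˢ 𝓝[>] (0 : ℝ)) (𝓝 L)

/-- `μ` is the measure `μ_k` on `Γ_k`, that is, the finite positive measure carried by the open
analytic arcs of `Γ_k` and given on each of them by
`dμ_k(λ) = (1 / 2πi) ∑_{j=1}^{q+k} (z_{j+}'(λ) / z_{j+}(λ) - z_{j-}'(λ) / z_{j-}(λ)) dλ`,
which is `(1 / 2πi) (w_{k+}'(λ) / w_{k+}(λ) - w_{k-}'(λ) / w_{k-}(λ)) dλ`. In a parametrization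
`λ = γ(x)` the complex line element `dλ` is `γ'(x) dx`. -/
structure IsJumpMeasure (a : ℂ[T;T⁻¹]) (q : ℕ) (k : ℤ) (μ : Measure ℂ) : Prop where
  finite : IsFiniteMeasure μ
  carried : μ (Gam a q k)ᶜ = 0
  exceptional : μ (exceptionalPoints a q k) = 0
  density : ∀ (γ : ℝ → ℂ) (s t : ℝ), IsRegularArc a q k γ s t →
    ∃ (Lplus Lminus : ℝ → ℂ) (d : ℝ → ℝ≥0),
      (∀ x ∈ Set.Ioo s t,
        HasSideLimit (logDeriv (w a q k)) γ 1 x (Lplus x) ∧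
        HasSideLimit (logDeriv (w a q k)) γ (-1) x (Lminus x) ∧
        ((d x : ℝ) : ℂ) =
          1 / (2 * (Real.pi : ℂ) * Complex.I) * (Lplus x - Lminus x) * deriv γ x) ∧
      μ.restrict (γ '' Set.Ioo s t) =
        Measure.map γ ((volume.restrict (Set.Ioo s t)).withDensity fun x => (d x : ℝ≥0∞))

end BandedToeplitz

end

/-!
Multiplied by `z^q`, the equation `a(z) = λ` becomes a pencil `A(z) - λ z^q` of polynomials of
degree `N = p + q`, and `T_n(z^{-k}(a - λ))` becomes the banded Toeplitz matrix
`polyToeplitz m n (A - λ X^q)` with `m = q + k`. Let `w` be the product of the `m` smallest roots and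
`Γ` the set where the `m`-th and the `(m+1)`-st modulus agree.

*Off `Γ`.* Widom's determinant identity (`det_polyToeplitz_eq`) expresses the determinant `P_n`
through a generalized Vandermonde determinant in the roots, in which a single product of roots
dominates. Hence `P_n w^n / total^n`, times a nonvanishing analytic factor and a sign, tends to `1`
locally uniformly off `Γ` (`exists_ball_normalized`). So there are no zeros near a point off `Γ` for
large `n`, and `P_n' / (n P_n)` tends to `-w'/w`.

*Limit measures.* Along every ultrafilter the zero counting measures converge vaguely; by the above
the limit `μ` is carried by `Γ` and its Cauchy transform is `-w'/w` almost everywhere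
(`exists_isLimitMeasure`). As `λ → ∞`, the behaviour of the roots gives `-λ w'/w → mass`
(`tendsto_mul_logDeriv_w`), and `mass` is also an upper bound for `deg P_n / n`
(`natDegree_le_mass`). Therefore no mass escapes, and the convergence holds for bounded continuous
functions. Since `w'/w` is of smaller order than a simple pole at every point
(`tendsto_sub_mul_logDeriv_w`), `μ` has no atoms.

*Identification.* Outside a countable set `Γ` is a union of regular analytic arcs (`countable_exc`),
so `Γ` has area zero (`volume_gam`) and `μ` is determined by its restrictions to the arcs. In a
holomorphic chart straightening an arc, the Cauchy–Pompeiu formula followed by Green's formula on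
both half planes shows that `μ` is the jump of `w'/w` across the arc (`ArcChart.integral_eq`,
`IsLimitMeasure.isJump`); the jump is nonnegative because `|w|` is the least modulus of a product of
`m` roots (`jump_re_im`). A measure with these properties is unique (`IsJump.unique`), so all limits
along ultrafilters coincide and the whole sequence converges (`tendsto_integral_countMeas`).

*Zeros accumulate on all of `Γ`.* If a subsequence of the `P_n` had no zeros in a disc about a point
of `Γ`, the Cauchy transform of a limit measure would continue `w'/w` analytically across `Γ`. That
is impossible (`no_continuation`): the set `Γ` has no isolated points (`not_isolated`), and by the
maximum principle a continuation would make two root functions proportional, which the condition on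
the greatest common divisor of the exponents excludes (`not_eventually_proportional`).
-/

noncomputable section

namespace BandedToeplitz

/-! ### Pencils of polynomials and their numbered roots -/

theorem exists_perm_of_map_univ_eq {n : ℕ} {α : Type*} {u v : Fin n → α}
    (h : Finset.univ.val.map u = Finset.univ.val.map v) :
    ∃ σ : Equiv.Perm (Fin n), ∀ i, u i = v (σ i) := by
  classical
  have hc : ∀ c : α, Nonempty ({i // u i = c} ≃ {i // v i = c}) := by
    intro c
    refine ⟨Fintype.equivOfCardEq ?_⟩
    have := congrArg (Multiset.count c) h
    rw [Multiset.count_map, Multiset.count_map] at this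
    rw [Fintype.card_subtype, Fintype.card_subtype]
    simpa [Finset.card_def, Finset.filter_val, eq_comm] using this
  have e := fun c => (hc c).some
  exact ⟨Equiv.ofFiberEquiv e, fun i => (Equiv.ofFiberEquiv_map e i).symm⟩

/-- The polynomials `A - λ X^q` of degree `N`, together with a numbering of their roots by
nondecreasing absolute value. The integer `m` is the number of roots that are counted as small. The
field `rigid` says that the differences `l - q` of the exponents that occur have no common divisor
other than `1`, in the form in which it is used: no `c ≠ 1` satisfies `c^l = c^q` for all of them. -/
structure Pencil (N m : ℕ) where
  A : ℂ[X]
  q : ℕ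
  root : ℂ → Fin N → ℂ
  m_pos : 0 < m
  m_lt : m < N
  q_pos : 0 < q
  q_lt : q < N
  natDegree_A : A.natDegree = N
  coeff_zero_ne : A.coeff 0 ≠ 0
  rigid : ∀ c : ℂ, c ≠ 0 → (∀ l, A.coeff l ≠ 0 → c ^ l = c ^ q) → c = 1
  factor : ∀ lam, A - Polynomial.C lam * Polynomial.X ^ q =
    Polynomial.C A.leadingCoeff * ∏ i, (Polynomial.X - Polynomial.C (root lam i))
  mono : ∀ lam, Monotone fun i => ‖root lam i‖

namespace Pencil

variable {N m : ℕ} (Q : Pencil N m)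

/-- The member `A - λ X^q` of the pencil. -/
def f (lam : ℂ) : ℂ[X] := Q.A - Polynomial.C lam * Polynomial.X ^ Q.q

/-- `v` lists the roots of `A - λ X^q` with multiplicity, in some order. -/
def IsRoots (lam : ℂ) (v : Fin N → ℂ) : Prop :=
  ∀ z, (Q.f lam).eval z = Q.A.leadingCoeff * ∏ i, (z - v i)

/-- `S` consists of the `m` smallest entries of `v`, strictly separated from the others. -/
def Bottom (m : ℕ) {N : ℕ} (v : Fin N → ℂ) (S : Finset (Fin N)) : Prop :=
  S.card = m ∧ ∀ i ∈ S, ∀ j ∉ S, ‖v i‖ < ‖v j‖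

/-- The indices of the `m` smallest roots. -/
def low (m N : ℕ) : Finset (Fin N) := Finset.univ.filter fun i => i.val < m

/-- The set of all `λ` for which the `m`-th and the `(m+1)`-st root have equal modulus. -/
def Gam : Set ℂ :=
  {lam | ‖Q.root lam ⟨m - 1, by have := Q.m_lt; omega⟩‖ = ‖Q.root lam ⟨m, Q.m_lt⟩‖}

/-- The product of the `m` smallest roots. -/
def w (lam : ℂ) : ℂ := ∏ i ∈ low m N, Q.root lam i

theorem lead_ne : Q.A.leadingCoeff ≠ 0 := by
  intro h
  have := Q.natDegree_A
  rw [Polynomial.leadingCoeff_eq_zero.1 h, Polynomial.natDegree_zero] at this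
  have := Q.m_lt; omega

theorem isRoots_root (lam : ℂ) : Q.IsRoots lam (Q.root lam) := by
  intro z
  have := congrArg (Polynomial.eval z) (Q.factor lam)
  simpa [f, Polynomial.eval_prod] using this

variable {Q}

theorem IsRoots.poly {lam : ℂ} {v : Fin N → ℂ} (h : Q.IsRoots lam v) :
    Q.f lam = Polynomial.C Q.A.leadingCoeff * ∏ i, (Polynomial.X - Polynomial.C (v i)) := by
  apply Polynomial.funext
  intro z
  rw [h z]
  simp [Polynomial.eval_prod]

theorem IsRoots.eval_eq_zero_iff {lam : ℂ} {v : Fin N → ℂ} (h : Q.IsRoots lam v) (z : ℂ) :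
    (Q.f lam).eval z = 0 ↔ ∃ i, v i = z := by
  rw [h z, mul_eq_zero, or_iff_right Q.lead_ne, Finset.prod_eq_zero_iff]
  simp [sub_eq_zero, eq_comm]

theorem IsRoots.perm {lam : ℂ} {u v : Fin N → ℂ} (hu : Q.IsRoots lam u) (hv : Q.IsRoots lam v) :
    ∃ σ : Equiv.Perm (Fin N), ∀ i, u i = v (σ i) := by
  apply exists_perm_of_map_univ_eq
  have key : ∀ {w : Fin N → ℂ}, Q.IsRoots lam w → (Q.f lam).roots = Finset.univ.val.map w := by
    intro w hw
    rw [hw.poly, Polynomial.roots_C_mul _ Q.lead_ne]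
    rw [← Polynomial.roots_multiset_prod_X_sub_C (Finset.univ.val.map w), Multiset.map_map]
    rfl
  rw [← key hu, ← key hv]

theorem IsRoots.comp {lam : ℂ} {v : Fin N → ℂ} (h : Q.IsRoots lam v) (σ : Equiv.Perm (Fin N)) :
    Q.IsRoots lam (v ∘ σ) := by
  intro z
  rw [h z]
  congr 1
  exact (Equiv.prod_comp σ (fun i => z - v i)).symm

variable (Q) in
theorem f_coeff_zero (lam : ℂ) : (Q.f lam).eval 0 = Q.A.coeff 0 := by
  have := Q.q_pos
  simp [f, Polynomial.coeff_zero_eq_eval_zero, this.ne']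

theorem IsRoots.ne_zero {lam : ℂ} {v : Fin N → ℂ} (h : Q.IsRoots lam v) (i : Fin N) :
    v i ≠ 0 := by
  intro h0
  apply Q.coeff_zero_ne
  rw [← Q.f_coeff_zero lam, h.eval_eq_zero_iff]
  exact ⟨i, h0⟩

theorem IsRoots.prod_eq {lam : ℂ} {v : Fin N → ℂ} (h : Q.IsRoots lam v) :
    Q.A.leadingCoeff * ∏ i, v i = (-1) ^ N * Q.A.coeff 0 := by
  have := h 0
  rw [f_coeff_zero] at this
  rw [this]
  have h2 : ∏ i, (0 - v i) = (-1) ^ N * ∏ i, v i := by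
    simp [Finset.prod_neg]
  rw [h2]
  have h3 : ((-1 : ℂ) ^ N) * (-1) ^ N = 1 := by rw [← mul_pow]; simp
  linear_combination (-Q.A.leadingCoeff * ∏ i, v i) * h3

theorem IsRoots.of_injective {lam : ℂ} {v : Fin N → ℂ} (hv : Function.Injective v)
    (h : ∀ i, (Q.f lam).eval (v i) = 0) : Q.IsRoots lam v := by
  have hr := Q.isRoots_root lam
  have h1 : ∀ i, ∃ j, Q.root lam j = v i := fun i => (hr.eval_eq_zero_iff _).1 (h i)
  choose τ hτ using h1
  have hinj : Function.Injective τ := by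
    intro i j hij
    apply hv
    rw [← hτ, ← hτ, hij]
  have := hr.comp (Equiv.ofBijective τ (Finite.injective_iff_bijective.1 hinj))
  convert this using 1
  ext i
  simp [hτ]

theorem card_low (h : m ≤ N) : (low m N).card = m := by
  rw [low, Fin.card_filter_val_lt]
  omega

theorem Bottom.map {u v : Fin N → ℂ} {S : Finset (Fin N)} (σ : Equiv.Perm (Fin N))
    (h : ∀ i, u i = v (σ i)) (hS : Bottom m u S) : Bottom m v (S.map σ.toEmbedding) := by
  refine ⟨by simpa using hS.1, ?_⟩
  intro i hi j hj
  have h1 := hS.2 (σ.symm i) (by simpa [Finset.mem_map_equiv] using hi) (σ.symm j)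
    (by simpa [Finset.mem_map_equiv] using hj)
  simpa [h] using h1

theorem Bottom.unique {v : Fin N → ℂ} {S T : Finset (Fin N)} (hS : Bottom m v S)
    (hT : Bottom m v T) : S = T := by
  have : S ⊆ T := by
    by_contra hn
    obtain ⟨i, hi, hi'⟩ := Finset.not_subset.1 hn
    have : ¬ T ⊆ S := by
      intro h
      exact hn (Finset.eq_of_subset_of_card_le h (by rw [hS.1, hT.1])).ge
    obtain ⟨j, hj, hj'⟩ := Finset.not_subset.1 this
    exact absurd (hS.2 i hi j hj') (not_lt.2 (hT.2 j hj i hi').le)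
  exact Finset.eq_of_subset_of_card_le this (by rw [hS.1, hT.1])

/-- For sorted entries only the `m`-th and the `(m+1)`-st have to be compared. -/
theorem bottom_low_iff {v : Fin N → ℂ} (hv : Monotone fun i => ‖v i‖) (h0 : 0 < m) (hm : m < N) :
    Bottom m v (low m N) ↔ ‖v ⟨m - 1, by omega⟩‖ < ‖v ⟨m, hm⟩‖ := by
  constructor
  · intro h
    exact h.2 _ (by simp [low]; omega) _ (by simp [low])
  · intro h
    refine ⟨card_low hm.le, fun i hi j hj => ?_⟩
    simp only [low, Finset.mem_filter, Finset.mem_univ, true_and, not_lt] at hi hj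
    have h1 : ‖v i‖ ≤ ‖v ⟨m - 1, by omega⟩‖ := hv (Fin.le_def.2 (by simp; omega))
    have h2 : ‖v ⟨m, hm⟩‖ ≤ ‖v j‖ := hv (Fin.le_def.2 (by simpa using hj))
    linarith

theorem Bottom.eq_low {v : Fin N → ℂ} (hv : Monotone fun i => ‖v i‖) (hm : m ≤ N)
    {S : Finset (Fin N)} (h : Bottom m v S) : S = low m N := by
  by_contra hn
  have h1 : ¬ S ⊆ low m N := fun hs =>
    hn (Finset.eq_of_subset_of_card_le hs (by rw [card_low hm, h.1]))
  have h2 : ¬ low m N ⊆ S := fun hs =>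
    hn (Finset.eq_of_subset_of_card_le hs (by rw [card_low hm, h.1])).symm
  obtain ⟨i, hi, hi'⟩ := Finset.not_subset.1 h1
  obtain ⟨j, hj, hj'⟩ := Finset.not_subset.1 h2
  simp only [low, Finset.mem_filter, Finset.mem_univ, true_and, not_lt] at hi' hj
  have := h.2 i hi j hj'
  have h3 : ‖v j‖ ≤ ‖v i‖ := hv (Fin.le_def.2 (by omega))
  linarith

theorem notMem_Gam_iff_low {lam : ℂ} : lam ∉ Q.Gam ↔ Bottom m (Q.root lam) (low m N) := by
  rw [bottom_low_iff (Q.mono lam) Q.m_pos Q.m_lt]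
  have h : ‖Q.root lam ⟨m - 1, by have := Q.m_lt; omega⟩‖ ≤ ‖Q.root lam ⟨m, Q.m_lt⟩‖ :=
    Q.mono lam (Fin.le_def.2 (by simp))
  exact ⟨fun hn => lt_of_le_of_ne h hn, fun hl => hl.ne⟩

/-- Membership in `Γ` can be read off from any numbering of the roots. -/
theorem IsRoots.notMem_Gam_iff {lam : ℂ} {v : Fin N → ℂ} (h : Q.IsRoots lam v) :
    lam ∉ Q.Gam ↔ ∃ S, Bottom m v S := by
  rw [notMem_Gam_iff_low]
  constructor
  · intro hb
    obtain ⟨σ, hσ⟩ := (Q.isRoots_root lam).perm h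
    exact ⟨_, hb.map σ hσ⟩
  · rintro ⟨S, hS⟩
    obtain ⟨σ, hσ⟩ := h.perm (Q.isRoots_root lam)
    have := hS.map σ hσ
    rwa [this.eq_low (Q.mono lam) Q.m_lt.le] at this

theorem IsRoots.w_eq {lam : ℂ} {v : Fin N → ℂ} (h : Q.IsRoots lam v) {S : Finset (Fin N)}
    (hS : Bottom m v S) : Q.w lam = ∏ i ∈ S, v i := by
  obtain ⟨σ, hσ⟩ := h.perm (Q.isRoots_root lam)
  have := hS.map σ hσ
  rw [w, ← this.eq_low (Q.mono lam) Q.m_lt.le, Finset.prod_map]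
  exact Finset.prod_congr rfl fun i _ => (hσ i).symm

variable (Q) in
theorem w_ne_zero (lam : ℂ) : Q.w lam ≠ 0 :=
  Finset.prod_ne_zero_iff.2 fun i _ => (Q.isRoots_root lam).ne_zero i

/-- Replacing an index set of size `m` by the `m` smallest indices does not increase the modulus of
the product of the entries (exchange argument). -/
theorem norm_prod_low_le {v : Fin N → ℂ} (hv : Monotone fun i => ‖v i‖) (hm : m < N)
    {S : Finset (Fin N)} (hS : S.card = m) :
    ∏ i ∈ low m N, ‖v i‖ ≤ ∏ i ∈ S, ‖v i‖ := by
  classical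
  rw [← Finset.prod_sdiff (Finset.inter_subset_left : low m N ∩ S ⊆ low m N),
    ← Finset.prod_sdiff (Finset.inter_subset_right : low m N ∩ S ⊆ S)]
  apply mul_le_mul_of_nonneg_right _ (Finset.prod_nonneg fun _ _ => norm_nonneg _)
  have hc : (low m N \ (low m N ∩ S)).card = (S \ (low m N ∩ S)).card := by
    rw [Finset.card_sdiff_of_subset Finset.inter_subset_left,
      Finset.card_sdiff_of_subset Finset.inter_subset_right, hS, card_low hm.le]
  calc ∏ i ∈ low m N \ (low m N ∩ S), ‖v i‖
      ≤ ‖v ⟨m, hm⟩‖ ^ (low m N \ (low m N ∩ S)).card := by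
        rw [← Finset.prod_const]
        apply Finset.prod_le_prod (fun _ _ => norm_nonneg _)
        intro i hi
        simp only [low, Finset.mem_sdiff, Finset.mem_filter, Finset.mem_univ, true_and] at hi
        exact hv (Fin.le_def.2 (by simpa using hi.1.le))
    _ = ‖v ⟨m, hm⟩‖ ^ (S \ (low m N ∩ S)).card := by rw [hc]
    _ ≤ ∏ i ∈ S \ (low m N ∩ S), ‖v i‖ := by
        rw [← Finset.prod_const]
        apply Finset.prod_le_prod
        · intros; positivity
        · intro i hi
          simp only [low, Finset.mem_sdiff, Finset.mem_inter, Finset.mem_filter, Finset.mem_univ,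
            true_and] at hi
          exact hv (Fin.le_def.2 (by simp only; by_contra hc; exact hi.2 ⟨by omega, hi.1⟩))

/-- The product of the `m` smallest roots has the least modulus among all products of `m` roots. -/
theorem IsRoots.norm_w_le {lam : ℂ} {v : Fin N → ℂ} (h : Q.IsRoots lam v) {S : Finset (Fin N)}
    (hS : S.card = m) : ‖Q.w lam‖ ≤ ‖∏ i ∈ S, v i‖ := by
  obtain ⟨σ, hσ⟩ := h.perm (Q.isRoots_root lam)
  rw [w, norm_prod, norm_prod]
  refine (norm_prod_low_le (Q.mono lam) Q.m_lt
    (S := S.map σ.toEmbedding) (by simpa using hS)).trans ?_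
  rw [Finset.prod_map]
  exact (Finset.prod_congr rfl fun i _ => by simp [hσ i]).le

end Pencil

/-! ### Widom's determinant identity -/

/-- The banded Toeplitz matrix with symbol `z^{-m} g(z)` for a polynomial `g`. -/
def polyToeplitz (m n : ℕ) (g : ℂ[X]) : Matrix (Fin n) (Fin n) ℂ :=
  Matrix.of fun i j => (g * Polynomial.X ^ (j : ℕ)).coeff (m + i)

section Widom

variable (m r n : ℕ)

/-- The exponents `0, …, m-1`, then `m+n, …, m+n+r-1`, then the gap `m, …, m+n-1`. -/
def gapExponent : (Fin m ⊕ Fin r) ⊕ Fin n → ℕ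
  | .inl (.inl l) => l
  | .inl (.inr l) => m + n + l
  | .inr i => m + i

/-- The exponents `0, …, m+r+n-1` in their natural order. -/
def naturalExponent : (Fin m ⊕ Fin r) ⊕ Fin n → ℕ
  | .inl (.inl l) => l
  | .inl (.inr l) => m + l
  | .inr i => m + r + i

theorem gapExponent_lt (x) : gapExponent m r n x < m + r + n := by
  rcases x with (x | x) | x <;> simp only [gapExponent] <;> omega

theorem naturalExponent_lt (x) : naturalExponent m r n x < m + r + n := by
  rcases x with (x | x) | x <;> simp only [naturalExponent] <;> omega

theorem bijective_of_injective_exponent {e : (Fin m ⊕ Fin r) ⊕ Fin n → ℕ}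
    (hlt : ∀ x, e x < m + r + n) (he : Function.Injective e) :
    Function.Bijective (fun x => (⟨e x, hlt x⟩ : Fin (m + r + n))) := by
  rw [Fintype.bijective_iff_injective_and_card]
  exact ⟨fun x y h => he (Fin.mk.inj_iff.1 h), by simp⟩

theorem gapExponent_injective : Function.Injective (gapExponent m r n) := by
  rintro ((x | x) | x) ((y | y) | y) h <;> simp only [gapExponent] at h <;>
    (congr 2; omega)

theorem naturalExponent_injective : Function.Injective (naturalExponent m r n) := by
  rintro ((x | x) | x) ((y | y) | y) h <;> simp only [naturalExponent] at h <;>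
    (congr 2; omega)

/-- Both exponent functions enumerate `0, …, m+r+n-1`. -/
theorem exists_perm_exponent : ∃ σ : Equiv.Perm ((Fin m ⊕ Fin r) ⊕ Fin n),
    ∀ x, naturalExponent m r n (σ x) = gapExponent m r n x := by
  let e₁ := Equiv.ofBijective _ (bijective_of_injective_exponent m r n (gapExponent_lt m r n)
    (gapExponent_injective m r n))
  let e₂ := Equiv.ofBijective _ (bijective_of_injective_exponent m r n (naturalExponent_lt m r n)
    (naturalExponent_injective m r n))
  refine ⟨e₁.trans e₂.symm, fun x => ?_⟩
  have := e₂.apply_symm_apply (e₁ x)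
  simpa [e₁, e₂, Equiv.ofBijective] using congrArg Fin.val this

variable {m r n}

theorem sum_gapExponent {M : Type*} [AddCommMonoid M] (F : ℕ → M) :
    ∑ x, F (gapExponent m r n x) = ∑ i ∈ Finset.range (m + r + n), F i := by
  rw [Finset.sum_range]
  exact (bijective_of_injective_exponent m r n (gapExponent_lt m r n)
    (gapExponent_injective m r n)).sum_comp fun i => F i.val

/-- **Widom's determinant identity.** For a polynomial `g` of degree `m + r` with roots among the
`v_x`, the Toeplitz determinant times the Vandermonde determinant of `v` is up to sign a
generalized Vandermonde determinant whose exponents skip `m, …, m+n-1`. -/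
theorem det_polyToeplitz_mul_vandermonde (m r n : ℕ) : ∃ s : ℂ, s * s = 1 ∧
    ∀ (g : ℂ[X]) (v : Fin m ⊕ Fin r → ℂ), g.natDegree = m + r → (∀ x, g.eval (v x) = 0) →
      s * (Matrix.of fun x y => v x ^ naturalExponent m r n (.inl y)).det *
        (polyToeplitz m n g).det =
      g.leadingCoeff ^ n * (Matrix.of fun x y => v x ^ gapExponent m r n (.inl y)).det := by
  classical
  obtain ⟨σ, hσ⟩ := exists_perm_exponent m r n
  refine ⟨(Equiv.Perm.sign σ : ℤ), by rcases Int.units_eq_one_or (Equiv.Perm.sign σ) with h | h <;> simp [h], ?_⟩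
  intro g v hdeg hv
  -- The matrix `Φ x (col y)` of functionals applied to polynomials is computed in two ways: directly,
  -- and as the product of `B` (functionals on monomials) and `M` (coefficients of `col y`).
  let col : (Fin m ⊕ Fin r) ⊕ Fin n → ℂ[X] :=
    Sum.elim (fun y => Polynomial.X ^ gapExponent m r n (.inl y)) (fun j => g * Polynomial.X ^ (j : ℕ))
  let Φ : (Fin m ⊕ Fin r) ⊕ Fin n → ℂ[X] →ₗ[ℂ] ℂ :=
    Sum.elim (fun x => Polynomial.leval (v x)) (fun i => Polynomial.lcoeff ℂ (m + r + i))
  have hcol : ∀ y, (col y).natDegree < m + r + n := by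
    rintro (y | j)
    · simpa [col] using gapExponent_lt m r n (.inl y)
    · have : (col (.inr j)).natDegree ≤ (m + r) + j := by
        simp only [col, Sum.elim_inr]
        exact (Polynomial.natDegree_mul_le).trans (by simp [hdeg])
      omega
  let M : Matrix ((Fin m ⊕ Fin r) ⊕ Fin n) ((Fin m ⊕ Fin r) ⊕ Fin n) ℂ :=
    Matrix.of fun x y => (col y).coeff (gapExponent m r n x)
  let B : Matrix ((Fin m ⊕ Fin r) ⊕ Fin n) ((Fin m ⊕ Fin r) ⊕ Fin n) ℂ :=
    Matrix.of fun x y => Φ x (Polynomial.X ^ gapExponent m r n y)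
  let B₀ : Matrix ((Fin m ⊕ Fin r) ⊕ Fin n) ((Fin m ⊕ Fin r) ⊕ Fin n) ℂ :=
    Matrix.of fun x y => Φ x (Polynomial.X ^ naturalExponent m r n y)
  have hM : M.det = (polyToeplitz m n g).det := by
    have : M = Matrix.fromBlocks 1 (Matrix.of fun x j => M (.inl x) (.inr j)) 0
        (polyToeplitz m n g) := by
      ext (x | x) (y | y)
      · simp only [M, col, Matrix.of_apply, Sum.elim_inl, Polynomial.coeff_X_pow,
          Matrix.fromBlocks_apply₁₁, Matrix.one_apply]
        simp [(gapExponent_injective m r n).eq_iff]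
      · rfl
      · simp only [M, col, Matrix.of_apply, Sum.elim_inl, Polynomial.coeff_X_pow,
          Matrix.fromBlocks_apply₂₁, Matrix.zero_apply]
        rw [if_neg]
        intro h
        exact absurd (gapExponent_injective m r n h) (by simp)
      · simp [M, col, polyToeplitz, gapExponent]
    rw [this, Matrix.det_fromBlocks_zero₂₁, Matrix.det_one, one_mul]
  have hB : B.det = (Equiv.Perm.sign σ : ℤ) * B₀.det := by
    have : B = B₀.submatrix id σ := by
      ext x y
      simp [B, B₀, hσ]
    rw [this, Matrix.det_permute']
  have hB₀ : B₀.det = (Matrix.of fun x y => v x ^ naturalExponent m r n (.inl y)).det := by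
    have : B₀ = Matrix.fromBlocks (Matrix.of fun x y => v x ^ naturalExponent m r n (.inl y))
        (Matrix.of fun x j => B₀ (.inl x) (.inr j)) 0 1 := by
      ext (x | x) (y | y)
      · simp [B₀, Φ, Polynomial.leval]
      · rfl
      · simp only [B₀, Φ, Matrix.of_apply, Sum.elim_inr, Polynomial.lcoeff_apply,
          Polynomial.coeff_X_pow, Matrix.fromBlocks_apply₂₁, Matrix.zero_apply]
        rw [if_neg]
        rcases y with y | y <;> simp only [naturalExponent] <;> omega
      · simp only [B₀, Φ, Matrix.of_apply, Sum.elim_inr, Polynomial.lcoeff_apply,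
          Polynomial.coeff_X_pow, Matrix.fromBlocks_apply₂₂, Matrix.one_apply, naturalExponent]
        simp [Fin.ext_iff]
    rw [this, Matrix.det_fromBlocks_zero₂₁, Matrix.det_one, mul_one]
  have hBM : ∀ x y, (B * M) x y = Φ x (col y) := by
    intro x y
    conv_rhs => rw [Polynomial.as_sum_range' (col y) _ (hcol y), map_sum]
    rw [← sum_gapExponent (m := m) (r := r) (n := n)
      (fun i => Φ x (Polynomial.monomial i ((col y).coeff i))), Matrix.mul_apply]
    refine Finset.sum_congr rfl fun z _ => ?_
    rw [← Polynomial.C_mul_X_pow_eq_monomial, ← Polynomial.smul_eq_C_mul, map_smul, smul_eq_mul,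
      mul_comm]
    rfl
  have hBM' : (B * M).det = g.leadingCoeff ^ n *
      (Matrix.of fun x y => v x ^ gapExponent m r n (.inl y)).det := by
    have : B * M = Matrix.fromBlocks (Matrix.of fun x y => v x ^ gapExponent m r n (.inl y)) 0
        (Matrix.of fun i y => (B * M) (.inr i) (.inl y))
        (Matrix.of fun i j : Fin n => (g * Polynomial.X ^ (j : ℕ)).coeff (m + r + i)) := by
      ext (x | x) (y | y)
      · simp [hBM, Φ, col, Polynomial.leval]
      · simp [hBM, Φ, col, Polynomial.leval, hv]
      · rfl
      · simp [hBM, Φ, col]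
    rw [this, Matrix.det_fromBlocks_zero₁₂, mul_comm]
    congr 1
    rw [Matrix.det_of_isUpperTriangular]
    · simp [Polynomial.coeff_mul_X_pow', Polynomial.leadingCoeff, hdeg]
    · intro i j hij
      simp only [id] at hij
      simp only [Matrix.of_apply, Polynomial.coeff_mul_X_pow']
      split_ifs
      · apply Polynomial.coeff_eq_zero_of_natDegree_lt
        have : (j : ℕ) < i := hij
        omega
      · rfl
  rw [← hBM', Matrix.det_mul, hB, hB₀, hM]

/-- The Vandermonde determinant, factored according to the two groups of nodes. -/
theorem det_natural_eq (v : Fin m ⊕ Fin r → ℂ) :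
    (Matrix.of fun x y => v x ^ naturalExponent m r n (.inl y)).det =
      (Matrix.vandermonde (v ∘ Sum.inl)).det * (Matrix.vandermonde (v ∘ Sum.inr)).det *
        ∏ i : Fin m, ∏ j : Fin r, (v (.inr j) - v (.inl i)) := by
  have h1 : (Matrix.of fun x y => v x ^ naturalExponent m r n (.inl y)) =
      (Matrix.vandermonde (v ∘ finSumFinEquiv.symm)).submatrix finSumFinEquiv finSumFinEquiv := by
    ext x (y | y) <;> simp [Matrix.vandermonde_apply, naturalExponent]
  rw [h1, Matrix.det_submatrix_equiv_self]
  have h2 : ∀ {k : ℕ} (u : Fin k → ℂ), (Matrix.vandermonde u).det =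
      ∏ i, ∏ j, if i < j then u j - u i else 1 := by
    intro k u
    rw [Matrix.det_vandermonde]
    refine Finset.prod_congr rfl fun i _ => ?_
    rw [← Finset.prod_filter]
    exact Finset.prod_congr (by ext; simp) fun _ _ => rfl
  rw [h2, h2, h2, Fin.prod_univ_add]
  simp only [Fin.prod_univ_add, Function.comp_apply, finSumFinEquiv_symm_apply_castAdd,
    finSumFinEquiv_symm_apply_natAdd, Fin.lt_def, Fin.val_castAdd, Fin.val_natAdd]
  have h3 : ∀ (i : Fin m) (j : Fin r), (i : ℕ) < m + j := fun i j => by omega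
  have h4 : ∀ (i : Fin m) (j : Fin r), ¬ (m + (j : ℕ) < i) := fun i j => by omega
  simp only [h3, h4, if_true, if_false, Finset.prod_const_one, one_mul, add_lt_add_iff_left,
    Finset.prod_mul_distrib]
  ring

/-- The generalized Vandermonde matrix with exponents `0, …, m-1, m+n, …, m+n+r-1`, with rows and
columns rescaled: its off-diagonal blocks decay if `‖u i‖ < ρ < ‖t j‖`. -/
def scaledBlocks (n : ℕ) (ρ : ℂ) (u : Fin m → ℂ) (t : Fin r → ℂ) :
    Matrix (Fin m ⊕ Fin r) (Fin m ⊕ Fin r) ℂ :=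
  Matrix.fromBlocks (Matrix.vandermonde u) (Matrix.of fun i l => u i ^ (l : ℕ) * (u i / ρ) ^ (m + n))
    (Matrix.of fun j l => t j ^ (l : ℕ) * (ρ / t j) ^ (m + n)) (Matrix.vandermonde t)

/-- The large nodes `v (.inr j)` contribute their full power `m + n` to the dominant term. -/
theorem det_gap_eq (v : Fin m ⊕ Fin r → ℂ) {ρ : ℂ} (hρ : ρ ≠ 0) (hv : ∀ j, v (.inr j) ≠ 0) :
    (Matrix.of fun x y => v x ^ gapExponent m r n (.inl y)).det =
      (∏ j, v (.inr j)) ^ (m + n) * (scaledBlocks n ρ (v ∘ Sum.inl) (v ∘ Sum.inr)).det := by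
  have h1 : (Matrix.of fun x y => v x ^ gapExponent m r n (.inl y)) = Matrix.of fun x y =>
      (Sum.elim (fun _ => 1) (fun j => (v (.inr j) / ρ) ^ (m + n)) x : ℂ) *
        (Matrix.of fun x y => (Sum.elim (fun _ => 1) (fun _ => ρ ^ (m + n)) y : ℂ) *
          scaledBlocks n ρ (v ∘ Sum.inl) (v ∘ Sum.inr) x y) x y := by
    ext (x | x) (y | y)
    · simp [gapExponent, scaledBlocks, Matrix.vandermonde_apply]
    · simp only [gapExponent, scaledBlocks, div_pow, Matrix.of_apply, Sum.elim_inl, Sum.elim_inr,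
        Matrix.fromBlocks_apply₁₂, Function.comp_apply]
      field_simp
      ring
    · have := hv x
      simp only [gapExponent, scaledBlocks, div_pow, Matrix.of_apply, Sum.elim_inl, Sum.elim_inr,
        Matrix.fromBlocks_apply₂₁, Function.comp_apply]
      field_simp
    · simp only [gapExponent, scaledBlocks, div_pow, Matrix.of_apply, Sum.elim_inr,
        Matrix.fromBlocks_apply₂₂, Function.comp_apply, Matrix.vandermonde_apply]
      field_simp
      ring
  rw [h1, Matrix.det_mul_column, Matrix.det_mul_row]
  simp only [Fintype.prod_sum_type, Sum.elim_inl, Sum.elim_inr, Finset.prod_const_one, one_mul,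
    Finset.prod_const, Finset.card_univ, Fintype.card_fin, div_pow, Finset.prod_div_distrib,
    Finset.prod_pow]
  field_simp

theorem prod_sub_eq (u : Fin m → ℂ) (t : Fin r → ℂ) (ht : ∀ j, t j ≠ 0) :
    ∏ i, ∏ j, (t j - u i) = (∏ j, t j) ^ m * ∏ i, ∏ j, (1 - u i / t j) := by
  have : ∀ i, ∏ j, (t j - u i) = (∏ j, t j) * ∏ j, (1 - u i / t j) := by
    intro i
    rw [← Finset.prod_mul_distrib]
    refine Finset.prod_congr rfl fun j _ => ?_
    have := ht j
    field_simp
  simp [this, Finset.prod_mul_distrib]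

/-- Widom's identity with the exponentially dominant term split off. -/
theorem det_polyToeplitz_eq (m r n : ℕ) : ∃ s : ℂ, s * s = 1 ∧
    ∀ (g : ℂ[X]) (v : Fin m ⊕ Fin r → ℂ) (ρ : ℂ), g.natDegree = m + r →
      (∀ x, g.eval (v x) = 0) → (∀ x, v x ≠ 0) → ρ ≠ 0 →
      s * (∏ i, ∏ j, (1 - v (.inl i) / v (.inr j))) *
          ((Matrix.vandermonde (v ∘ Sum.inl)).det * (Matrix.vandermonde (v ∘ Sum.inr)).det) *
          (polyToeplitz m n g).det =
        (g.leadingCoeff * ∏ j, v (.inr j)) ^ n *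
          (scaledBlocks n ρ (v ∘ Sum.inl) (v ∘ Sum.inr)).det := by
  obtain ⟨s, hs, h⟩ := det_polyToeplitz_mul_vandermonde m r n
  refine ⟨s, hs, fun g v ρ hg hv h0 hρ => ?_⟩
  have h1 := h g v hg hv
  rw [det_natural_eq, det_gap_eq v hρ (fun j => h0 _),
    prod_sub_eq (fun i => v (.inl i)) (fun j => v (.inr j)) (fun j => h0 _)] at h1
  have h2 : (∏ j, v (.inr j)) ^ m ≠ 0 := pow_ne_zero _ (Finset.prod_ne_zero_iff.2 fun j _ => h0 _)
  apply mul_left_cancel₀ h2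
  rw [mul_pow]
  rw [pow_add] at h1
  linear_combination h1

/-- The rescaled generalized Vandermonde determinants converge, locally uniformly in parameters. -/
theorem tendsto_det_scaledBlocks {ι : Type*} {l : Filter ι} {N : ι → ℕ} (hN : Tendsto N l atTop)
    {u : ι → Fin m → ℂ} {t : ι → Fin r → ℂ} {u₀ : Fin m → ℂ} {t₀ : Fin r → ℂ}
    (hu : Tendsto u l (𝓝 u₀)) (ht : Tendsto t l (𝓝 t₀)) {ρ : ℂ} (hu₀ : ∀ i, ‖u₀ i‖ < ‖ρ‖)
    (ht₀ : ∀ j, ‖ρ‖ < ‖t₀ j‖) :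
    Tendsto (fun x => (scaledBlocks (N x) ρ (u x) (t x)).det) l
      (𝓝 ((Matrix.vandermonde u₀).det * (Matrix.vandermonde t₀).det)) := by
  have key : ∀ {a : ι → ℂ} {a₀ : ℂ}, Tendsto a l (𝓝 a₀) → ‖a₀‖ < 1 →
      Tendsto (fun x => a x ^ (m + N x)) l (𝓝 0) := by
    intro a a₀ ha h1
    obtain ⟨c, hc1, hc2⟩ := exists_between h1
    have h2 : ∀ᶠ x in l, ‖a x‖ < c := ha.norm.eventually_lt_const hc1
    have h3 : Tendsto (fun x => c ^ (m + N x)) l (𝓝 0) :=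
      (tendsto_pow_atTop_nhds_zero_of_lt_one ((norm_nonneg _).trans hc1.le) hc2).comp
        (tendsto_atTop_mono (fun x => Nat.le_add_left (N x) m) hN)
    refine squeeze_zero_norm' ?_ h3
    filter_upwards [h2] with x hx
    rw [norm_pow]
    exact pow_le_pow_left₀ (norm_nonneg _) hx.le _
  have hu' : ∀ i, Tendsto (fun x => u x i) l (𝓝 (u₀ i)) := fun i => (tendsto_pi_nhds.1 hu) i
  have ht' : ∀ i, Tendsto (fun x => t x i) l (𝓝 (t₀ i)) := fun i => (tendsto_pi_nhds.1 ht) i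
  have h : Tendsto (fun x => scaledBlocks (N x) ρ (u x) (t x)) l
      (𝓝 (Matrix.fromBlocks (Matrix.vandermonde u₀) 0 0 (Matrix.vandermonde t₀))) := by
    refine tendsto_pi_nhds.2 fun x => tendsto_pi_nhds.2 fun y => ?_
    rcases x with i | j <;> rcases y with k | k
    · simpa [scaledBlocks, Matrix.vandermonde_apply] using (hu' i).pow k
    · have h1 : Tendsto (fun x => u x i / ρ) l (𝓝 (u₀ i / ρ)) := (hu' i).div_const ρ
      have h2 : ‖u₀ i / ρ‖ < 1 := by
        rw [norm_div]
        exact (div_lt_one ((norm_nonneg _).trans_lt (hu₀ i))).2 (hu₀ i)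
      simpa [scaledBlocks] using ((hu' i).pow k).mul (key h1 h2)
    · have h0 : 0 < ‖t₀ j‖ := (norm_nonneg _).trans_lt (ht₀ j)
      have h1 : Tendsto (fun x => ρ / t x j) l (𝓝 (ρ / t₀ j)) :=
        tendsto_const_nhds.div (ht' j) (norm_pos_iff.1 h0)
      have h2 : ‖ρ / t₀ j‖ < 1 := by
        rw [norm_div]
        exact (div_lt_one h0).2 (ht₀ j)
      simpa [scaledBlocks] using ((ht' j).pow k).mul (key h1 h2)
    · simpa [scaledBlocks, Matrix.vandermonde_apply] using (ht' j).pow k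
  have := (Continuous.matrix_det continuous_id).continuousAt.tendsto.comp h
  simpa [Matrix.det_fromBlocks_zero₂₁, Function.comp_def] using this

end Widom

/-! ### Dependence of the roots on `λ` -/

namespace Pencil

variable {N m : ℕ} (Q : Pencil N m)

theorem eval_f (lam z : ℂ) : (Q.f lam).eval z = Q.A.eval z - lam * z ^ Q.q := by
  simp [f]

/-- A Cauchy type bound: the roots stay bounded as long as `λ` does. -/
theorem norm_root_le (lam : ℂ) (i : Fin N) :
    ‖Q.root lam i‖ ≤ 1 + (‖lam‖ + ∑ l ∈ Finset.range N, ‖Q.A.coeff l‖) / ‖Q.A.leadingCoeff‖ := by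
  set z := Q.root lam i with hz
  set S := ∑ l ∈ Finset.range N, ‖Q.A.coeff l‖
  have hS : 0 ≤ S := Finset.sum_nonneg fun _ _ => norm_nonneg _
  have hl : 0 < ‖Q.A.leadingCoeff‖ := norm_pos_iff.2 Q.lead_ne
  by_cases h1 : ‖z‖ ≤ 1
  · have : 0 ≤ (‖lam‖ + S) / ‖Q.A.leadingCoeff‖ := by positivity
    linarith
  push Not at h1
  have h0 : (Q.f lam).eval z = 0 := ((Q.isRoots_root lam).eval_eq_zero_iff z).2 ⟨i, rfl⟩
  rw [eval_f, Polynomial.eval_eq_sum_range, Q.natDegree_A, Finset.sum_range_succ] at h0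
  have hlead : Q.A.coeff N = Q.A.leadingCoeff := by rw [Polynomial.leadingCoeff, Q.natDegree_A]
  rw [hlead] at h0
  have h2 : Q.A.leadingCoeff * z ^ N = lam * z ^ Q.q - ∑ l ∈ Finset.range N, Q.A.coeff l * z ^ l := by
    linear_combination h0
  have h3 : ‖Q.A.leadingCoeff‖ * ‖z‖ ^ N ≤ (‖lam‖ + S) * ‖z‖ ^ (N - 1) := by
    rw [← norm_pow, ← norm_mul, h2, add_mul]
    refine (norm_sub_le _ _).trans (add_le_add ?_ ?_)
    · rw [norm_mul, norm_pow]
      have := Q.q_lt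
      gcongr
      · exact h1.le
      · omega
    · rw [Finset.sum_mul]
      refine (norm_sum_le _ _).trans (Finset.sum_le_sum fun l hl => ?_)
      rw [norm_mul, norm_pow]
      have := Finset.mem_range.1 hl
      gcongr
      · exact h1.le
      · omega
  have hN : N = (N - 1) + 1 := by have := Q.m_lt; omega
  have h4 : ‖Q.A.leadingCoeff‖ * ‖z‖ ≤ ‖lam‖ + S := by
    have hp : 0 < ‖z‖ ^ (N - 1) := by positivity
    have h5 : ‖z‖ ^ N = ‖z‖ ^ (N - 1) * ‖z‖ := by rw [← pow_succ, ← hN]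
    rw [h5] at h3
    exact le_of_mul_le_mul_right (by linarith) hp
  have : ‖z‖ ≤ (‖lam‖ + S) / ‖Q.A.leadingCoeff‖ := by
    rw [le_div_iff₀ hl]; linarith
  linarith

/-- Limits of sorted root vectors are sorted root vectors. -/
theorem exists_tendsto_root {lam₀ : ℂ} (g : Ultrafilter ℂ) (hg : (g : Filter ℂ) ≤ 𝓝 lam₀) :
    ∃ v : Fin N → ℂ, Q.IsRoots lam₀ v ∧ (Monotone fun i => ‖v i‖) ∧ Tendsto Q.root g (𝓝 v) := by
  set R := 1 + ((‖lam₀‖ + 1) + ∑ l ∈ Finset.range N, ‖Q.A.coeff l‖) / ‖Q.A.leadingCoeff‖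
  have hK : IsCompact (Set.univ.pi fun _ : Fin N => Metric.closedBall (0 : ℂ) R) :=
    isCompact_univ_pi fun _ => isCompact_closedBall _ _
  have hev : ∀ᶠ lam in (g : Filter ℂ), Q.root lam ∈
      (Set.univ.pi fun _ : Fin N => Metric.closedBall (0 : ℂ) R) := by
    have h1 : ∀ᶠ lam : ℂ in 𝓝 lam₀, ‖lam‖ < ‖lam₀‖ + 1 :=
      continuous_norm.continuousAt.eventually_lt_const (by linarith)
    filter_upwards [hg h1] with lam hlam i _
    rw [mem_closedBall_zero_iff]
    refine (Q.norm_root_le lam i).trans ?_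
    simp only [R]
    gcongr
  obtain ⟨v, -, hv⟩ := hK.ultrafilter_le_nhds (g.map Q.root) (le_principal_iff.2 hev)
  have hv' : Tendsto Q.root g (𝓝 v) := hv
  have hi : ∀ i, Tendsto (fun lam => Q.root lam i) g (𝓝 (v i)) := tendsto_pi_nhds.1 hv'
  refine ⟨v, ?_, ?_, hv'⟩
  · intro z
    have h1 : Tendsto (fun lam => (Q.f lam).eval z) g (𝓝 ((Q.f lam₀).eval z)) := by
      simp only [eval_f]
      exact tendsto_const_nhds.sub ((tendsto_id.mono_left hg).mul_const _)
    have h2 : Tendsto (fun lam => (Q.f lam).eval z) g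
        (𝓝 (Q.A.leadingCoeff * ∏ i, (z - v i))) := by
      have : (fun lam => (Q.f lam).eval z) =
          fun lam => Q.A.leadingCoeff * ∏ i, (z - Q.root lam i) :=
        funext fun lam => Q.isRoots_root lam z
      rw [this]
      exact (tendsto_finsetProd _ fun i _ => tendsto_const_nhds.sub (hi i)).const_mul _
    exact tendsto_nhds_unique h1 h2
  · intro i j hij
    exact le_of_tendsto_of_tendsto' (hi i).norm (hi j).norm fun lam => Q.mono lam hij

variable {Q} in
theorem IsRoots.norm_eq {lam : ℂ} {v : Fin N → ℂ} (h : Q.IsRoots lam v)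
    (hv : Monotone fun i => ‖v i‖) (i : Fin N) : ‖v i‖ = ‖Q.root lam i‖ := by
  obtain ⟨σ, hσ⟩ := h.perm (Q.isRoots_root lam)
  have := Tuple.unique_monotone (f := fun i => ‖Q.root lam i‖) (σ := σ) (τ := Equiv.refl _)
    (fun i j hij => by simpa [hσ] using hv hij) (fun i j hij => Q.mono lam hij)
  have := congrFun this i
  simpa [hσ] using this

theorem continuous_norm_root (i : Fin N) : Continuous fun lam => ‖Q.root lam i‖ := by
  rw [continuous_iff_ultrafilter]
  intro lam₀ g hg
  obtain ⟨v, hv, hmono, ht⟩ := Q.exists_tendsto_root g hg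
  rw [← hv.norm_eq hmono]
  exact (tendsto_pi_nhds.1 ht i).norm

theorem isClosed_Gam : IsClosed Q.Gam :=
  isClosed_eq (Q.continuous_norm_root _) (Q.continuous_norm_root _)

theorem continuous_norm_w : Continuous fun lam => ‖Q.w lam‖ := by
  simp only [w, norm_prod]
  exact continuous_finsetProd _ fun i _ => Q.continuous_norm_root i

/-- The Laurent polynomial `A(z) / z^q`, whose `λ`-points are the roots of `A - λ X^q`. -/
def sym (z : ℂ) : ℂ := Q.A.eval z / z ^ Q.q

theorem sym_eq_iff {z lam : ℂ} (hz : z ≠ 0) : Q.sym z = lam ↔ (Q.f lam).eval z = 0 := by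
  rw [sym, div_eq_iff (pow_ne_zero _ hz), eval_f, sub_eq_zero]

theorem hasDerivAt_sym {z : ℂ} (hz : z ≠ 0) :
    HasDerivAt Q.sym ((Q.f (Q.sym z)).derivative.eval z / z ^ Q.q) z := by
  have h1 : HasDerivAt Q.sym _ z :=
    (Q.A.hasDerivAt z).div (hasDerivAt_pow Q.q z) (pow_ne_zero _ hz)
  refine h1.congr_deriv ?_
  have : (Q.f (Q.sym z)).derivative.eval z =
      Q.A.derivative.eval z - Q.sym z * (Q.q * z ^ (Q.q - 1)) := by
    simp [f, Polynomial.derivative_X_pow]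
  rw [this, sym]
  field_simp

theorem analyticAt_sym {z : ℂ} (hz : z ≠ 0) : AnalyticAt ℂ Q.sym z := by
  have h1 : AnalyticAt ℂ (fun z => Q.A.eval z) z := by
    have := (AnalyticAt.aeval_polynomial (analyticAt_id (𝕜 := ℂ) (z := z)) Q.A)
    simpa [Polynomial.aeval_def, Polynomial.eval₂_eq_eval_map] using this
  exact h1.div (analyticAt_id.pow _) (pow_ne_zero _ hz)

theorem deriv_f_ne {lam : ℂ} {v : Fin N → ℂ} (hv : Q.IsRoots lam v)
    (hinj : Function.Injective v) (i : Fin N) : (Q.f lam).derivative.eval (v i) ≠ 0 := by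
  have h1 : Q.f lam = (Polynomial.X - Polynomial.C (v i)) * (Polynomial.C Q.A.leadingCoeff *
      ∏ j ∈ Finset.univ.erase i, (Polynomial.X - Polynomial.C (v j))) := by
    rw [hv.poly, ← Finset.mul_prod_erase Finset.univ _ (Finset.mem_univ i)]
    ring
  rw [h1, Polynomial.derivative_mul]
  simp only [Polynomial.derivative_sub, Polynomial.derivative_X, Polynomial.derivative_C, sub_zero,
    one_mul, Polynomial.eval_add, Polynomial.eval_mul, Polynomial.eval_C, Polynomial.eval_sub,
    Polynomial.eval_X, sub_self, zero_mul, add_zero, Polynomial.eval_prod]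
  refine mul_ne_zero Q.lead_ne (Finset.prod_ne_zero_iff.2 fun j hj => sub_ne_zero.2 fun h => ?_)
  exact (Finset.ne_of_mem_erase hj) (hinj h).symm

theorem deriv_sym_ne {lam : ℂ} {v : Fin N → ℂ} (hv : Q.IsRoots lam v)
    (hinj : Function.Injective v) (i : Fin N) : deriv Q.sym (v i) ≠ 0 := by
  have h0 := hv.ne_zero i
  have h1 : Q.sym (v i) = lam := (Q.sym_eq_iff h0).2 ((hv.eval_eq_zero_iff _).2 ⟨i, rfl⟩)
  rw [(Q.hasDerivAt_sym h0).deriv, h1]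
  exact div_ne_zero (Q.deriv_f_ne hv hinj i) (pow_ne_zero _ h0)

/-- `ψ` consists of analytic functions numbering the roots of `A - λ X^q` near `λ₀`, where the
roots are distinct. -/
structure LocalRoots (lam₀ : ℂ) (ψ : Fin N → ℂ → ℂ) : Prop where
  analytic : ∀ i, AnalyticAt ℂ (ψ i) lam₀
  roots : Q.IsRoots lam₀ fun i => ψ i lam₀
  inj : Function.Injective fun i => ψ i lam₀
  logDeriv_eq : ∀ i, logDeriv (ψ i) lam₀ = 1 / (ψ i lam₀ * deriv Q.sym (ψ i lam₀))

/-- At distinct roots the local inverses of `sym` are analytic root functions. -/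
theorem exists_localRoots {lam₀ : ℂ} {v : Fin N → ℂ} (hv : Q.IsRoots lam₀ v)
    (hinj : Function.Injective v) :
    ∃ ψ : Fin N → ℂ → ℂ, (∀ i, ψ i lam₀ = v i) ∧ ∀ᶠ lam in 𝓝 lam₀, Q.LocalRoots lam ψ := by
  have hsym : ∀ i, Q.sym (v i) = lam₀ := fun i =>
    (Q.sym_eq_iff (hv.ne_zero i)).2 ((hv.eval_eq_zero_iff _).2 ⟨i, rfl⟩)
  have key : ∀ i, ∃ φ : ℂ → ℂ, AnalyticAt ℂ φ lam₀ ∧ φ lam₀ = v i ∧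
      ∀ᶠ lam in 𝓝 lam₀, Q.sym (φ lam) = lam := by
    intro i
    have ha := Q.analyticAt_sym (hv.ne_zero i)
    have hd := Q.deriv_sym_ne hv hinj i
    have h1 := ha.analyticAt_localInverse hd
    refine ⟨_, by rw [hsym i] at h1; exact h1, ?_, ?_⟩
    · have := HasStrictFDerivAt.localInverse_apply_image
        (ha.hasStrictDerivAt.hasStrictFDerivAt_equiv hd)
      rw [hsym i] at this
      exact this
    · have := HasStrictFDerivAt.eventually_right_inverse
        (ha.hasStrictDerivAt.hasStrictFDerivAt_equiv hd)
      rw [hsym i] at this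
      exact this
  choose ψ hψa hψv hψs using key
  refine ⟨ψ, hψv, ?_⟩
  have hne : ∀ᶠ lam in 𝓝 lam₀, ∀ i, ψ i lam ≠ 0 := by
    rw [eventually_all]
    exact fun i => (hψa i).continuousAt.eventually_ne (by rw [hψv]; exact hv.ne_zero i)
  have hin : ∀ᶠ lam in 𝓝 lam₀, Function.Injective fun i => ψ i lam := by
    have : ∀ᶠ lam in 𝓝 lam₀, ∀ i j, i ≠ j → ψ i lam ≠ ψ j lam := by
      rw [eventually_all]; intro i
      rw [eventually_all]; intro j
      by_cases hij : i = j
      · simp [hij]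
      · have h1 : ContinuousAt (fun lam => ψ i lam - ψ j lam) lam₀ :=
          (hψa i).continuousAt.sub (hψa j).continuousAt
        filter_upwards [h1.eventually_ne (y := 0) (by
          simp only [hψv]; exact sub_ne_zero.2 fun h => hij (hinj h))] with lam h _
        exact sub_ne_zero.1 h
    filter_upwards [this] with lam h i j hij
    by_contra hne
    exact h i j hne hij
  have hs : ∀ᶠ lam in 𝓝 lam₀, ∀ i, Q.sym (ψ i lam) = lam := eventually_all.2 hψs
  have ha : ∀ᶠ lam in 𝓝 lam₀, ∀ i, AnalyticAt ℂ (ψ i) lam :=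
    eventually_all.2 fun i => (hψa i).eventually_analyticAt
  filter_upwards [hne, hin, hs, ha, eventually_eventually_nhds.2 hs] with lam h1 h2 h3 h4 h5
  have hr : Q.IsRoots lam fun i => ψ i lam :=
    IsRoots.of_injective h2 fun i => (Q.sym_eq_iff (h1 i)).1 (h3 i)
  refine ⟨h4, hr, h2, fun i => ?_⟩
  have h6 : HasDerivAt (fun x => Q.sym (ψ i x)) (deriv Q.sym (ψ i lam) * deriv (ψ i) lam) lam :=
    ((Q.analyticAt_sym (h1 i)).differentiableAt.hasDerivAt).comp lam
      (h4 i).differentiableAt.hasDerivAt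
  have h7 : HasDerivAt (fun x => Q.sym (ψ i x)) 1 lam :=
    (hasDerivAt_id lam).congr_of_eventuallyEq (h5.mono fun x hx => hx i)
  have h8 := h6.unique h7
  have h9 := Q.deriv_sym_ne hr h2 i
  have h10 := h1 i
  rw [logDeriv_apply]
  field_simp
  linear_combination h8

/-- The points `λ` for which `A - λ X^q` has distinct roots. -/
def Simple : Set ℂ := {lam | Function.Injective (Q.root lam)}

variable {Q} in
theorem LocalRoots.simple {lam : ℂ} {ψ : Fin N → ℂ → ℂ} (h : Q.LocalRoots lam ψ) :
    lam ∈ Q.Simple := by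
  obtain ⟨σ, hσ⟩ := (Q.isRoots_root lam).perm h.roots
  intro i j hij
  rw [hσ, hσ] at hij
  exact σ.injective (h.inj hij)

theorem deriv_f_eq_zero {lam : ℂ} {v : Fin N → ℂ} (hv : Q.IsRoots lam v) {i j : Fin N}
    (hij : i ≠ j) (h : v i = v j) : (Q.f lam).derivative.eval (v i) = 0 := by
  have h1 : Q.f lam = (Polynomial.X - Polynomial.C (v i)) * ((Polynomial.X - Polynomial.C (v i)) *
      (Polynomial.C Q.A.leadingCoeff *
      ∏ l ∈ (Finset.univ.erase i).erase j, (Polynomial.X - Polynomial.C (v l)))) := by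
    rw [hv.poly, ← Finset.mul_prod_erase Finset.univ _ (Finset.mem_univ i),
      ← Finset.mul_prod_erase (Finset.univ.erase i) _ (Finset.mem_erase.2 ⟨hij.symm, Finset.mem_univ j⟩),
      h]
    ring
  rw [h1, Polynomial.derivative_mul]
  simp

/-- A multiple root is a zero of the polynomial `z A' - q A`, whose constant coefficient is not zero. -/
theorem finite_compl_simple : Q.Simpleᶜ.Finite := by
  set D : ℂ[X] := Polynomial.X * Q.A.derivative - Polynomial.C (Q.q : ℂ) * Q.A with hD
  have hD0 : D ≠ 0 := by
    intro h
    have h1 : D.coeff N = ((N : ℂ) - Q.q) * Q.A.leadingCoeff := by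
      obtain ⟨n, hn⟩ : ∃ n, n + 1 = N := ⟨N - 1, by have := Q.m_lt; omega⟩
      have h2 : Q.A.coeff N = Q.A.leadingCoeff := by rw [Polynomial.leadingCoeff, Q.natDegree_A]
      have h3 : D.coeff (n + 1) = (((n + 1 : ℕ) : ℂ) - Q.q) * Q.A.coeff (n + 1) := by
        rw [hD, Polynomial.coeff_sub, Polynomial.coeff_X_mul, Polynomial.coeff_derivative,
          Polynomial.coeff_C_mul]
        push_cast
        ring
      rwa [hn, h2] at h3
    rw [h, Polynomial.coeff_zero] at h1
    rcases mul_eq_zero.1 h1.symm with h2 | h2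
    · have := Q.q_lt
      rw [sub_eq_zero] at h2
      have : N = Q.q := by exact_mod_cast h2
      omega
    · exact Q.lead_ne h2
  refine ((D.roots.toFinset.finite_toSet).image Q.sym).subset ?_
  intro lam hlam
  simp only [Simple, Set.mem_compl_iff, Set.mem_ofPred_eq, Function.Injective, not_forall] at hlam
  obtain ⟨i, j, hij, hne⟩ := hlam
  have hr := Q.isRoots_root lam
  have h0 := hr.ne_zero i
  have h1 := (hr.eval_eq_zero_iff _).2 ⟨i, rfl⟩
  have h2 := Q.deriv_f_eq_zero hr hne hij
  refine ⟨Q.root lam i, ?_, (Q.sym_eq_iff h0).2 h1⟩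
  simp only [Finset.mem_coe, Multiset.mem_toFinset, Polynomial.mem_roots hD0,
    Polynomial.IsRoot.def]
  rw [eval_f] at h1
  have h3 : (Q.f lam).derivative.eval (Q.root lam i) = Q.A.derivative.eval (Q.root lam i) -
      lam * (Q.q * Q.root lam i ^ (Q.q - 1)) := by simp [f, Polynomial.derivative_X_pow]
  rw [h3] at h2
  have h4 : Q.root lam i ^ Q.q = Q.root lam i ^ (Q.q - 1) * Q.root lam i := by
    rw [← pow_succ, Nat.sub_add_cancel Q.q_pos]
  simp only [hD, Polynomial.eval_sub, Polynomial.eval_mul, Polynomial.eval_X, Polynomial.eval_C]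
  rw [h4] at h1
  linear_combination Q.root lam i * h2 - Q.q * h1

theorem eventually_simple (lam₀ : ℂ) : ∀ᶠ lam in 𝓝[≠] lam₀, lam ∈ Q.Simple := by
  have h : (Q.Simpleᶜ \ {lam₀})ᶜ ∈ 𝓝 lam₀ :=
    ((Q.finite_compl_simple.subset Set.sdiff_subset).isClosed.isOpen_compl).mem_nhds (by simp)
  filter_upwards [mem_nhdsWithin_of_mem_nhds h, self_mem_nhdsWithin] with lam h1 h2
  by_contra h3
  exact h1 ⟨h3, h2⟩

theorem eventually_bottom {lam₀ : ℂ} {ψ : Fin N → ℂ → ℂ} (hc : ∀ i, ContinuousAt (ψ i) lam₀)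
    {S : Finset (Fin N)} (hS : Bottom m (fun i => ψ i lam₀) S) :
    ∀ᶠ lam in 𝓝 lam₀, Bottom m (fun i => ψ i lam) S := by
  have : ∀ᶠ lam in 𝓝 lam₀, ∀ i, i ∈ S → ∀ j, j ∉ S → ‖ψ i lam‖ < ‖ψ j lam‖ := by
    rw [eventually_all]; intro i
    rw [eventually_imp_distrib_left]; intro hi
    rw [eventually_all]; intro j
    rw [eventually_imp_distrib_left]; intro hj
    exact (hc i).norm.eventually_lt (hc j).norm (hS.2 i hi j hj)
  exact this.mono fun lam h => ⟨hS.1, h⟩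

/-- Near a point off `Γ` with distinct roots, `w` is a product of `m` analytic roots. -/
theorem w_eventuallyEq {lam₀ : ℂ} {ψ : Fin N → ℂ → ℂ} (hψ : ∀ᶠ lam in 𝓝 lam₀, Q.LocalRoots lam ψ)
    {S : Finset (Fin N)} (hS : Bottom m (fun i => ψ i lam₀) S) :
    Q.w =ᶠ[𝓝 lam₀] fun lam => ∏ i ∈ S, ψ i lam := by
  filter_upwards [hψ, eventually_bottom (fun i => (hψ.self_of_nhds.analytic i).continuousAt) hS]
    with lam h1 h2
  exact h1.roots.w_eq h2

variable {Q} in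
theorem LocalRoots.logDeriv_prod {lam : ℂ} {ψ : Fin N → ℂ → ℂ} (h : Q.LocalRoots lam ψ)
    (S : Finset (Fin N)) : logDeriv (fun x => ∏ i ∈ S, ψ i x) lam =
      ∑ i ∈ S, 1 / (ψ i lam * deriv Q.sym (ψ i lam)) := by
  rw [_root_.logDeriv_prod (fun i _ => h.roots.ne_zero i)
    fun i _ => (h.analytic i).differentiableAt]
  exact Finset.sum_congr rfl fun i _ => h.logDeriv_eq i

/-- `w'/w` as a sum over the small roots; each root function satisfies `sym (ψ λ) = λ`, hence
`ψ' = 1 / sym' (ψ)`. -/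
theorem logDeriv_w {lam : ℂ} (hs : lam ∈ Q.Simple) (hG : lam ∉ Q.Gam) :
    logDeriv Q.w lam =
      ∑ i ∈ low m N, 1 / (Q.root lam i * deriv Q.sym (Q.root lam i)) := by
  obtain ⟨ψ, h1, h2⟩ := Q.exists_localRoots (Q.isRoots_root lam) hs
  have hS : Bottom m (fun i => ψ i lam) (low m N) := by
    simpa [h1] using notMem_Gam_iff_low.1 hG
  have h3 := Q.w_eventuallyEq h2 hS
  have h4 : logDeriv Q.w lam = logDeriv (fun x => ∏ i ∈ low m N, ψ i x) lam := by
    rw [logDeriv_apply, logDeriv_apply, h3.deriv_eq, h3.self_of_nhds]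
  rw [h4, h2.self_of_nhds.logDeriv_prod]
  simp [h1]

/-- A function of `N` numbers, differentiable where none of them vanishes, that is symmetric in the
first `m` of them and in the others. -/
structure SplitSymmetric (m : ℕ) {N : ℕ} (F : (Fin N → ℂ) → ℂ) : Prop where
  diff : ∀ v, (∀ i, v i ≠ 0) → DifferentiableAt ℂ F v
  symm : ∀ (σ : Equiv.Perm (Fin N)), (∀ i, σ i ∈ low m N ↔ i ∈ low m N) →
    ∀ v, F (v ∘ σ) = F v

variable {Q} in
theorem IsRoots.exists_perm_low {lam : ℂ} {u v : Fin N → ℂ} (hu : Q.IsRoots lam u)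
    (hv : Q.IsRoots lam v) (hbu : Bottom m u (low m N)) (hbv : Bottom m v (low m N)) :
    ∃ σ : Equiv.Perm (Fin N), (∀ i, σ i ∈ low m N ↔ i ∈ low m N) ∧ u = v ∘ σ := by
  obtain ⟨σ, hσ⟩ := hu.perm hv
  refine ⟨σ, fun i => ?_, funext hσ⟩
  have h1 := (hbu.map σ hσ).unique hbv
  conv_lhs => rw [← h1]
  simp

/-- Off `Γ` the numbering of the roots is ambiguous only within the small ones and within the
others, up to permutations that do not change `F`. -/
theorem continuousAt_comp_root {F : (Fin N → ℂ) → ℂ} (hF : SplitSymmetric m F) {lam₀ : ℂ}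
    (h : lam₀ ∉ Q.Gam) : ContinuousAt (fun lam => F (Q.root lam)) lam₀ := by
  rw [continuousAt_iff_ultrafilter]
  intro g hg
  obtain ⟨v, hv, hmono, ht⟩ := Q.exists_tendsto_root g hg
  have hbv : Bottom m v (low m N) := by
    rw [bottom_low_iff hmono Q.m_pos Q.m_lt, hv.norm_eq hmono, hv.norm_eq hmono,
      ← bottom_low_iff (Q.mono lam₀) Q.m_pos Q.m_lt]
    exact notMem_Gam_iff_low.1 h
  obtain ⟨σ, h1, h2⟩ := hv.exists_perm_low (Q.isRoots_root lam₀) hbv (notMem_Gam_iff_low.1 h)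
  have h3 : F v = F (Q.root lam₀) := by rw [h2, hF.symm σ h1]
  rw [← h3]
  exact (hF.diff v fun i => hv.ne_zero i).continuousAt.tendsto.comp ht

/-- Functions of the roots with the appropriate symmetry are holomorphic off `Γ`; at the finitely
many points with multiple roots the singularity is removable. -/
theorem differentiableOn_comp_root {F : (Fin N → ℂ) → ℂ} (hF : SplitSymmetric m F) :
    DifferentiableOn ℂ (fun lam => F (Q.root lam)) Q.Gamᶜ := by
  have hsimple : ∀ lam ∈ Q.Simple, lam ∉ Q.Gam →
      DifferentiableAt ℂ (fun lam => F (Q.root lam)) lam := by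
    intro lam hs hG
    obtain ⟨ψ, h1, h2⟩ := Q.exists_localRoots (Q.isRoots_root lam) hs
    have hS : Bottom m (fun i => ψ i lam) (low m N) := by
      simpa [h1] using notMem_Gam_iff_low.1 hG
    have hl := h2.self_of_nhds
    have h3 : (fun lam => F (Q.root lam)) =ᶠ[𝓝 lam] fun lam => F fun i => ψ i lam := by
      filter_upwards [h2, eventually_bottom (fun i => (hl.analytic i).continuousAt) hS,
        Q.isClosed_Gam.isOpen_compl.mem_nhds hG] with x hx1 hx2 hx3
      obtain ⟨σ, h4, h5⟩ := (Q.isRoots_root x).exists_perm_low hx1.roots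
        (notMem_Gam_iff_low.1 hx3) hx2
      rw [h5, hF.symm σ h4]
    refine DifferentiableAt.congr_of_eventuallyEq ?_ h3
    have h6 : DifferentiableAt ℂ F (fun i => ψ i lam) := hF.diff _ fun i => hl.roots.ne_zero i
    exact h6.comp lam (differentiableAt_pi.2 fun i => (hl.analytic i).differentiableAt)
  intro lam₀ hG
  have hU : ∀ᶠ lam in 𝓝 lam₀, lam ∈ Q.Gamᶜ ∧ (lam ≠ lam₀ → lam ∈ Q.Simple) :=
    Filter.Eventually.and (Q.isClosed_Gam.isOpen_compl.mem_nhds hG) (eventually_nhdsWithin_iff.1 (Q.eventually_simple lam₀))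
  have h := (Complex.differentiableOn_compl_singleton_and_continuousAt_iff hU).1
    ⟨fun x hx => (hsimple x (hx.1.2 hx.2) hx.1.1).differentiableWithinAt,
      Q.continuousAt_comp_root hF hG⟩
  exact (h.differentiableAt hU).differentiableWithinAt

theorem prod_low_comp {M : Type*} [CommMonoid M] {σ : Equiv.Perm (Fin N)}
    (hσ : ∀ i, σ i ∈ low m N ↔ i ∈ low m N) (F : Fin N → M) :
    ∏ i ∈ low m N, F (σ i) = ∏ i ∈ low m N, F i :=
  Finset.prod_equiv σ (fun i => (hσ i).symm) fun _ _ => rfl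

theorem prod_compl_low_comp {M : Type*} [CommMonoid M] {σ : Equiv.Perm (Fin N)}
    (hσ : ∀ i, σ i ∈ low m N ↔ i ∈ low m N) (F : Fin N → M) :
    ∏ i ∈ (low m N)ᶜ, F (σ i) = ∏ i ∈ (low m N)ᶜ, F i :=
  Finset.prod_equiv σ (fun i => by simp [hσ i]) fun _ _ => rfl

theorem differentiableAt_prod {ι E : Type*} [NormedAddCommGroup E] [NormedSpace ℂ E]
    {s : Finset ι} {F : ι → E → ℂ} {x : E} (h : ∀ i ∈ s, DifferentiableAt ℂ (F i) x) :
    DifferentiableAt ℂ (fun y => ∏ i ∈ s, F i y) x := by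
  classical
  exact (HasFDerivAt.finsetProd fun i hi => (h i hi).hasFDerivAt).differentiableAt

theorem splitSymmetric_prod : SplitSymmetric m fun v : Fin N → ℂ => ∏ i ∈ low m N, v i :=
  ⟨fun v _ => differentiableAt_prod fun i _ => differentiableAt_apply i v,
    fun _ hσ v => prod_low_comp hσ v⟩

theorem differentiableOn_w : DifferentiableOn ℂ Q.w Q.Gamᶜ :=
  Q.differentiableOn_comp_root splitSymmetric_prod

/-- The product of the `1 - t v_i / v_j` over small `i` and large `j`. -/
def ratioProd (m : ℕ) {N : ℕ} (t : ℂ) (v : Fin N → ℂ) : ℂ :=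
  ∏ i ∈ low m N, ∏ j ∈ (low m N)ᶜ, (1 - t * (v i / v j))

theorem differentiableAt_ratioProd (t : ℂ) {v : Fin N → ℂ} (hv : ∀ i, v i ≠ 0) :
    DifferentiableAt ℂ (ratioProd m t) v := by
  refine differentiableAt_prod fun i _ => differentiableAt_prod fun j _ => ?_
  simp only [div_eq_mul_inv]
  exact (differentiableAt_const _).fun_sub ((differentiableAt_const _).fun_mul
    ((differentiableAt_apply i v).fun_mul ((differentiableAt_apply j v).fun_inv (hv j))))

theorem splitSymmetric_ratioProd (t : ℂ) : SplitSymmetric m (ratioProd m t (N := N)) :=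
  ⟨fun v hv => differentiableAt_ratioProd t hv, fun σ hσ v => by
    simp only [ratioProd, Function.comp_apply]
    rw [← prod_low_comp hσ fun i => ∏ j ∈ (low m N)ᶜ, (1 - t * (v i / v j))]
    exact Finset.prod_congr rfl fun i _ => prod_compl_low_comp hσ fun j => 1 - t * (v (σ i) / v j)⟩

end Pencil

/-! ### Asymptotics of the determinants off `Γ` -/

namespace Pencil

theorem prod_low_eq {m r : ℕ} {M : Type*} [CommMonoid M] (F : Fin (m + r) → M) :
    ∏ i ∈ low m (m + r), F i = ∏ i : Fin m, F (Fin.castAdd r i) := by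
  rw [low, Finset.prod_filter, Fin.prod_univ_add]
  simp

theorem prod_compl_low_eq {m r : ℕ} {M : Type*} [CommMonoid M] (F : Fin (m + r) → M) :
    ∏ i ∈ (low m (m + r))ᶜ, F i = ∏ i : Fin r, F (Fin.natAdd m i) := by
  rw [low, Finset.compl_filter, Finset.prod_filter, Fin.prod_univ_add]
  simp

variable {N m : ℕ} (Q : Pencil N m)

theorem natDegree_f (lam : ℂ) : (Q.f lam).natDegree = N := by
  rw [(Q.isRoots_root lam).poly, Polynomial.natDegree_C_mul Q.lead_ne,
    Polynomial.natDegree_prod_of_monic _ _ fun i _ => Polynomial.monic_X_sub_C _]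
  simp

theorem leadingCoeff_f (lam : ℂ) : (Q.f lam).leadingCoeff = Q.A.leadingCoeff := by
  rw [(Q.isRoots_root lam).poly, Polynomial.leadingCoeff_mul, Polynomial.leadingCoeff_C,
    Polynomial.leadingCoeff_prod]
  simp

/-- The product of the leading coefficient and all roots, which does not depend on `λ`. -/
def total : ℂ := (-1) ^ N * Q.A.coeff 0

theorem total_ne : Q.total ≠ 0 := mul_ne_zero (pow_ne_zero _ (by norm_num)) Q.coeff_zero_ne

/-- The Toeplitz determinant divided by its asymptotic size; for a sign `s` depending on `n` it tends
to `1` off `Γ`. The power `(total / w)^n` is that of the leading coefficient times the large roots. -/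
def normalized (D : ℂ[X]) (s : ℂ) (n : ℕ) (lam : ℂ) : ℂ :=
  s * (D.eval lam * (Q.w lam / Q.total) ^ n * ratioProd m 1 (Q.root lam))

variable {Q} {D : ℕ → ℂ[X]}

/-- Asymptotics of the Toeplitz determinants off `Γ`, locally uniformly where the roots are
distinct. -/
theorem exists_tendsto_normalized
    (hD : ∀ n lam, (D n).eval lam = (polyToeplitz m n (Q.f lam)).det) :
    ∃ s : ℕ → ℂ, (∀ n, s n * s n = 1) ∧ ∀ lam₀ ∈ Q.Simple, lam₀ ∉ Q.Gam →
      Tendsto (fun x : ℕ × ℂ => Q.normalized (D x.1) (s x.1) x.1 x.2) (atTop ×ˢ 𝓝 lam₀) (𝓝 1) := by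
  obtain ⟨r, rfl⟩ : ∃ r, N = m + r := ⟨N - m, by have := Q.m_lt; omega⟩
  choose s hs hid using det_polyToeplitz_eq m r
  refine ⟨s, hs, fun lam₀ hsim hG => ?_⟩
  obtain ⟨ψ, hψ₀, hψ⟩ := Q.exists_localRoots (Q.isRoots_root lam₀) hsim
  have hl := hψ.self_of_nhds
  have hb : Bottom m (fun i => ψ i lam₀) (low m (m + r)) := by
    simpa [hψ₀] using notMem_Gam_iff_low.1 hG
  have hlt := (bottom_low_iff (Q.mono lam₀) Q.m_pos Q.m_lt).1 (notMem_Gam_iff_low.1 hG)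
  obtain ⟨ρ, hρ1, hρ2⟩ := exists_between hlt
  have hρ0 : 0 < ρ := (norm_nonneg _).trans_lt hρ1
  let u : ℂ → Fin m → ℂ := fun lam i => ψ (Fin.castAdd r i) lam
  let t : ℂ → Fin r → ℂ := fun lam j => ψ (Fin.natAdd m j) lam
  have hu : Tendsto (fun x : ℕ × ℂ => u x.2) (atTop ×ˢ 𝓝 lam₀) (𝓝 (u lam₀)) :=
    tendsto_pi_nhds.2 fun i => (hl.analytic _).continuousAt.tendsto.comp tendsto_snd
  have ht : Tendsto (fun x : ℕ × ℂ => t x.2) (atTop ×ˢ 𝓝 lam₀) (𝓝 (t lam₀)) :=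
    tendsto_pi_nhds.2 fun i => (hl.analytic _).continuousAt.tendsto.comp tendsto_snd
  have hu₀ : ∀ i, ‖u lam₀ i‖ < ‖(ρ : ℂ)‖ := by
    intro i
    simp only [u, hψ₀, Complex.norm_real, Real.norm_of_nonneg hρ0.le]
    exact (Q.mono lam₀ (Fin.le_def.2 (by simp; omega))).trans_lt hρ1
  have ht₀ : ∀ i, ‖(ρ : ℂ)‖ < ‖t lam₀ i‖ := by
    intro i
    simp only [t, hψ₀, Complex.norm_real, Real.norm_of_nonneg hρ0.le]
    exact hρ2.trans_le (Q.mono lam₀ (Fin.le_def.2 (by simp)))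
  have h1 := tendsto_det_scaledBlocks (N := fun x : ℕ × ℂ => x.1) tendsto_fst hu ht hu₀ ht₀
  have hV : Tendsto (fun x : ℕ × ℂ => (Matrix.vandermonde (u x.2)).det *
      (Matrix.vandermonde (t x.2)).det) (atTop ×ˢ 𝓝 lam₀)
      (𝓝 ((Matrix.vandermonde (u lam₀)).det * (Matrix.vandermonde (t lam₀)).det)) := by
    have hc : ∀ k, Continuous fun y : Fin k → ℂ => (Matrix.vandermonde y).det := fun k => by
      simp only [Matrix.det_vandermonde]; fun_prop
    exact ((hc m).continuousAt.tendsto.comp hu).mul ((hc r).continuousAt.tendsto.comp ht)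
  have hV0 : (Matrix.vandermonde (u lam₀)).det * (Matrix.vandermonde (t lam₀)).det ≠ 0 := by
    refine mul_ne_zero (Matrix.det_vandermonde_ne_zero_iff.2 fun i j hij => ?_)
      (Matrix.det_vandermonde_ne_zero_iff.2 fun i j hij => ?_)
    · exact Fin.castAdd_injective _ _ (hl.inj hij)
    · exact Fin.natAdd_injective _ _ (hl.inj hij)
  have h2 := h1.div hV hV0
  rw [div_self hV0] at h2
  refine h2.congr' ?_
  have hev : ∀ᶠ lam in 𝓝 lam₀, Q.LocalRoots lam ψ ∧
      Bottom m (fun i => ψ i lam) (low m (m + r)) ∧ lam ∉ Q.Gam :=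
    hψ.and ((eventually_bottom (fun i => (hl.analytic i).continuousAt) hb).and
      (Q.isClosed_Gam.isOpen_compl.mem_nhds hG))
  filter_upwards [tendsto_snd.eventually hev, hV.eventually_ne hV0] with ⟨n, lam⟩ ⟨hx1, hx2, hx3⟩ hx4
  simp only at hx1 hx2 hx3 hx4 ⊢
  obtain ⟨σ, hσ1, hσ2⟩ := (Q.isRoots_root lam).exists_perm_low hx1.roots
    (notMem_Gam_iff_low.1 hx3) hx2
  have hr : ratioProd m 1 (Q.root lam) = ∏ i, ∏ j, (1 - u lam i / t lam j) := by
    rw [hσ2, (splitSymmetric_ratioProd 1).symm σ hσ1, ratioProd, prod_low_eq]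
    refine Finset.prod_congr rfl fun i _ => ?_
    rw [prod_compl_low_eq]
    simp [u, t]
  have hw : Q.w lam = ∏ i, u lam i := by
    rw [hx1.roots.w_eq hx2, prod_low_eq]
  have htot : Q.A.leadingCoeff * ((∏ i, u lam i) * ∏ j, t lam j) = Q.total := by
    rw [total, ← hx1.roots.prod_eq, Fin.prod_univ_add]
  have h3 := hid n (Q.f lam) (Sum.elim (u lam) (t lam)) ρ (Q.natDegree_f lam)
    (by rintro (i | j) <;> exact (hx1.roots.eval_eq_zero_iff _).2 ⟨_, rfl⟩)
    (by rintro (i | j) <;> exact hx1.roots.ne_zero _) (by exact_mod_cast hρ0.ne')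
  simp only [Sum.elim_inl, Sum.elim_inr, Sum.elim_comp_inl, Sum.elim_comp_inr,
    leadingCoeff_f] at h3
  rw [Pi.div_apply, normalized, hD, hr, div_eq_iff hx4, div_pow]
  have hT := Q.total_ne
  have hw0 := Q.w_ne_zero lam
  have h4 : (Q.A.leadingCoeff * ∏ j, t lam j) ^ n * Q.w lam ^ n = Q.total ^ n := by
    rw [← mul_pow, hw, ← htot]
    ring
  have h5 : Q.total ^ n ≠ 0 := pow_ne_zero _ hT
  field_simp
  linear_combination (-(scaledBlocks n (ρ : ℂ) (u lam) (t lam)).det) * h4 - Q.w lam ^ n * h3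

theorem differentiableOn_normalized (P : ℂ[X]) (s : ℂ) (n : ℕ) :
    DifferentiableOn ℂ (Q.normalized P s n) Q.Gamᶜ :=
  ((P.differentiable.differentiableOn.mul ((Q.differentiableOn_w.div_const _).pow n)).mul
    (Q.differentiableOn_comp_root (splitSymmetric_ratioProd 1))).const_mul s

/-- Off `Γ` the asymptotics are uniform on a disc; at multiple roots this follows from the
maximum principle. -/
theorem exists_ball_normalized
    (hD : ∀ n lam, (D n).eval lam = (polyToeplitz m n (Q.f lam)).det) :
    ∃ s : ℕ → ℂ, ∀ lam₀, lam₀ ∉ Q.Gam → ∃ ε > 0,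
      Metric.closedBall lam₀ ε ⊆ Q.Gamᶜ ∧ ∀ᶠ n in atTop, ∀ lam ∈ Metric.closedBall lam₀ ε,
        ‖Q.normalized (D n) (s n) n lam - 1‖ ≤ 1 / 2 := by
  obtain ⟨s, -, hs⟩ := exists_tendsto_normalized hD
  refine ⟨s, fun lam₀ hG => ?_⟩
  obtain ⟨ε, hε, hε1⟩ := Metric.nhds_basis_closedBall.mem_iff.1
    (Q.isClosed_Gam.isOpen_compl.mem_nhds hG)
  obtain ⟨δ, hδ, hδ1⟩ := Metric.mem_nhdsWithin_iff.1 (Q.eventually_simple lam₀)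
  set η := min ε (δ / 2)
  have hη : 0 < η := lt_min hε (by linarith)
  have hsub : Metric.closedBall lam₀ η ⊆ Q.Gamᶜ :=
    (Metric.closedBall_subset_closedBall (min_le_left _ _)).trans hε1
  refine ⟨η, hη, hsub, ?_⟩
  -- The points with multiple roots are isolated, so there are none on a small circle.
  have hev : ∀ y ∈ Metric.sphere lam₀ η, ∀ᶠ x : ℕ × ℂ in atTop ×ˢ 𝓝 y,
      ‖Q.normalized (D x.1) (s x.1) x.1 x.2 - 1‖ ≤ 1 / 2 := by
    intro y hy
    have hy1 : y ∈ Q.Simple := by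
      apply hδ1
      have hd : dist y lam₀ = η := hy
      refine ⟨?_, fun h => ?_⟩
      · rw [Metric.mem_ball, hd]
        exact (min_le_right _ _).trans_lt (by linarith)
      · rw [Set.mem_singleton_iff.1 h, dist_self] at hd
        exact hη.ne hd
    have h1 := hs y hy1 (hsub (Metric.sphere_subset_closedBall hy))
    have h2 := (h1.sub_const 1).norm
    simp only [sub_self, norm_zero] at h2
    exact (h2.eventually_lt_const (by norm_num : (0 : ℝ) < 1 / 2)).mono fun x hx => hx.le
  have hun : ∀ᶠ n in atTop, ∀ y ∈ Metric.sphere lam₀ η,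
      ‖Q.normalized (D n) (s n) n y - 1‖ ≤ 1 / 2 := by
    have hKc := isCompact_sphere lam₀ η
    have := hKc.induction_on (p := fun K => ∀ᶠ n in atTop, ∀ y ∈ K,
      ‖Q.normalized (D n) (s n) n y - 1‖ ≤ 1 / 2) (by simp)
      (fun K L hKL hL => hL.mono fun n hn y hy => hn y (hKL hy))
      (fun K L hK hL => (hK.and hL).mono fun n hn y hy => hy.elim (hn.1 y) (hn.2 y))
      (fun y hy => by
        obtain ⟨p, hp, q, hq, hpq⟩ := eventually_prod_iff.1 (hev y hy)
        exact ⟨_, mem_nhdsWithin_of_mem_nhds hq, hp.mono fun n hn z hz => hpq hn hz⟩)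
    exact this
  filter_upwards [hun] with n hn lam hlam
  have hd : DiffContOnCl ℂ (fun lam => Q.normalized (D n) (s n) n lam - 1)
      (Metric.ball lam₀ η) := by
    refine DifferentiableOn.diffContOnCl ?_
    rw [closure_ball _ hη.ne']
    exact ((differentiableOn_normalized _ _ _).mono hsub).sub_const 1
  refine Complex.norm_le_of_forall_mem_frontier_norm_le Metric.isBounded_ball hd ?_
    (by rwa [closure_ball _ hη.ne'])
  rwa [frontier_ball _ hη.ne']

/-- Off `Γ` the determinants are locally zero-free for large `n`. -/
theorem exists_ball_eval_ne_zero
    (hD : ∀ n lam, (D n).eval lam = (polyToeplitz m n (Q.f lam)).det) {lam₀ : ℂ}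
    (hG : lam₀ ∉ Q.Gam) :
    ∃ ε > 0, ∀ᶠ n in atTop, ∀ lam ∈ Metric.ball lam₀ ε, (D n).eval lam ≠ 0 := by
  obtain ⟨s, hs⟩ := exists_ball_normalized hD
  obtain ⟨ε, hε, -, h⟩ := hs lam₀ hG
  refine ⟨ε, hε, h.mono fun n hn lam hlam h0 => ?_⟩
  have := hn lam (Metric.ball_subset_closedBall hlam)
  simp only [normalized, h0, zero_mul, mul_zero, zero_sub, norm_neg, norm_one] at this
  norm_num at this

/-- Off `Γ` the normalized logarithmic derivatives of the determinants converge. -/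
theorem tendsto_logDeriv_eval
    (hD : ∀ n lam, (D n).eval lam = (polyToeplitz m n (Q.f lam)).det) {lam₀ : ℂ}
    (hG : lam₀ ∉ Q.Gam) :
    Tendsto (fun n : ℕ => (n : ℂ)⁻¹ * ((D n).derivative.eval lam₀ / (D n).eval lam₀)) atTop
      (𝓝 (-logDeriv Q.w lam₀)) := by
  obtain ⟨s, hs⟩ := exists_ball_normalized hD
  obtain ⟨ε, hε, hsub, h⟩ := hs lam₀ hG
  set E : ℂ → ℂ := fun lam => ratioProd m 1 (Q.root lam)
  have hnhds : Q.Gamᶜ ∈ 𝓝 lam₀ := Q.isClosed_Gam.isOpen_compl.mem_nhds hG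
  have hwd : DifferentiableAt ℂ Q.w lam₀ := Q.differentiableOn_w.differentiableAt hnhds
  have hEd : DifferentiableAt ℂ E lam₀ :=
    (Q.differentiableOn_comp_root (splitSymmetric_ratioProd 1)).differentiableAt hnhds
  have hw0 := Q.w_ne_zero lam₀
  have key : ∀ᶠ n : ℕ in atTop,
      ‖((n : ℂ)⁻¹ * ((D n).derivative.eval lam₀ / (D n).eval lam₀)) - -logDeriv Q.w lam₀‖ ≤
        (n : ℝ)⁻¹ * (3 / ε + ‖logDeriv E lam₀‖) := by
    filter_upwards [h, eventually_gt_atTop 0] with n hn hn0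
    set K := Q.normalized (D n) (s n) n
    have hK : ∀ lam ∈ Metric.closedBall lam₀ ε, ‖K lam‖ ≤ 3 / 2 := by
      intro lam hlam
      have h1 := hn lam hlam
      have h2 := norm_add_le (K lam - 1) 1
      rw [sub_add_cancel, norm_one] at h2
      linarith
    have hK0 : 1 / 2 ≤ ‖K lam₀‖ := by
      have h1 := hn lam₀ (Metric.mem_closedBall_self hε.le)
      have h2 := norm_sub_norm_le (1 : ℂ) (1 - K lam₀)
      rw [norm_one, sub_sub_cancel, norm_sub_rev] at h2
      linarith
    have hK0' : K lam₀ ≠ 0 := norm_pos_iff.1 (by linarith)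
    have hd : DifferentiableOn ℂ K (Metric.closedBall lam₀ ε) :=
      (differentiableOn_normalized _ _ _).mono hsub
    have hder : ‖deriv K lam₀‖ ≤ (3 / 2) / ε := by
      refine Complex.norm_deriv_le_of_forall_mem_sphere_norm_le hε
        (DifferentiableOn.diffContOnCl (by rwa [closure_ball _ hε.ne'])) fun z hz =>
          hK z (Metric.sphere_subset_closedBall hz)
    have hlog : ‖logDeriv K lam₀‖ ≤ 3 / ε := by
      rw [logDeriv_apply, norm_div, div_le_iff₀ (by linarith)]
      calc ‖deriv K lam₀‖ ≤ (3 / 2) / ε := hder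
        _ = 3 / ε * (1 / 2) := by ring
        _ ≤ 3 / ε * ‖K lam₀‖ := by gcongr
    have hs0 : s n ≠ 0 := fun h0 => hK0' (by simp [K, normalized, h0])
    have hD0 : (D n).eval lam₀ ≠ 0 := fun h0 => hK0' (by simp [K, normalized, h0])
    have hE0 : E lam₀ ≠ 0 := fun h0 => hK0' (by
      simp only [E] at h0
      simp [K, normalized, h0])
    have hdK : HasDerivAt K (s n * (((D n).derivative.eval lam₀ * (Q.w lam₀ / Q.total) ^ n +
        (D n).eval lam₀ * (n * (Q.w lam₀ / Q.total) ^ (n - 1) * (deriv Q.w lam₀ / Q.total))) *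
          E lam₀ + (D n).eval lam₀ * (Q.w lam₀ / Q.total) ^ n * deriv E lam₀)) lam₀ :=
      ((((D n).hasDerivAt lam₀).mul ((hwd.hasDerivAt.div_const Q.total).pow n)).mul
        hEd.hasDerivAt).const_mul (s n)
    have hT := Q.total_ne
    have heq : logDeriv K lam₀ = (D n).derivative.eval lam₀ / (D n).eval lam₀ +
        n * logDeriv Q.w lam₀ + logDeriv E lam₀ := by
      rw [logDeriv_apply, hdK.deriv, logDeriv_apply, logDeriv_apply]
      have hp : (Q.w lam₀ / Q.total) ^ n = (Q.w lam₀ / Q.total) ^ (n - 1) * (Q.w lam₀ / Q.total) := by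
        rw [← pow_succ, Nat.sub_add_cancel hn0]
      have hp0 : (Q.w lam₀ / Q.total) ^ (n - 1) ≠ 0 := pow_ne_zero _ (div_ne_zero hw0 hT)
      have hKe : K lam₀ = s n * ((D n).eval lam₀ * (Q.w lam₀ / Q.total) ^ n * E lam₀) := rfl
      rw [hKe, hp]
      generalize (Q.w lam₀ / Q.total) ^ (n - 1) = y at hp0
      field_simp
    have hn0' : (n : ℂ) ≠ 0 := by exact_mod_cast hn0.ne'
    have heq2 : ((n : ℂ)⁻¹ * ((D n).derivative.eval lam₀ / (D n).eval lam₀)) - -logDeriv Q.w lam₀ =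
        (n : ℂ)⁻¹ * (logDeriv K lam₀ - logDeriv E lam₀) := by
      rw [heq]
      field_simp
      ring
    rw [heq2, norm_mul, norm_inv, Complex.norm_natCast]
    gcongr
    exact (norm_sub_le _ _).trans (by gcongr)
  rw [tendsto_iff_norm_sub_tendsto_zero]
  refine squeeze_zero' (Eventually.of_forall fun n => norm_nonneg _) key ?_
  have := (tendsto_inv_atTop_nhds_zero_nat (𝕜 := ℝ)).mul_const (3 / ε + ‖logDeriv E lam₀‖)
  simpa using this

end Pencil

/-! ### Degree bounds, and `w'/w` near singular points and at infinity -/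

/-- For a nonconstant analytic function `h`, the quotient `(h - h z₀) / h'` tends to `0` at `z₀`, also
if `h'` vanishes there. -/
theorem tendsto_sub_div_deriv {h : ℂ → ℂ} {z₀ : ℂ} (ha : AnalyticAt ℂ h z₀)
    (hn : ¬ ∀ᶠ z in 𝓝 z₀, h z = h z₀) :
    Tendsto (fun z => (h z - h z₀) / deriv h z) (𝓝 z₀) (𝓝 0) := by
  have ha' : AnalyticAt ℂ (fun z => h z - h z₀) z₀ := ha.sub analyticAt_const
  obtain ⟨n, g, hg, hg0, hev⟩ := ha'.exists_eventuallyEq_pow_smul_nonzero_iff.2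
    (by simpa [sub_eq_zero] using hn)
  have hn0 : n ≠ 0 := by
    rintro rfl
    have := hev.self_of_nhds
    simp only [sub_self, pow_zero, one_smul] at this
    exact hg0 this.symm
  have hd : ∀ᶠ z in 𝓝 z₀, deriv h z = (z - z₀) ^ (n - 1) * (n * g z + (z - z₀) * deriv g z) := by
    filter_upwards [hev.eventually_nhds, hg.eventually_analyticAt] with z hz hgz
    have h1 : HasDerivAt (fun z => (z - z₀) ^ n • g z)
        (n * (z - z₀) ^ (n - 1) * g z + (z - z₀) ^ n * deriv g z) z := by
      refine ((((hasDerivAt_id' z).sub_const z₀).fun_pow n).fun_mul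
        hgz.differentiableAt.hasDerivAt).congr_deriv ?_
      simp
    have h2 : HasDerivAt (fun z => h z - h z₀) _ z := h1.congr_of_eventuallyEq hz
    have h3 := h2.add_const (h z₀)
    simp only [sub_add_cancel] at h3
    rw [h3.deriv]
    have : (z - z₀) ^ n = (z - z₀) ^ (n - 1) * (z - z₀) := by
      rw [← pow_succ, Nat.sub_add_cancel (Nat.pos_of_ne_zero hn0)]
    rw [this]; ring
  have hlim : Tendsto (fun z => (z - z₀) * g z / (n * g z + (z - z₀) * deriv g z)) (𝓝 z₀)
      (𝓝 0) := by
    have hsub : ContinuousAt (fun z : ℂ => z - z₀) z₀ := by fun_prop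
    have h1 : ContinuousAt (fun z => (z - z₀) * g z / (n * g z + (z - z₀) * deriv g z)) z₀ := by
      refine (hsub.mul hg.continuousAt).div (((continuousAt_const).mul hg.continuousAt).add
        (hsub.mul hg.deriv.continuousAt)) ?_
      simp [hn0, hg0]
    have h2 := h1.tendsto
    simpa using h2
  refine hlim.congr' ?_
  filter_upwards [hev, hd] with z h1 h2
  rw [h1, h2]
  by_cases hz : z = z₀
  · simp [hz, hn0]
  · have hz' : (z - z₀) ^ (n - 1) ≠ 0 := pow_ne_zero _ (sub_ne_zero.2 hz)
    have : (z - z₀) ^ n = (z - z₀) ^ (n - 1) * (z - z₀) := by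
      rw [← pow_succ, Nat.sub_add_cancel (Nat.pos_of_ne_zero hn0)]
    rw [this, smul_eq_mul, mul_assoc, mul_div_mul_left _ _ hz']

theorem natDegree_le_of_norm_le {P : ℂ[X]} {C : ℝ} {d : ℕ}
    (h : ∀ r : ℝ, 1 ≤ r → ‖P.eval (r : ℂ)‖ ≤ C * r ^ d) : P.natDegree ≤ d := by
  by_contra hlt
  push Not at hlt
  have hP : P ≠ 0 := by rintro rfl; simp at hlt
  have h1 : Tendsto (fun r : ℝ => ((r⁻¹ : ℝ) : ℂ)) atTop (𝓝 0) := by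
    have := (Complex.continuous_ofReal.tendsto 0).comp tendsto_inv_atTop_zero
    simpa [Function.comp_def] using this
  have h2 : Tendsto (fun r : ℝ => P.reverse.eval ((r⁻¹ : ℝ) : ℂ)) atTop
      (𝓝 P.leadingCoeff) := by
    have := (P.reverse.continuous.tendsto 0).comp h1
    rwa [← Polynomial.coeff_zero_eq_eval_zero, Polynomial.coeff_zero_reverse] at this
  have h3 : ∀ᶠ r : ℝ in atTop, ‖P.reverse.eval ((r⁻¹ : ℝ) : ℂ)‖ ≤ C * r⁻¹ := by
    filter_upwards [eventually_ge_atTop (1 : ℝ)] with r hr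
    have hr0 : (0 : ℝ) < r := by linarith
    have hrc : (r : ℂ) ≠ 0 := by exact_mod_cast hr0.ne'
    let : Invertible (r : ℂ) := invertibleOfNonzero hrc
    have h4 := Polynomial.eval₂_reverse_mul_pow (RingHom.id ℂ) (r : ℂ) P
    rw [invOf_eq_inv] at h4
    change P.reverse.eval ((r : ℂ)⁻¹) * (r : ℂ) ^ P.natDegree = P.eval (r : ℂ) at h4
    have h5 := h r hr
    rw [← h4, norm_mul, norm_pow, Complex.norm_real, Real.norm_of_nonneg hr0.le] at h5
    have h6 : C * r ^ d ≤ C * r⁻¹ * r ^ P.natDegree := by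
      have hC : 0 ≤ C := by
        have := (norm_nonneg _).trans (h 1 le_rfl)
        simpa using this
      obtain ⟨e, he⟩ : ∃ e, P.natDegree = d + 1 + e := ⟨P.natDegree - (d + 1), by omega⟩
      have h8 : r⁻¹ * r ^ P.natDegree = r ^ (d + e) := by
        rw [he, pow_add, pow_succ, pow_add]; field_simp
      rw [mul_assoc, h8]
      exact mul_le_mul_of_nonneg_left (pow_le_pow_right₀ hr (by omega)) hC
    push_cast
    exact le_of_mul_le_mul_right (h5.trans h6) (by positivity)
  have h7 : Tendsto (fun r : ℝ => C * r⁻¹) atTop (𝓝 0) := by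
    simpa using tendsto_inv_atTop_zero.const_mul C
  have h8 := le_of_tendsto_of_tendsto h2.norm h7 h3
  exact hP (Polynomial.leadingCoeff_eq_zero.1 (norm_le_zero_iff.1 h8))

/-- Bound for a Toeplitz determinant, from the Leibniz formula after conjugating the matrix by the
diagonal matrix of the powers of `ρ`. -/
theorem norm_det_polyToeplitz_le {m n : ℕ} {g : ℂ[X]} {ρ B : ℝ} (hρ : 0 < ρ) (hB : 0 ≤ B)
    (h : ∀ l, ρ ^ l * ‖g.coeff l‖ ≤ B * ρ ^ m) :
    ‖(polyToeplitz m n g).det‖ ≤ n.factorial * B ^ n := by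
  have hρc : (ρ : ℂ) ≠ 0 := by exact_mod_cast hρ.ne'
  have h1 : (polyToeplitz m n g).det = (Matrix.of fun i j : Fin n => (ρ : ℂ) ^ (i : ℕ) *
      (Matrix.of fun i j : Fin n => ((ρ : ℂ) ^ (j : ℕ))⁻¹ * polyToeplitz m n g i j) i j).det := by
    rw [Matrix.det_mul_column, Matrix.det_mul_row, ← mul_assoc, ← Finset.prod_mul_distrib,
      Finset.prod_eq_one, one_mul]
    intro i _
    field_simp
  rw [h1]
  have h2 := Matrix.det_le (A := (Matrix.of fun i j : Fin n => (ρ : ℂ) ^ (i : ℕ) *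
      (Matrix.of fun i j : Fin n => ((ρ : ℂ) ^ (j : ℕ))⁻¹ * polyToeplitz m n g i j) i j))
      (abv := IsAbsoluteValue.toAbsoluteValue (norm : ℂ → ℝ)) (x := B) (by
    intro i j
    simp only [IsAbsoluteValue.toAbsoluteValue, AbsoluteValue.coe_mk, MulHom.coe_mk, polyToeplitz,
      Matrix.of_apply, Polynomial.coeff_mul_X_pow']
    split_ifs with hij
    · simp only [norm_mul, norm_inv, norm_pow, Complex.norm_real, Real.norm_of_nonneg hρ.le]
      have h3 := h (m + i - j)
      have h4 : ρ ^ (m + (i : ℕ) - j) * ρ ^ (j : ℕ) = ρ ^ m * ρ ^ (i : ℕ) := by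
        rw [← pow_add, ← pow_add]; congr 1; omega
      have h5 : 0 < ρ ^ m := by positivity
      have h6 : 0 < ρ ^ (j : ℕ) := by positivity
      rw [← mul_le_mul_iff_of_pos_right h5]
      calc ρ ^ (i : ℕ) * ((ρ ^ (j : ℕ))⁻¹ * ‖g.coeff (m + i - j)‖) * ρ ^ m
          = (ρ ^ m * ρ ^ (i : ℕ)) * (ρ ^ (j : ℕ))⁻¹ * ‖g.coeff (m + i - j)‖ := by ring
        _ = ρ ^ (m + (i : ℕ) - j) * ‖g.coeff (m + i - j)‖ := by rw [← h4]; field_simp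
        _ ≤ _ := h3
    · simpa using hB)
  simpa [IsAbsoluteValue.toAbsoluteValue, nsmul_eq_mul] using h2

namespace Pencil

variable {N m : ℕ} (Q : Pencil N m)

theorem coeff_f (lam : ℂ) (l : ℕ) :
    (Q.f lam).coeff l = Q.A.coeff l - if l = Q.q then lam else 0 := by
  simp [f, Polynomial.coeff_X_pow]

theorem coeff_norm_le (l : ℕ) : ‖Q.A.coeff l‖ ≤ ∑ l ∈ Finset.range (N + 1), ‖Q.A.coeff l‖ := by
  by_cases hl : l < N + 1
  · exact Finset.single_le_sum (f := fun l => ‖Q.A.coeff l‖) (fun _ _ => norm_nonneg _)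
      (Finset.mem_range.2 hl)
  · rw [Polynomial.coeff_eq_zero_of_natDegree_lt (by rw [Q.natDegree_A]; omega), norm_zero]
    exact Finset.sum_nonneg fun _ _ => norm_nonneg _

/-- The substitution `λ = r^(N-q)` and conjugation by powers of `r` balance the terms `z^N` and
`λ z^q` of the pencil. -/
theorem natDegree_mul_le {n : ℕ} {D : ℂ[X]}
    (hD : ∀ lam, D.eval lam = (polyToeplitz m n (Q.f lam)).det) :
    D.natDegree * (N - Q.q) ≤ n * (N - m) := by
  set S := ∑ l ∈ Finset.range (N + 1), ‖Q.A.coeff l‖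
  have hS : 0 ≤ S := Finset.sum_nonneg fun _ _ => norm_nonneg _
  have hq := Q.q_lt
  have hm := Q.m_lt
  have h := natDegree_le_of_norm_le (P := D.comp (Polynomial.X ^ (N - Q.q)))
    (C := n.factorial * (S + 1) ^ n) (d := n * (N - m)) (by
      intro r hr
      have hr0 : 0 < r := by linarith
      rw [Polynomial.eval_comp, Polynomial.eval_pow, Polynomial.eval_X, hD]
      refine (norm_det_polyToeplitz_le hr0 (B := (S + 1) * r ^ (N - m)) (by positivity) ?_).trans ?_
      · intro l
        rw [mul_assoc, ← pow_add, Nat.sub_add_cancel hm.le, coeff_f]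
        by_cases hl : l ≤ N
        · have h1 : r ^ l * ‖Q.A.coeff l‖ ≤ S * r ^ N := by
            rw [mul_comm]
            exact mul_le_mul (Q.coeff_norm_le l) (pow_le_pow_right₀ hr hl) (by positivity) hS
          have h2 : r ^ l * ‖(if l = Q.q then (r : ℂ) ^ (N - Q.q) else 0)‖ ≤ r ^ N := by
            split_ifs with h
            · rw [norm_pow, Complex.norm_real, Real.norm_of_nonneg hr0.le, ← pow_add]
              exact pow_le_pow_right₀ hr (by omega)
            · simp; positivity
          calc _ ≤ r ^ l * (‖Q.A.coeff l‖ + ‖(if l = Q.q then (r : ℂ) ^ (N - Q.q) else 0)‖) := by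
                gcongr; exact norm_sub_le _ _
            _ ≤ _ := by linarith
        · rw [Polynomial.coeff_eq_zero_of_natDegree_lt (by rw [Q.natDegree_A]; omega),
            if_neg (by omega)]
          simp; positivity
      · rw [mul_pow, ← pow_mul, mul_comm (N - m) n, mul_assoc])
  rwa [Polynomial.natDegree_comp, Polynomial.natDegree_X_pow] at h

/-- The substitution `λ = r^q` and conjugation by powers of `1/r` balance the terms `z^0` and
`λ z^q` of the pencil. -/
theorem natDegree_mul_le' {n : ℕ} {D : ℂ[X]}
    (hD : ∀ lam, D.eval lam = (polyToeplitz m n (Q.f lam)).det) :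
    D.natDegree * Q.q ≤ n * m := by
  set S := ∑ l ∈ Finset.range (N + 1), ‖Q.A.coeff l‖
  have hS : 0 ≤ S := Finset.sum_nonneg fun _ _ => norm_nonneg _
  have h := natDegree_le_of_norm_le (P := D.comp (Polynomial.X ^ Q.q))
    (C := n.factorial * (S + 1) ^ n) (d := n * m) (by
      intro r hr
      have hr0 : 0 < r := by linarith
      rw [Polynomial.eval_comp, Polynomial.eval_pow, Polynomial.eval_X, hD]
      refine (norm_det_polyToeplitz_le (inv_pos.2 hr0) (B := (S + 1) * r ^ m) (by positivity)
        ?_).trans ?_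
      · intro l
        rw [mul_assoc, ← mul_pow, mul_inv_cancel₀ hr0.ne', one_pow, mul_one, coeff_f]
        have h0 : (r⁻¹) ^ l ≤ 1 := pow_le_one₀ (by positivity) (inv_le_one_of_one_le₀ hr)
        have h1 : (r⁻¹) ^ l * ‖Q.A.coeff l‖ ≤ S :=
          (mul_le_of_le_one_left (norm_nonneg _) h0).trans (Q.coeff_norm_le l)
        have h2 : (r⁻¹) ^ l * ‖(if l = Q.q then (r : ℂ) ^ Q.q else 0)‖ ≤ 1 := by
          split_ifs with h
          · rw [norm_pow, Complex.norm_real, Real.norm_of_nonneg hr0.le, h, ← mul_pow,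
              inv_mul_cancel₀ hr0.ne', one_pow]
          · simp
        calc _ ≤ (r⁻¹) ^ l * (‖Q.A.coeff l‖ + ‖(if l = Q.q then (r : ℂ) ^ Q.q else 0)‖) := by
              gcongr; exact norm_sub_le _ _
          _ ≤ _ := by linarith
      · rw [mul_pow, ← pow_mul, mul_comm m n, mul_assoc])
  rwa [Polynomial.natDegree_comp, Polynomial.natDegree_X_pow] at h

/-- The points off `Γ` over which the roots are distinct. -/
def good : Set ℂ := Q.Simple ∩ Q.Gamᶜ

theorem sym_root (lam : ℂ) (i : Fin N) : Q.sym (Q.root lam i) = lam :=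
  (Q.sym_eq_iff ((Q.isRoots_root lam).ne_zero i)).2
    (((Q.isRoots_root lam).eval_eq_zero_iff _).2 ⟨i, rfl⟩)

theorem not_eventually_sym_eq {z : ℂ} (hz : z ≠ 0) : ¬ ∀ᶠ y in 𝓝 z, Q.sym y = Q.sym z := by
  intro h
  have h1 : ∀ᶠ y in 𝓝 z, (Q.f (Q.sym z)).eval y = 0 := by
    filter_upwards [h, eventually_ne_nhds hz] with y hy hy0
    exact (Q.sym_eq_iff hy0).1 hy
  have h2 : {y | (Q.f (Q.sym z)).IsRoot y}.Infinite := infinite_of_mem_nhds z h1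
  have h3 : Q.f (Q.sym z) ≠ 0 := by
    intro h0
    have := Q.leadingCoeff_f (Q.sym z)
    rw [h0, Polynomial.leadingCoeff_zero] at this
    exact Q.lead_ne this.symm
  exact h2 (Polynomial.finite_setOfPred_isRoot h3)

/-- The logarithmic derivative of `w` is of smaller order than a simple pole at every point. -/
theorem tendsto_sub_mul_logDeriv_w (x : ℂ) :
    Tendsto (fun lam => (lam - x) * -logDeriv Q.w lam) (𝓝 x ⊓ 𝓟 Q.good) (𝓝 0) := by
  rw [tendsto_iff_ultrafilter]
  intro g hg
  obtain ⟨v, hv, -, ht⟩ := Q.exists_tendsto_root g (hg.trans inf_le_left)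
  have hgood : ∀ᶠ lam in (g : Filter ℂ), lam ∈ Q.good :=
    hg.trans inf_le_right (mem_principal_self _)
  have h1 : ∀ i, Tendsto (fun lam => (lam - x) * (1 / (Q.root lam i * deriv Q.sym (Q.root lam i))))
      g (𝓝 0) := by
    intro i
    have hv0 := hv.ne_zero i
    have hsv : Q.sym (v i) = x := (Q.sym_eq_iff hv0).2 ((hv.eval_eq_zero_iff _).2 ⟨i, rfl⟩)
    have hti : Tendsto (fun lam => Q.root lam i) g (𝓝 (v i)) := tendsto_pi_nhds.1 ht i
    have h2 := (tendsto_sub_div_deriv (Q.analyticAt_sym hv0) (Q.not_eventually_sym_eq hv0)).comp hti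
    have h3 := h2.mul (hti.inv₀ hv0)
    rw [zero_mul] at h3
    refine h3.congr fun lam => ?_
    simp only [Function.comp_apply, hsv, sym_root]
    rw [one_div, mul_inv, div_eq_mul_inv]
    ring
  have h4 := (tendsto_finsetSum (low m N) fun i _ => h1 i).neg
  simp only [Finset.sum_const_zero, neg_zero] at h4
  refine h4.congr' ?_
  filter_upwards [hgood] with lam hlam
  rw [Q.logDeriv_w hlam.1 hlam.2, ← Finset.mul_sum]
  ring

/-- As `λ → ∞`, each root tends to a pole of the symbol, `0` or infinity. -/
theorem tendsto_root_infinity (g : Ultrafilter ℂ) (hg : (g : Filter ℂ) ≤ Bornology.cobounded ℂ)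
    (i : Fin N) : Tendsto (fun lam => Q.root lam i) g (𝓝 0) ∨
      Tendsto (fun lam => Q.root lam i) g (Bornology.cobounded ℂ) := by
  -- On a compact annulus the symbol is bounded, so a root cannot stay there.
  have key : ∀ a b : ℝ, 0 < a → ∀ᶠ lam in (g : Filter ℂ),
      ¬ (a ≤ ‖Q.root lam i‖ ∧ ‖Q.root lam i‖ ≤ b) := by
    intro a b ha
    have hK : IsCompact (Metric.closedBall (0 : ℂ) b \ Metric.ball 0 a) :=
      (isCompact_closedBall _ _).diff Metric.isOpen_ball
    have hc : ContinuousOn Q.sym (Metric.closedBall (0 : ℂ) b \ Metric.ball 0 a) := by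
      intro z hz
      have : z ≠ 0 := by
        rintro rfl
        exact hz.2 (Metric.mem_ball_self ha)
      exact (Q.analyticAt_sym this).continuousAt.continuousWithinAt
    have hb : Bornology.IsBounded (Q.sym '' (Metric.closedBall (0 : ℂ) b \ Metric.ball 0 a)) :=
      (hK.image_of_continuousOn hc).isBounded
    filter_upwards [hg (Bornology.isBounded_def.1 hb)] with lam hlam h
    exact hlam ⟨Q.root lam i, by simp [h.1, h.2], Q.sym_root lam i⟩
  rcases g.em (fun lam => ‖Q.root lam i‖ ≤ 1) with h | h
  · left
    rw [Metric.tendsto_nhds]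
    intro ε hε
    filter_upwards [h, key ε 1 hε] with lam h1 h2
    rw [dist_zero_right]
    by_contra h3
    exact h2 ⟨not_lt.1 h3, h1⟩
  · right
    rw [← tendsto_norm_atTop_iff_cobounded, tendsto_atTop]
    intro b
    filter_upwards [h, key 1 b one_pos] with lam h1 h2
    by_contra h3
    exact h2 ⟨(not_le.1 h1).le, (not_le.1 h3).le⟩

/-- As `λ → ∞`, exactly `q` of the roots tend to `0` and the others tend to infinity. -/
theorem tendsto_root_of_lt (g : Ultrafilter ℂ) (hg : (g : Filter ℂ) ≤ Bornology.cobounded ℂ) :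
    (∀ i : Fin N, i.val < Q.q → Tendsto (fun lam => Q.root lam i) g (𝓝 0)) ∧
    (∀ i : Fin N, Q.q ≤ i.val → Tendsto (fun lam => Q.root lam i) g (Bornology.cobounded ℂ)) := by
  classical
  set S : Finset (Fin N) := Finset.univ.filter fun i => Tendsto (fun lam => Q.root lam i) g (𝓝 0)
    with hS
  have hmem : ∀ i, i ∈ S ↔ Tendsto (fun lam => Q.root lam i) g (𝓝 0) := by simp [hS]
  have hnot : ∀ i, i ∉ S → Tendsto (fun lam => Q.root lam i) g (Bornology.cobounded ℂ) :=
    fun i hi => (Q.tendsto_root_infinity g hg i).resolve_left fun h => hi ((hmem i).2 h)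
  have hinv : Tendsto (fun lam : ℂ => lam⁻¹) g (𝓝 0) := tendsto_inv₀_cobounded.mono_left hg
  have hne : ∀ᶠ lam in (g : Filter ℂ), lam ≠ 0 := by
    filter_upwards [hg (Bornology.isBounded_def.1 (Bornology.isBounded_singleton (x := (0 : ℂ))))]
      with lam h using h
  -- `f_λ / (-λ)` converges to `z^q`, while its factors converge to `z` or to `1`.
  set κ : ℂ → ℂ := fun lam => Q.A.leadingCoeff * (-lam⁻¹) * ∏ i ∈ Sᶜ, (-Q.root lam i)
  set F : ℂ → ℂ → ℂ := fun z lam =>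
    (∏ i ∈ S, (z - Q.root lam i)) * ∏ i ∈ Sᶜ, (1 - z * (Q.root lam i)⁻¹)
  have hF : ∀ z, Tendsto (F z) g (𝓝 (z ^ S.card)) := by
    intro z
    have h1 : Tendsto (fun lam => ∏ i ∈ S, (z - Q.root lam i)) g (𝓝 (∏ i ∈ S, (z - 0))) :=
      tendsto_finsetProd _ fun i hi => tendsto_const_nhds.sub ((hmem i).1 hi)
    have h2 : Tendsto (fun lam => ∏ i ∈ Sᶜ, (1 - z * (Q.root lam i)⁻¹)) g
        (𝓝 (∏ i ∈ Sᶜ, (1 - z * 0))) :=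
      tendsto_finsetProd _ fun i hi => tendsto_const_nhds.sub (tendsto_const_nhds.mul
        (tendsto_inv₀_cobounded.comp (hnot i (Finset.mem_compl.1 hi))))
    simpa using h1.mul h2
  have hκF : ∀ z, Tendsto (fun lam => κ lam * F z lam) g (𝓝 (z ^ Q.q)) := by
    intro z
    have h1 : Tendsto (fun lam => z ^ Q.q - Q.A.eval z * lam⁻¹) g (𝓝 (z ^ Q.q - Q.A.eval z * 0)) :=
      tendsto_const_nhds.sub (hinv.const_mul _)
    rw [mul_zero, sub_zero] at h1
    refine h1.congr' ?_
    filter_upwards [hne] with lam hlam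
    have h2 := Q.isRoots_root lam z
    rw [eval_f, ← Finset.prod_mul_prod_compl S] at h2
    have h3 : ∏ i ∈ Sᶜ, (z - Q.root lam i) =
        (∏ i ∈ Sᶜ, (-Q.root lam i)) * ∏ i ∈ Sᶜ, (1 - z * (Q.root lam i)⁻¹) := by
      rw [← Finset.prod_mul_distrib]
      refine Finset.prod_congr rfl fun i _ => ?_
      have := (Q.isRoots_root lam).ne_zero i
      field_simp
      ring
    rw [h3] at h2
    have h4 : z ^ Q.q - Q.A.eval z * lam⁻¹ = (-lam⁻¹) * (Q.A.eval z - lam * z ^ Q.q) := by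
      field_simp
      ring
    rw [h4, h2]
    simp only [κ, F]
    ring
  have hκ : Tendsto κ g (𝓝 1) := by
    have h1 := (hκF 1).div (hF 1) (by simp)
    simp only [one_pow, div_one] at h1
    refine h1.congr' ?_
    filter_upwards [(hF 1).eventually_ne (by simp : (1 : ℂ) ^ S.card ≠ 0)] with lam h
    rw [Pi.div_apply, mul_div_assoc, div_self h, mul_one]
  have hcard : S.card = Q.q := by
    have h1 := tendsto_nhds_unique (hκ.mul (hF 2)) (hκF 2)
    rw [one_mul] at h1
    have h2 : (2 : ℕ) ^ S.card = 2 ^ Q.q := by exact_mod_cast h1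
    exact Nat.pow_right_injective le_rfl h2
  have hdown : ∀ i ∈ S, ∀ j ≤ i, j ∈ S := by
    intro i hi j hj
    rw [hmem] at hi ⊢
    refine squeeze_zero_norm (fun lam => Q.mono lam hj) ?_
    simpa using hi.norm
  have hlow : S = low Q.q N := by
    have h1 : S ⊆ low Q.q N ∨ low Q.q N ⊆ S := by
      by_contra h
      push Not at h
      obtain ⟨i, hi, hi'⟩ := Finset.not_subset.1 h.1
      obtain ⟨j, hj, hj'⟩ := Finset.not_subset.1 h.2
      simp only [low, Finset.mem_filter, Finset.mem_univ, true_and, not_lt] at hi' hj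
      exact hj' (hdown i hi j (Fin.le_def.2 (by omega)))
    rcases h1 with h1 | h1
    · exact Finset.eq_of_subset_of_card_le h1 (by rw [card_low Q.q_lt.le, hcard])
    · exact (Finset.eq_of_subset_of_card_le h1 (by rw [card_low Q.q_lt.le, hcard])).symm
  exact ⟨fun i hi => (hmem i).1 (by rw [hlow]; simp [low, hi]),
    fun i hi => hnot i (by rw [hlow]; simp [low, hi])⟩

theorem mul_deriv_sym {z : ℂ} (hz : z ≠ 0) (hs : Q.sym z ≠ 0) :
    z * deriv Q.sym z / Q.sym z = z * Q.A.derivative.eval z / Q.A.eval z - Q.q := by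
  have h1 : HasDerivAt Q.sym _ z :=
    (Q.A.hasDerivAt z).div (hasDerivAt_pow Q.q z) (pow_ne_zero _ hz)
  have hA : Q.A.eval z ≠ 0 := fun h => hs (by simp [sym, h])
  have hp : z ^ Q.q = z ^ (Q.q - 1) * z := by rw [← pow_succ, Nat.sub_add_cancel Q.q_pos]
  rw [h1.deriv, sym, hp]
  have hz' : z ^ (Q.q - 1) ≠ 0 := pow_ne_zero _ hz
  generalize z ^ (Q.q - 1) = y at hz'
  field_simp

theorem tendsto_mul_deriv_div_zero :
    Tendsto (fun z => z * Q.A.derivative.eval z / Q.A.eval z) (𝓝 0) (𝓝 0) := by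
  have : ContinuousAt (fun z => z * Q.A.derivative.eval z / Q.A.eval z) 0 :=
    (continuousAt_id.mul Q.A.derivative.continuous.continuousAt).div Q.A.continuous.continuousAt
      (by rw [← Polynomial.coeff_zero_eq_eval_zero]; exact Q.coeff_zero_ne)
  simpa using this.tendsto

theorem tendsto_mul_deriv_div_infinity :
    Tendsto (fun z => z * Q.A.derivative.eval z / Q.A.eval z) (Bornology.cobounded ℂ)
      (𝓝 (N : ℂ)) := by
  have hs := IsAlgClosed.splits Q.A
  have hA : Q.A ≠ 0 := fun h => Q.lead_ne (by simp [h])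
  have hcard : Multiset.card Q.A.roots = N := by rw [← hs.natDegree_eq_card_roots, Q.natDegree_A]
  have h1 : ∀ a : ℂ, Tendsto (fun z : ℂ => z * (1 / (z - a))) (Bornology.cobounded ℂ) (𝓝 1) := by
    intro a
    have h2 : Tendsto (fun z : ℂ => (1 - a * z⁻¹)⁻¹) (Bornology.cobounded ℂ) (𝓝 (1 - a * 0)⁻¹) :=
      (tendsto_const_nhds.sub (tendsto_inv₀_cobounded.const_mul a)).inv₀ (by simp)
    simp only [mul_zero, sub_zero, inv_one] at h2
    refine h2.congr' ?_
    filter_upwards [Bornology.isBounded_def.1 (Bornology.isBounded_singleton (x := (0 : ℂ)))]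
      with z hz
    have hz : z ≠ 0 := hz
    have : 1 - a * z⁻¹ = (z - a) * z⁻¹ := by field_simp
    rw [this, mul_inv, inv_inv]
    ring
  have h2 : Tendsto (fun z : ℂ => (Q.A.roots.map fun a => z * (1 / (z - a))).sum)
      (Bornology.cobounded ℂ) (𝓝 (Q.A.roots.map fun _ => (1 : ℂ)).sum) :=
    tendsto_multiset_sum _ fun a _ => h1 a
  simp only [Multiset.map_const', Multiset.sum_replicate, hcard, nsmul_eq_mul, mul_one] at h2
  refine h2.congr' ?_
  have hfin : Bornology.IsBounded (Q.A.roots.toFinset : Set ℂ) :=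
    (Finset.finite_toSet _).isBounded
  filter_upwards [Bornology.isBounded_def.1 hfin] with z hz
  have hz0 : Q.A.eval z ≠ 0 := by
    intro h
    exact hz (by simp [Polynomial.mem_roots hA, h])
  rw [Multiset.sum_map_mul_left, ← hs.eval_derivative_div_eval_of_ne_zero hz0, mul_div_assoc]

/-- As `λ → ∞`, the contribution of a single root to `λ w'/w` tends to the reciprocal of the limit of
`z sym'(z) / sym(z)`, which is `-q` at `0` and `N - q` at infinity. -/
theorem tendsto_lam_div {g : Ultrafilter ℂ} (hg : (g : Filter ℂ) ≤ Bornology.cobounded ℂ)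
    (i : Fin N) : Tendsto (fun lam => lam * (1 / (Q.root lam i * deriv Q.sym (Q.root lam i)))) g
      (𝓝 (if i.val < Q.q then -1 / (Q.q : ℂ) else 1 / ((N : ℂ) - Q.q))) := by
  have hne : ∀ᶠ lam in (g : Filter ℂ), lam ≠ 0 := by
    filter_upwards [hg (Bornology.isBounded_def.1 (Bornology.isBounded_singleton (x := (0 : ℂ))))]
      with lam h using h
  have hq : (Q.q : ℂ) ≠ 0 := by exact_mod_cast Q.q_pos.ne'
  have hNq : (N : ℂ) - Q.q ≠ 0 := by
    rw [sub_ne_zero]; exact_mod_cast Q.q_lt.ne'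
  have key : ∀ {c : ℂ}, Tendsto (fun lam => Q.root lam i * Q.A.derivative.eval (Q.root lam i) /
      Q.A.eval (Q.root lam i)) g (𝓝 c) → c - Q.q ≠ 0 →
      Tendsto (fun lam => lam * (1 / (Q.root lam i * deriv Q.sym (Q.root lam i)))) g
        (𝓝 (c - Q.q)⁻¹) := by
    intro c hc hc0
    refine ((hc.sub_const (Q.q : ℂ)).inv₀ hc0).congr' ?_
    filter_upwards [hne] with lam hlam
    rw [← Q.mul_deriv_sym ((Q.isRoots_root lam).ne_zero i) (by rwa [sym_root]), sym_root, inv_div]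
    ring
  obtain ⟨h1, h2⟩ := Q.tendsto_root_of_lt g hg
  split_ifs with hi
  · have := key (Q.tendsto_mul_deriv_div_zero.comp (h1 i hi)) (by simpa using hq)
    convert this using 2
    rw [zero_sub, inv_neg, neg_div, one_div]
  · have := key (Q.tendsto_mul_deriv_div_infinity.comp (h2 i (not_lt.1 hi))) hNq
    convert this using 2
    rw [one_div]

/-- The product of all roots does not depend on `λ`, so its logarithmic derivative vanishes. -/
theorem sum_eq_zero {lam : ℂ} (hs : lam ∈ Q.Simple) :
    ∑ i, 1 / (Q.root lam i * deriv Q.sym (Q.root lam i)) = 0 := by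
  obtain ⟨ψ, h1, h2⟩ := Q.exists_localRoots (Q.isRoots_root lam) hs
  have h3 := h2.self_of_nhds.logDeriv_prod Finset.univ
  simp only [h1] at h3
  rw [← h3]
  have h4 : (fun x => ∏ i, ψ i x) =ᶠ[𝓝 lam] fun _ => Q.total / Q.A.leadingCoeff := by
    filter_upwards [h2] with x hx
    rw [eq_div_iff Q.lead_ne, mul_comm, hx.roots.prod_eq, total]
  rw [logDeriv_apply, h4.deriv_eq]
  simp

/-- The total mass of the limit measure: the smaller of the two bounds for `deg P_n / n` from
`natDegree_mul_le` and `natDegree_mul_le'`. -/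
def mass : ℝ := if Q.q ≤ m then ((N : ℝ) - m) / (N - Q.q) else m / Q.q

theorem natDegree_le_mass {n : ℕ} {D : ℂ[X]}
    (hD : ∀ lam, D.eval lam = (polyToeplitz m n (Q.f lam)).det) :
    (D.natDegree : ℝ) ≤ n * Q.mass := by
  have hq : (0 : ℝ) < Q.q := by exact_mod_cast Q.q_pos
  have hNq : (0 : ℝ) < (N : ℝ) - Q.q := by
    rw [sub_pos]; exact_mod_cast Q.q_lt
  rw [mass]
  split_ifs with h
  · rw [mul_div_assoc', le_div_iff₀ hNq]
    have := Q.natDegree_mul_le hD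
    rw [← Nat.cast_sub Q.q_lt.le, ← Nat.cast_sub Q.m_lt.le]
    exact_mod_cast this
  · rw [mul_div_assoc', le_div_iff₀ hq]
    exact_mod_cast Q.natDegree_mul_le' hD

theorem mass_nonneg : 0 ≤ Q.mass := by
  have h1 : (Q.q : ℝ) ≤ N := by exact_mod_cast Q.q_lt.le
  have h2 : (m : ℝ) ≤ N := by exact_mod_cast Q.m_lt.le
  rw [mass]
  split_ifs
  · exact div_nonneg (by linarith) (by linarith)
  · positivity

/-- At infinity `-w'/w` behaves like the Cauchy transform of a measure of total mass `mass`. -/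
theorem tendsto_mul_logDeriv_w :
    Tendsto (fun lam => lam * -logDeriv Q.w lam) (Bornology.cobounded ℂ ⊓ 𝓟 Q.good)
      (𝓝 (Q.mass : ℂ)) := by
  rw [tendsto_iff_ultrafilter]
  intro g hg
  have hgood : ∀ᶠ lam in (g : Filter ℂ), lam ∈ Q.good :=
    hg.trans inf_le_right (mem_principal_self _)
  have hlim := Q.tendsto_lam_div (hg.trans inf_le_left)
  rw [mass]
  split_ifs with h
  · have h1 := tendsto_finsetSum (low m N)ᶜ fun i _ => hlim i
    have h2 : ∑ i ∈ (low m N)ᶜ, (if i.val < Q.q then -1 / (Q.q : ℂ) else 1 / ((N : ℂ) - Q.q)) =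
        (((N : ℝ) - m) / (N - Q.q) : ℝ) := by
      rw [Finset.sum_congr rfl (g := fun _ => 1 / ((N : ℂ) - Q.q))
        (fun i hi => if_neg (by simp [low] at hi; omega)), Finset.sum_const, Finset.card_compl,
        card_low Q.m_lt.le, Fintype.card_fin, nsmul_eq_mul, Nat.cast_sub Q.m_lt.le]
      push_cast
      ring
    rw [h2] at h1
    refine h1.congr' ?_
    filter_upwards [hgood] with lam hlam
    rw [Q.logDeriv_w hlam.1 hlam.2, ← Finset.mul_sum]
    have h3 := Q.sum_eq_zero hlam.1
    rw [← Finset.sum_add_sum_compl (low m N)] at h3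
    congr 1
    linear_combination h3
  · have h1 := (tendsto_finsetSum (low m N) fun i _ => hlim i).neg
    have h2 : -∑ i ∈ low m N, (if i.val < Q.q then -1 / (Q.q : ℂ) else 1 / ((N : ℂ) - Q.q)) =
        ((m : ℝ) / Q.q : ℝ) := by
      rw [Finset.sum_congr rfl (g := fun _ => -1 / (Q.q : ℂ))
        (fun i hi => if_pos (by simp [low] at hi; omega)), Finset.sum_const,
        card_low Q.m_lt.le, nsmul_eq_mul]
      push_cast
      ring
    rw [h2] at h1
    refine h1.congr' ?_
    filter_upwards [hgood] with lam hlam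
    rw [Q.logDeriv_w hlam.1 hlam.2, ← Finset.mul_sum]
    ring

end Pencil

/-! ### Local structure of `Γ` -/

/-- Straightening of a level curve `|h| = 1` through a point where `h' ≠ 0`. -/
theorem exists_level_chart {h : ℂ → ℂ} {z₀ : ℂ} (ha : AnalyticAt ℂ h z₀) (h1 : ‖h z₀‖ = 1)
    (hd : deriv h z₀ ≠ 0) {V : Set ℂ} (hV : V ∈ 𝓝 z₀) :
    ∃ (φ L : ℂ → ℂ) (δ : ℝ), 0 < δ ∧ φ 0 = z₀ ∧ AnalyticOnNhd ℂ φ (Metric.ball 0 δ) ∧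
      (∀ r, 0 < r → r ≤ δ → IsOpen (φ '' Metric.ball 0 r)) ∧
      ContinuousOn L (φ '' Metric.ball 0 δ) ∧
      ∀ ζ ∈ Metric.ball (0 : ℂ) δ, deriv φ ζ ≠ 0 ∧ L (φ ζ) = ζ ∧ ‖h (φ ζ)‖ = Real.exp ζ.re ∧
        φ ζ ∈ V := by
  have h0 : h z₀ ≠ 0 := fun h2 => by simp [h2] at h1
  set L : ℂ → ℂ := fun z => Complex.log (h z / h z₀) with hL
  have hq : AnalyticAt ℂ (fun z => h z / h z₀) z₀ := ha.div analyticAt_const h0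
  have hLa : AnalyticAt ℂ L z₀ := hq.clog (by simp [h0])
  have hL0 : L z₀ = 0 := by simp [hL]
  have hLd : HasDerivAt L (deriv h z₀ / h z₀) z₀ := by
    have h2 := (ha.differentiableAt.hasDerivAt.div_const (h z₀)).clog (by simp [h0])
    simpa [h0] using h2
  have hLne : deriv h z₀ / h z₀ ≠ 0 := div_ne_zero hd h0
  have hstrict : HasStrictDerivAt L (deriv h z₀ / h z₀) z₀ := by
    have := hLa.hasStrictDerivAt
    rwa [hLd.deriv] at this
  set e := (hstrict.hasStrictFDerivAt_equiv hLne).toOpenPartialHomeomorph L with he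
  have hecoe : (e : ℂ → ℂ) = L := rfl
  have hsrc : z₀ ∈ e.source := (hstrict.hasStrictFDerivAt_equiv hLne).mem_toOpenPartialHomeomorph_source
  have htgt : (0 : ℂ) ∈ e.target := by
    have := e.map_source hsrc
    rwa [hecoe, hL0] at this
  have hs0 : e.symm 0 = z₀ := by
    have := e.left_inv hsrc
    rwa [hecoe, hL0] at this
  have hφa : AnalyticAt ℂ e.symm 0 := by
    refine e.analyticAt_symm (i := ContinuousLinearEquiv.unitsEquivAut ℂ (Units.mk0 _ hLne)) htgt
      ?_ ?_
    · rw [hs0]; exact hLa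
    · rw [hs0]; exact (hstrict.hasStrictFDerivAt_equiv hLne).hasFDerivAt.fderiv
  have hexp : ∀ᶠ z in 𝓝 z₀, ‖h z‖ = Real.exp (L z).re := by
    filter_upwards [ha.continuousAt.eventually_ne h0] with z hz
    rw [← Complex.norm_exp, hL, Complex.exp_log (div_ne_zero hz h0), norm_div, h1, div_one]
  have hc0 : ContinuousAt e.symm 0 := hφa.continuousAt
  have hev : ∀ᶠ ζ in 𝓝 (0 : ℂ), AnalyticAt ℂ e.symm ζ ∧ ζ ∈ e.target ∧
      (AnalyticAt ℂ L (e.symm ζ) ∧ ‖h (e.symm ζ)‖ = Real.exp (L (e.symm ζ)).re ∧ e.symm ζ ∈ V) := by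
    have htgt' : ∀ᶠ ζ in 𝓝 (0 : ℂ), ζ ∈ e.target := e.open_target.mem_nhds htgt
    refine hφa.eventually_analyticAt.and (htgt'.and ?_)
    refine Tendsto.eventually (p := fun z => AnalyticAt ℂ L z ∧ ‖h z‖ = Real.exp (L z).re ∧ z ∈ V)
      hc0 ?_
    rw [hs0]
    exact hLa.eventually_analyticAt.and (hexp.and hV)
  obtain ⟨δ, hδ, hball⟩ := Metric.eventually_nhds_iff_ball.1 hev
  have hsub : Metric.ball (0 : ℂ) δ ⊆ e.target := fun ζ hζ => (hball ζ hζ).2.1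
  have hinv : ∀ ζ ∈ Metric.ball (0 : ℂ) δ, L (e.symm ζ) = ζ := fun ζ hζ => e.right_inv (hsub hζ)
  refine ⟨e.symm, L, δ, hδ, hs0, fun ζ hζ => (hball ζ hζ).1, fun r hr hrδ => ?_, ?_,
    fun ζ hζ => ⟨?_, hinv ζ hζ, ?_, (hball ζ hζ).2.2.2.2⟩⟩
  · exact e.symm.isOpen_image_of_subset_source Metric.isOpen_ball
      ((Metric.ball_subset_ball hrδ).trans hsub)
  · rintro _ ⟨ζ, hζ, rfl⟩
    exact (hball ζ hζ).2.2.1.continuousAt.continuousWithinAt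
  · intro h2
    have h3 : HasDerivAt (fun x => L (e.symm x)) (deriv L (e.symm ζ) * deriv e.symm ζ) ζ :=
      HasDerivAt.comp ζ (hball ζ hζ).2.2.1.differentiableAt.hasDerivAt
        (hball ζ hζ).1.differentiableAt.hasDerivAt
    have h4 : (fun x => L (e.symm x)) =ᶠ[𝓝 ζ] id := by
      filter_upwards [Metric.isOpen_ball.mem_nhds hζ] with x hx using hinv x hx
    have h5 := h3.unique (h4.hasDerivAt_iff.2 (hasDerivAt_id ζ))
    rw [h2, mul_zero] at h5
    exact zero_ne_one h5
  · rw [(hball ζ hζ).2.2.2.1, hinv ζ hζ]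

/-- A level curve `|h| = 1` through a point where `h' ≠ 0`, as a parametrized analytic arc. -/
theorem exists_level_arc {h : ℂ → ℂ} {z₀ : ℂ} (ha : AnalyticAt ℂ h z₀) (h1 : ‖h z₀‖ = 1)
    (hd : deriv h z₀ ≠ 0) {V : Set ℂ} (hV : V ∈ 𝓝 z₀) :
    ∃ (γ : ℝ → ℂ) (δ : ℝ) (U : Set ℂ), 0 < δ ∧ γ 0 = z₀ ∧
      AnalyticOnNhd ℝ γ (Set.Ioo (-δ) δ) ∧ (∀ x ∈ Set.Ioo (-δ) δ, deriv γ x ≠ 0) ∧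
      IsEmbedding (fun x : Set.Ioo (-δ) δ => γ x) ∧ IsOpen U ∧ U ⊆ V ∧
      (∀ r, 0 < r → r ≤ δ → ∃ W ∈ 𝓝 z₀, γ '' Set.Ioo (-r) r = {z | ‖h z‖ = 1} ∩ W) ∧
      γ '' Set.Ioo (-δ) δ = {z | ‖h z‖ = 1} ∩ U := by
  obtain ⟨φ, L, δ, hδ, h0, hφ, hop, hL, hall⟩ := exists_level_chart ha h1 hd hV
  have hmem : ∀ {r : ℝ} {x : ℝ}, x ∈ Set.Ioo (-r) r → Complex.I * (x : ℂ) ∈ Metric.ball (0 : ℂ) r := by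
    intro r x hx
    simpa [abs_lt] using hx
  have himg : ∀ r, r ≤ δ → (fun x : ℝ => φ (Complex.I * x)) '' Set.Ioo (-r) r =
      {z | ‖h z‖ = 1} ∩ φ '' Metric.ball 0 r := by
    intro r hr
    ext z
    constructor
    · rintro ⟨x, hx, rfl⟩
      refine ⟨?_, _, hmem hx, rfl⟩
      have := (hall _ (Metric.ball_subset_ball hr (hmem hx))).2.2.1
      simpa using this
    · rintro ⟨hz, ζ, hζ, rfl⟩
      have h2 := (hall _ (Metric.ball_subset_ball hr hζ)).2.2.1
      have h3 : ζ.re = 0 := by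
        rw [Set.mem_ofPred_eq] at hz
        rw [hz] at h2
        exact (Real.exp_eq_one_iff _).1 h2.symm
      have h4 : Complex.I * (ζ.im : ℂ) = ζ := by
        apply Complex.ext <;> simp [h3]
      refine ⟨ζ.im, ?_, by simp only [h4]⟩
      have : ‖ζ‖ < r := by simpa using hζ
      rw [← h4] at this
      simpa [abs_lt] using this
  have hlin : ∀ x : ℝ, HasDerivAt (fun x : ℝ => Complex.I * (x : ℂ)) Complex.I x := fun x => by
    simpa using (Complex.ofRealCLM.hasDerivAt (x := x)).const_mul Complex.I
  refine ⟨fun x => φ (Complex.I * x), δ, φ '' Metric.ball 0 δ, hδ, by simp [h0], ?_, ?_, ?_,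
    hop δ hδ le_rfl, ?_, ?_, himg δ le_rfl⟩
  · intro x hx
    have h2 : AnalyticAt ℝ (fun x : ℝ => Complex.I * (x : ℂ)) x :=
      analyticAt_const.mul (Complex.ofRealCLM.analyticAt x)
    exact AnalyticAt.comp (g := φ) (hφ _ (hmem hx)).restrictScalars h2
  · intro x hx
    have h2 := HasDerivAt.scomp x (hφ _ (hmem hx)).differentiableAt.hasDerivAt (hlin x)
    have h3 : deriv (fun x : ℝ => φ (Complex.I * x)) x = _ := h2.deriv
    rw [h3, smul_eq_mul]
    exact mul_ne_zero Complex.I_ne_zero (hall _ (hmem hx)).1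
  · set f : Set.Ioo (-δ) δ → φ '' Metric.ball 0 δ := fun x =>
      ⟨φ (Complex.I * (x : ℝ)), _, hmem x.2, rfl⟩ with hf
    set g : φ '' Metric.ball 0 δ → ℝ := fun u => (L u).im with hg
    have hfc : Continuous f := by
      refine Continuous.subtype_mk ?_ _
      refine continuous_iff_continuousAt.2 fun x => ?_
      have h2 : ContinuousAt (fun x : Set.Ioo (-δ) δ => Complex.I * ((x : ℝ) : ℂ)) x := by fun_prop
      exact ContinuousAt.comp (g := φ) (hφ _ (hmem x.2)).continuousAt h2
    have hgc : Continuous g := Complex.continuous_im.comp (continuousOn_iff_continuous_domRestrict.1 hL)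
    have hgf : g ∘ f = Subtype.val := by
      funext x
      simp only [hg, hf, Function.comp_apply]
      rw [(hall _ (hmem x.2)).2.1]
      simp
    have h2 : IsEmbedding f := IsEmbedding.of_comp hfc hgc (by rw [hgf]; exact IsEmbedding.subtypeVal)
    exact IsEmbedding.subtypeVal.comp h2
  · rintro _ ⟨ζ, hζ, rfl⟩
    exact (hall ζ hζ).2.2.2
  · intro r hr hrδ
    exact ⟨φ '' Metric.ball 0 r, (hop r hr hrδ).mem_nhds ⟨0, by simpa using hr, h0⟩, himg r hrδ⟩

/-- Two analytic level curves through a point either coincide near it, or meet there only at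
that point. -/
theorem eventually_level_dichotomy {h k : ℂ → ℂ} {z₀ : ℂ} (ha : AnalyticAt ℂ h z₀)
    (h1 : ‖h z₀‖ = 1) (hd : deriv h z₀ ≠ 0) (hk : AnalyticAt ℂ k z₀) :
    (∀ᶠ z in 𝓝 z₀, ‖h z‖ = 1 → ‖k z‖ = 1) ∨ (∀ᶠ z in 𝓝[≠] z₀, ‖h z‖ = 1 → ‖k z‖ ≠ 1) := by
  obtain ⟨γ, δ, U, hδ, h0, hγ, -, -, -, -, hW, -⟩ := exists_level_arc ha h1 hd univ_mem
  have hγ0 : AnalyticAt ℝ γ 0 := hγ 0 (by simp [hδ])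
  have hkγ : AnalyticAt ℝ (fun x : ℝ => k (γ x)) 0 :=
    AnalyticAt.comp (g := k) (by rw [h0]; exact hk.restrictScalars) hγ0
  have hr : AnalyticAt ℝ (fun x : ℝ => (k (γ x)).re ^ 2 + (k (γ x)).im ^ 2 - 1) 0 :=
    ((((Complex.reCLM.analyticAt _).comp hkγ).pow 2).add
      (((Complex.imCLM.analyticAt _).comp hkγ).pow 2)).sub analyticAt_const
  have hiff : ∀ x : ℝ, (k (γ x)).re ^ 2 + (k (γ x)).im ^ 2 - 1 = 0 ↔ ‖k (γ x)‖ = 1 := by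
    intro x
    have h2 : ‖k (γ x)‖ ^ 2 = (k (γ x)).re ^ 2 + (k (γ x)).im ^ 2 := by
      rw [← Complex.normSq_eq_norm_sq, Complex.normSq_apply]; ring
    rw [← h2, sub_eq_zero, pow_eq_one_iff_of_nonneg (norm_nonneg _) two_ne_zero]
  rcases hr.eventually_eq_zero_or_eventually_ne_zero with h2 | h2
  · left
    obtain ⟨ε, hε, hball⟩ := Metric.eventually_nhds_iff_ball.1 h2
    obtain ⟨W, hW0, himg⟩ := hW (min ε δ) (lt_min hε hδ) (min_le_right _ _)
    filter_upwards [hW0] with z hz hz1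
    have h3 : z ∈ γ '' Set.Ioo (-min ε δ) (min ε δ) := by rw [himg]; exact ⟨hz1, hz⟩
    obtain ⟨x, hx, rfl⟩ := h3
    refine (hiff x).1 (hball x ?_)
    rw [Metric.mem_ball, Real.dist_0_eq_abs, abs_lt]
    exact ⟨by linarith [hx.1, min_le_left ε δ], by linarith [hx.2, min_le_left ε δ]⟩
  · right
    rw [eventually_nhdsWithin_iff] at h2 ⊢
    obtain ⟨ε, hε, hball⟩ := Metric.eventually_nhds_iff_ball.1 h2
    obtain ⟨W, hW0, himg⟩ := hW (min ε δ) (lt_min hε hδ) (min_le_right _ _)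
    filter_upwards [hW0] with z hz hne hz1
    have h3 : z ∈ γ '' Set.Ioo (-min ε δ) (min ε δ) := by rw [himg]; exact ⟨hz1, hz⟩
    obtain ⟨x, hx, rfl⟩ := h3
    intro h4
    refine hball x ?_ ?_ ((hiff x).2 h4)
    · rw [Metric.mem_ball, Real.dist_0_eq_abs, abs_lt]
      exact ⟨by linarith [hx.1, min_le_left ε δ], by linarith [hx.2, min_le_left ε δ]⟩
    · rintro rfl
      exact hne h0

/-- A set all of whose points are isolated is countable. -/
theorem countable_of_isolated {S : Set ℂ} (h : ∀ x ∈ S, ∀ᶠ y in 𝓝[≠] x, y ∉ S) : S.Countable := by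
  have : DiscreteTopology S := by
    rw [discreteTopology_subtype_iff]
    intro x hx
    have h1 := h x hx
    rw [Filter.inf_principal_eq_bot]
    exact h1
  exact Set.countable_coe_iff.1 (countable_of_Lindelof_of_discrete (X := S))

namespace Pencil

variable {N m : ℕ} (Q : Pencil N m)

variable {Q} in
theorem LocalRoots.sym_eq {lam : ℂ} {ψ : Fin N → ℂ → ℂ} (h : Q.LocalRoots lam ψ) (i : Fin N) :
    Q.sym (ψ i lam) = lam :=
  (Q.sym_eq_iff (h.roots.ne_zero i)).2 ((h.roots.eval_eq_zero_iff _).2 ⟨i, rfl⟩)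

/-- No two root functions are proportional, since the exponents of the pencil have no common
divisor. -/
theorem not_eventually_proportional {lam₀ : ℂ} {ψ : Fin N → ℂ → ℂ}
    (hψ : ∀ᶠ lam in 𝓝 lam₀, Q.LocalRoots lam ψ) {i j : Fin N} (hij : i ≠ j) (c : ℂ) :
    ¬ ∀ᶠ lam in 𝓝 lam₀, ψ i lam = c * ψ j lam := by
  intro h
  have h0 := hψ.self_of_nhds
  have hc : c ≠ 0 := by
    rintro rfl
    exact h0.roots.ne_zero i (by simpa using h.self_of_nhds)
  have hpoly : Q.A.comp (Polynomial.C c * Polynomial.X) - Polynomial.C (c ^ Q.q) * Q.A = 0 := by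
    refine Polynomial.eq_zero_of_infinite_isRoot _ ?_
    have hinf : ({lam | Q.LocalRoots lam ψ ∧ ψ i lam = c * ψ j lam}).Infinite :=
      infinite_of_mem_nhds lam₀ (hψ.and h)
    refine (hinf.image (f := ψ j) ?_).mono ?_
    · intro x hx y hy hxy
      rw [← hx.1.sym_eq j, ← hy.1.sym_eq j, hxy]
    · rintro _ ⟨lam, ⟨h1, h2⟩, rfl⟩
      have e1 := (h1.roots.eval_eq_zero_iff (ψ i lam)).2 ⟨i, rfl⟩
      have e2 := (h1.roots.eval_eq_zero_iff (ψ j lam)).2 ⟨j, rfl⟩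
      rw [eval_f] at e1 e2
      rw [h2] at e1
      simp only [Set.mem_ofPred_eq, Polynomial.IsRoot.def, Polynomial.eval_sub, Polynomial.eval_comp, Polynomial.eval_mul,
        Polynomial.eval_C, Polynomial.eval_X]
      linear_combination e1 - c ^ Q.q * e2
  have hc1 : c = 1 := by
    refine Q.rigid c hc fun l hl => ?_
    have h2 := congrArg (fun p => Polynomial.coeff p l) hpoly
    simp only [Polynomial.coeff_sub, Polynomial.comp_C_mul_X_coeff, Polynomial.coeff_C_mul,
      Polynomial.coeff_zero] at h2
    have h3 : Q.A.coeff l * (c ^ l - c ^ Q.q) = 0 := by linear_combination h2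
    exact sub_eq_zero.1 ((mul_eq_zero.1 h3).resolve_left hl)
  have := h.self_of_nhds
  rw [hc1, one_mul] at this
  exact hij (h0.inj this)

/-- The points with distinct roots where two of the root functions have the same logarithmic
derivative. -/
def Crit : Set ℂ :=
  {lam ∈ Q.Simple | ∃ i j, i ≠ j ∧ Q.root lam i * deriv Q.sym (Q.root lam i) =
    Q.root lam j * deriv Q.sym (Q.root lam j)}

variable {Q} in
theorem LocalRoots.mem_crit_iff {lam : ℂ} {ψ : Fin N → ℂ → ℂ} (h : Q.LocalRoots lam ψ) :
    lam ∈ Q.Crit ↔ ∃ i j, i ≠ j ∧ logDeriv (ψ i) lam = logDeriv (ψ j) lam := by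
  obtain ⟨σ, hσ⟩ := h.roots.perm (Q.isRoots_root lam)
  have hl : ∀ i j, logDeriv (ψ i) lam = logDeriv (ψ j) lam ↔
      Q.root lam (σ i) * deriv Q.sym (Q.root lam (σ i)) =
        Q.root lam (σ j) * deriv Q.sym (Q.root lam (σ j)) := by
    intro i j
    rw [h.logDeriv_eq, h.logDeriv_eq, one_div, one_div, inv_inj, ← hσ, ← hσ]
  constructor
  · rintro ⟨-, i, j, hij, he⟩
    exact ⟨σ.symm i, σ.symm j, σ.symm.injective.ne hij, (hl _ _).2 (by simpa using he)⟩
  · rintro ⟨i, j, hij, he⟩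
    exact ⟨h.simple, σ i, σ j, σ.injective.ne hij, (hl i j).1 he⟩

variable {Q} in
theorem LocalRoots.logDeriv_div {lam : ℂ} {ψ : Fin N → ℂ → ℂ} (h : Q.LocalRoots lam ψ)
    (i j : Fin N) : logDeriv (fun z => ψ i z / ψ j z) lam =
      logDeriv (ψ i) lam - logDeriv (ψ j) lam :=
  _root_.logDeriv_div _ (h.roots.ne_zero i) (h.roots.ne_zero j)
    (h.analytic i).differentiableAt (h.analytic j).differentiableAt

/-- If the logarithmic derivatives of two root functions agreed on a set with a limit point, the
functions would be proportional. -/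
theorem eventually_notMem_crit {lam₀ : ℂ} (hs : lam₀ ∈ Q.Simple) :
    ∀ᶠ lam in 𝓝[≠] lam₀, lam ∉ Q.Crit := by
  obtain ⟨ψ, -, hψ⟩ := Q.exists_localRoots (Q.isRoots_root lam₀) hs
  have h0 := hψ.self_of_nhds
  have hne : ∀ i j, i ≠ j → ∀ᶠ lam in 𝓝[≠] lam₀, logDeriv (ψ i) lam ≠ logDeriv (ψ j) lam := by
    intro i j hij
    have hld : ∀ i, AnalyticAt ℂ (logDeriv (ψ i)) lam₀ := fun i =>
      (h0.analytic i).deriv.div (h0.analytic i) (h0.roots.ne_zero i)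
    rcases ((hld i).sub (hld j)).eventually_eq_zero_or_eventually_ne_zero with h1 | h1
    · exfalso
      obtain ⟨r, hr, hball⟩ := Metric.eventually_nhds_iff_ball.1 (hψ.and h1)
      have hd : ∀ i, DifferentiableOn ℂ (ψ i) (Metric.ball lam₀ r) := fun i x hx =>
        ((hball x hx).1.analytic i).differentiableAt.differentiableWithinAt
      have h2 : Set.EqOn (logDeriv (ψ i)) (logDeriv (ψ j)) (Metric.ball lam₀ r) := fun x hx =>
        sub_eq_zero.1 (hball x hx).2
      obtain ⟨c, -, hc⟩ := (logDeriv_eqOn_iff (hd i) (hd j) Metric.isOpen_ball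
        (convex_ball _ _).isPreconnected (fun x hx => (hball x hx).1.roots.ne_zero j)
        (fun x hx => (hball x hx).1.roots.ne_zero i)).1 h2
      refine Q.not_eventually_proportional hψ hij c ?_
      filter_upwards [Metric.ball_mem_nhds lam₀ hr] with x hx
      simpa using hc hx
    · filter_upwards [h1] with x hx h2
      exact hx (sub_eq_zero.2 h2)
  have h2 : ∀ᶠ lam in 𝓝[≠] lam₀, ∀ i j, i ≠ j → logDeriv (ψ i) lam ≠ logDeriv (ψ j) lam := by
    rw [eventually_all]; intro i
    rw [eventually_all]; intro j
    rw [eventually_imp_distrib_left]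
    exact hne i j
  filter_upwards [h2, hψ.filter_mono nhdsWithin_le_nhds] with lam h3 h4 h5
  obtain ⟨i, j, hij, he⟩ := h4.mem_crit_iff.1 h5
  exact h3 i j hij he

/-- `γ` parametrizes a regular open analytic arc of `Γ` on which the roots are distinct. -/
structure IsArc (γ : ℝ → ℂ) (s t : ℝ) : Prop where
  analytic : AnalyticOnNhd ℝ γ (Set.Ioo s t)
  deriv_ne_zero : ∀ x ∈ Set.Ioo s t, deriv γ x ≠ 0
  embedding : IsEmbedding (fun x : Set.Ioo s t => γ x)
  image_eq : ∃ U : Set ℂ, IsOpen U ∧ γ '' Set.Ioo s t = Q.Gam ∩ U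
  simple : ∀ x ∈ Set.Ioo s t, γ x ∈ Q.Simple

/-- The points of `Γ` that lie on no regular arc. -/
def Exc : Set ℂ :=
  {lam ∈ Q.Gam | ¬ ∃ (γ : ℝ → ℂ) (s t : ℝ), Q.IsArc γ s t ∧ lam ∈ γ '' Set.Ioo s t}

variable {Q} in
theorem LocalRoots.exists_tie {lam : ℂ} {ψ : Fin N → ℂ → ℂ} (h : Q.LocalRoots lam ψ)
    (hG : lam ∈ Q.Gam) : ∃ i j, i ≠ j ∧ ‖ψ i lam‖ = ‖ψ j lam‖ := by
  obtain ⟨σ, hσ⟩ := (Q.isRoots_root lam).perm h.roots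
  have := Q.m_pos
  refine ⟨σ ⟨m - 1, by have := Q.m_lt; omega⟩, σ ⟨m, Q.m_lt⟩, σ.injective.ne ?_, ?_⟩
  · simp only [ne_eq, Fin.mk.injEq]; omega
  · rw [← hσ, ← hσ]
    exact hG

/-- Near a point of `Γ` the ordering of the moduli of the roots can only change within ties. -/
theorem eventually_norm_lt {lam₀ : ℂ} {ψ : Fin N → ℂ → ℂ} (hψ : Q.LocalRoots lam₀ ψ) :
    ∀ᶠ lam in 𝓝 lam₀, ∀ i j, ‖ψ i lam₀‖ < ‖ψ j lam₀‖ → ‖ψ i lam‖ < ‖ψ j lam‖ := by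
  rw [eventually_all]; intro i
  rw [eventually_all]; intro j
  rw [eventually_imp_distrib_left]
  exact fun h => (hψ.analytic i).continuousAt.norm.eventually_lt
    (hψ.analytic j).continuousAt.norm h

/-- If all ties between the moduli of the roots at a point of `Γ` persist along one and the same
regular curve, then this curve is `Γ` near the point. -/
theorem exists_arc {lam₀ : ℂ} (hG : lam₀ ∈ Q.Gam) {ψ : Fin N → ℂ → ℂ}
    (hψ : ∀ᶠ lam in 𝓝 lam₀, Q.LocalRoots lam ψ) (hcrit : lam₀ ∉ Q.Crit)
    (hties : ∀ i j i' j', i ≠ j → i' ≠ j' → ‖ψ i lam₀‖ = ‖ψ j lam₀‖ →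
      ‖ψ i' lam₀‖ = ‖ψ j' lam₀‖ →
      ∀ᶠ lam in 𝓝 lam₀, ‖ψ i lam‖ = ‖ψ j lam‖ → ‖ψ i' lam‖ = ‖ψ j' lam‖) :
    lam₀ ∉ Q.Exc := by
  have h0 := hψ.self_of_nhds
  obtain ⟨i₀, j₀, hij, htie⟩ := h0.exists_tie hG
  have hall : ∀ᶠ lam in 𝓝 lam₀, ∀ i j i' j', i ≠ j → i' ≠ j' → ‖ψ i lam₀‖ = ‖ψ j lam₀‖ →
      ‖ψ i' lam₀‖ = ‖ψ j' lam₀‖ → ‖ψ i lam‖ = ‖ψ j lam‖ → ‖ψ i' lam‖ = ‖ψ j' lam‖ := by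
    rw [eventually_all]; intro i
    rw [eventually_all]; intro j
    rw [eventually_all]; intro i'
    rw [eventually_all]; intro j'
    simp only [eventually_imp_distrib_left]
    exact hties i j i' j'
  set h : ℂ → ℂ := fun z => ψ i₀ z / ψ j₀ z with hh
  have hha : AnalyticAt ℂ h lam₀ := (h0.analytic i₀).div (h0.analytic j₀) (h0.roots.ne_zero j₀)
  have hh1 : ‖h lam₀‖ = 1 := by
    rw [hh, norm_div, htie, div_self (norm_ne_zero_iff.2 (h0.roots.ne_zero j₀))]
  have hhd : deriv h lam₀ ≠ 0 := by
    intro h1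
    have h2 := h0.logDeriv_div i₀ j₀
    rw [logDeriv_apply] at h2
    rw [show deriv (fun z => ψ i₀ z / ψ j₀ z) lam₀ = 0 from h1, zero_div] at h2
    exact hcrit (h0.mem_crit_iff.2 ⟨i₀, j₀, hij, sub_eq_zero.1 h2.symm⟩)
  have hV := (hψ.and hall).and (Q.eventually_norm_lt h0)
  obtain ⟨γ, δ, U, hδ, hγ0, hγ, hγd, hemb, hU, hUV, -, himg⟩ := exists_level_arc hha hh1 hhd hV
  have hUV' : ∀ z ∈ U, (Q.LocalRoots z ψ ∧ ∀ i j i' j', i ≠ j → i' ≠ j' →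
      ‖ψ i lam₀‖ = ‖ψ j lam₀‖ → ‖ψ i' lam₀‖ = ‖ψ j' lam₀‖ → ‖ψ i z‖ = ‖ψ j z‖ →
      ‖ψ i' z‖ = ‖ψ j' z‖) ∧ ∀ i j, ‖ψ i lam₀‖ < ‖ψ j lam₀‖ → ‖ψ i z‖ < ‖ψ j z‖ :=
    fun z hz => hUV hz
  have heq : {z | ‖h z‖ = 1} ∩ U = Q.Gam ∩ U := by
    ext z
    simp only [Set.mem_inter_iff, and_congr_left_iff, Set.mem_ofPred_eq]
    intro hz
    obtain ⟨⟨h1, h2⟩, h3⟩ := hUV' z hz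
    have hnorm : ‖h z‖ = 1 ↔ ‖ψ i₀ z‖ = ‖ψ j₀ z‖ := by
      rw [hh, norm_div, div_eq_one_iff_eq (norm_ne_zero_iff.2 (h1.roots.ne_zero j₀))]
    rw [hnorm]
    constructor
    · intro h4
      by_contra h5
      obtain ⟨S, hS⟩ := h1.roots.notMem_Gam_iff.1 h5
      refine h0.roots.notMem_Gam_iff.2 ⟨S, hS.1, fun i hi j hj => ?_⟩ hG
      have h6 := hS.2 i hi j hj
      rcases lt_trichotomy ‖ψ i lam₀‖ ‖ψ j lam₀‖ with h7 | h7 | h7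
      · exact h7
      · have hne : i ≠ j := fun h => hj (h ▸ hi)
        exact absurd (h2 i₀ j₀ i j hij hne htie h7 h4) h6.ne
      · exact absurd (h3 j i h7) h6.asymm
    · intro h4
      obtain ⟨i, j, hne, h5⟩ := h1.exists_tie h4
      have h6 : ‖ψ i lam₀‖ = ‖ψ j lam₀‖ := by
        rcases lt_trichotomy ‖ψ i lam₀‖ ‖ψ j lam₀‖ with h7 | h7 | h7
        · exact absurd h5 (h3 i j h7).ne
        · exact h7
        · exact absurd h5 (h3 j i h7).ne'
      exact h2 i j i₀ j₀ hne hij h6 htie h5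
  rintro ⟨-, h1⟩
  refine h1 ⟨γ, -δ, δ, ⟨hγ, hγd, hemb, ⟨U, hU, himg.trans heq⟩, fun x hx => ?_⟩, 0,
    by simp [hδ], hγ0⟩
  have : γ x ∈ {z | ‖h z‖ = 1} ∩ U := himg ▸ Set.mem_image_of_mem γ hx
  exact (hUV' _ this.2).1.1.simple

/-- Near `λ₀`, two level curves `‖ψ i‖ = ‖ψ j‖` either coincide or meet only at `λ₀`, so that away from
`λ₀` all ties between moduli persist along one curve. -/
theorem eventually_notMem_exc {lam₀ : ℂ} (hs : lam₀ ∈ Q.Simple) (hc : lam₀ ∉ Q.Crit) :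
    ∀ᶠ lam in 𝓝[≠] lam₀, lam ∉ Q.Exc := by
  obtain ⟨ψ, -, hψ⟩ := Q.exists_localRoots (Q.isRoots_root lam₀) hs
  have h0 := hψ.self_of_nhds
  have key : ∀ i j i' j', i ≠ j → i' ≠ j' → ∀ᶠ lam in 𝓝[≠] lam₀,
      ‖ψ i lam₀‖ = ‖ψ j lam₀‖ → ‖ψ i' lam₀‖ = ‖ψ j' lam₀‖ → ‖ψ i lam‖ = ‖ψ j lam‖ →
      ‖ψ i' lam‖ = ‖ψ j' lam‖ →
      ∀ᶠ z in 𝓝 lam, ‖ψ i z‖ = ‖ψ j z‖ → ‖ψ i' z‖ = ‖ψ j' z‖ := by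
    intro i j i' j' hij hij'
    simp only [eventually_imp_distrib_left]
    intro t1 t2
    have hnorm : ∀ i j, ∀ z, Q.LocalRoots z ψ → (‖ψ i z / ψ j z‖ = 1 ↔ ‖ψ i z‖ = ‖ψ j z‖) := by
      intro i j z hz
      rw [norm_div, div_eq_one_iff_eq (norm_ne_zero_iff.2 (hz.roots.ne_zero j))]
    have ha : ∀ i j, AnalyticAt ℂ (fun z => ψ i z / ψ j z) lam₀ := fun i j =>
      (h0.analytic i).div (h0.analytic j) (h0.roots.ne_zero j)
    have hd : deriv (fun z => ψ i z / ψ j z) lam₀ ≠ 0 := by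
      intro h1
      have h2 := h0.logDeriv_div i j
      rw [logDeriv_apply, h1, zero_div] at h2
      exact hc (h0.mem_crit_iff.2 ⟨i, j, hij, sub_eq_zero.1 h2.symm⟩)
    rcases eventually_level_dichotomy (ha i j) ((hnorm i j _ h0).2 t1) hd (ha i' j') with h1 | h1
    · refine Filter.Eventually.filter_mono nhdsWithin_le_nhds ?_
      filter_upwards [(h1.and hψ).eventually_nhds] with lam h2 _ _
      filter_upwards [h2] with z hz h3
      exact (hnorm i' j' z hz.2).1 (hz.1 ((hnorm i j z hz.2).2 h3))
    · filter_upwards [h1, hψ.filter_mono nhdsWithin_le_nhds] with lam h2 h3 h4 h5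
      exact absurd ((hnorm i' j' _ h3).2 h5) (h2 ((hnorm i j _ h3).2 h4))
  have hall : ∀ᶠ lam in 𝓝[≠] lam₀, ∀ i j i' j', i ≠ j → i' ≠ j' →
      ‖ψ i lam₀‖ = ‖ψ j lam₀‖ → ‖ψ i' lam₀‖ = ‖ψ j' lam₀‖ → ‖ψ i lam‖ = ‖ψ j lam‖ →
      ‖ψ i' lam‖ = ‖ψ j' lam‖ →
      ∀ᶠ z in 𝓝 lam, ‖ψ i z‖ = ‖ψ j z‖ → ‖ψ i' z‖ = ‖ψ j' z‖ := by
    rw [eventually_all]; intro i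
    rw [eventually_all]; intro j
    rw [eventually_all]; intro i'
    rw [eventually_all]; intro j'
    rw [eventually_imp_distrib_left]; intro hij
    rw [eventually_imp_distrib_left]; intro hij'
    exact key i j i' j' hij hij'
  have hlt := (hψ.eventually_nhds.and (Q.eventually_norm_lt h0)).filter_mono
    (nhdsWithin_le_nhds (s := {lam₀}ᶜ))
  filter_upwards [hall, hlt, Q.eventually_notMem_crit hs] with lam h1 h2 h3 h4
  have hback : ∀ i j, ‖ψ i lam‖ = ‖ψ j lam‖ → ‖ψ i lam₀‖ = ‖ψ j lam₀‖ := by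
    intro i j h5
    rcases lt_trichotomy ‖ψ i lam₀‖ ‖ψ j lam₀‖ with h7 | h7 | h7
    · exact absurd h5 (h2.2 i j h7).ne
    · exact h7
    · exact absurd h5 (h2.2 j i h7).ne'
  exact Q.exists_arc h4.1 h2.1 h3 (fun i j i' j' hij hij' t1 t2 =>
    h1 i j i' j' hij hij' (hback i j t1) (hback i' j' t2) t1 t2) h4

/-- Multiple points are finite in number, critical points are isolated, and so are the remaining
exceptional points. -/
theorem countable_exc : Q.Exc.Countable := by
  have h1 : Q.Crit.Countable := countable_of_isolated fun x hx => Q.eventually_notMem_crit hx.1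
  have h2 : (Q.Exc ∩ (Q.Simple \ Q.Crit)).Countable := countable_of_isolated fun x hx =>
    (Q.eventually_notMem_exc hx.2.1 hx.2.2).mono fun y hy h => hy h.1
  refine ((Q.finite_compl_simple.countable.union h1).union h2).mono fun x hx => ?_
  by_cases hs : x ∈ Q.Simple
  · by_cases hc : x ∈ Q.Crit
    · exact Or.inl (Or.inr hc)
    · exact Or.inr ⟨hx, hs, hc⟩
  · exact Or.inl (Or.inl hs)

/-- The image of a differentiable curve has planar measure zero. -/
theorem volume_image_curve {γ : ℝ → ℂ} {I : Set ℝ} (hI : IsOpen I) (hγ : DifferentiableOn ℝ γ I) :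
    volume (γ '' I) = 0 := by
  have h1 : γ '' I = (fun v : ℂ => γ v.re) '' {v : ℂ | v.im = 0 ∧ v.re ∈ I} := by
    ext z
    constructor
    · rintro ⟨x, hx, rfl⟩
      exact ⟨x, ⟨by simp, by simpa using hx⟩, by simp⟩
    · rintro ⟨v, ⟨-, hv⟩, rfl⟩
      exact ⟨v.re, hv, rfl⟩
  rw [h1]
  refine addHaar_image_eq_zero_of_differentiableOn_of_addHaar_eq_zero volume ?_ ?_
  · intro v hv
    exact ((hγ.differentiableAt (hI.mem_nhds hv.2)).comp v
      Complex.reCLM.differentiableAt).differentiableWithinAt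
  · refine measure_mono_null (t := (LinearMap.ker Complex.imLm : Set ℂ)) ?_ ?_
    · rintro v ⟨hv, -⟩
      simpa using hv
    · refine Measure.addHaar_submodule _ _ ?_
      intro h
      have : (Complex.I : ℂ) ∈ LinearMap.ker Complex.imLm := by rw [h]; trivial
      simp at this

/-- `Γ` is covered by its regular arcs, up to a countable set. -/
theorem volume_gam : volume Q.Gam = 0 := by
  have h1 : volume Q.Exc = 0 := Q.countable_exc.measure_zero _
  have h2 : volume (Q.Gam \ Q.Exc) = 0 := by
    refine measure_null_of_locally_null _ fun x hx => ?_
    have h3 : ∃ (γ : ℝ → ℂ) (s t : ℝ), Q.IsArc γ s t ∧ x ∈ γ '' Set.Ioo s t := by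
      by_contra h4
      exact hx.2 ⟨hx.1, h4⟩
    obtain ⟨γ, s, t, hγ, hxγ⟩ := h3
    obtain ⟨U, hU, himg⟩ := hγ.image_eq
    rw [himg] at hxγ
    refine ⟨U ∩ (Q.Gam \ Q.Exc), ?_, ?_⟩
    · rw [Set.inter_comm]
      exact inter_mem_nhdsWithin _ (hU.mem_nhds hxγ.2)
    · refine measure_mono_null (t := γ '' Set.Ioo s t) ?_ (volume_image_curve isOpen_Ioo
        fun y hy => (hγ.analytic y hy).differentiableAt.differentiableWithinAt)
      rw [himg]
      exact fun y hy => ⟨hy.2.1, hy.1⟩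
  exact measure_mono_null (fun x hx => or_iff_not_imp_left.2 fun h => ⟨hx, h⟩)
    (measure_union_null h1 h2)

end Pencil

/-! ### No continuation of `w'/w` across `Γ` -/

theorem norm_ratio_le {t a b : ℂ} {θ : ℝ} (ht : ‖t‖ ≤ 1) (hb : b ≠ 0) (hab : ‖a‖ ≤ θ * ‖b‖) :
    ‖t * (a / b)‖ ≤ θ := by
  have hb' : 0 < ‖b‖ := norm_pos_iff.2 hb
  have h1 : ‖a‖ / ‖b‖ ≤ θ := (div_le_iff₀ hb').2 hab
  rw [norm_mul, norm_div]
  calc ‖t‖ * (‖a‖ / ‖b‖) ≤ 1 * (‖a‖ / ‖b‖) := by gcongr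
    _ ≤ θ := by simpa using h1

namespace Pencil

variable {N m : ℕ} (Q : Pencil N m)

theorem norm_ratioProd_le {t : ℂ} (ht : ‖t‖ ≤ 1) {v : Fin N → ℂ} (h0 : ∀ i, v i ≠ 0)
    (hv : ∀ i ∈ low m N, ∀ j ∈ (low m N)ᶜ, ‖v i‖ ≤ ‖v j‖) :
    ‖ratioProd m t v‖ ≤ ∏ _i ∈ low m N, ∏ _j ∈ (low m N)ᶜ, 2 := by
  rw [ratioProd, norm_prod]
  refine Finset.prod_le_prod (fun _ _ => norm_nonneg _) fun i hi => ?_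
  rw [norm_prod]
  refine Finset.prod_le_prod (fun _ _ => norm_nonneg _) fun j hj => ?_
  have h1 := norm_ratio_le (θ := 1) ht (h0 j) (by simpa using hv i hi j hj)
  calc ‖1 - t * (v i / v j)‖ ≤ ‖(1 : ℂ)‖ + ‖t * (v i / v j)‖ := norm_sub_le _ _
    _ ≤ 2 := by rw [norm_one]; linarith

theorem le_norm_ratioProd {t : ℂ} (ht : ‖t‖ ≤ 1) {v : Fin N → ℂ} (h0 : ∀ i, v i ≠ 0) {θ : ℝ}
    (hθ : θ ≤ 1) (hv : ∀ i ∈ low m N, ∀ j ∈ (low m N)ᶜ, ‖v i‖ ≤ θ * ‖v j‖) :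
    ∏ _i ∈ low m N, ∏ _j ∈ (low m N)ᶜ, (1 - θ) ≤ ‖ratioProd m t v‖ := by
  rw [ratioProd, norm_prod]
  refine Finset.prod_le_prod (fun _ _ => Finset.prod_nonneg fun _ _ => by linarith) fun i hi => ?_
  rw [norm_prod]
  refine Finset.prod_le_prod (fun _ _ => by linarith) fun j hj => ?_
  have h1 := norm_ratio_le ht (h0 j) (hv i hi j hj)
  calc 1 - θ ≤ ‖(1 : ℂ)‖ - ‖t * (v i / v j)‖ := by rw [norm_one]; linarith
    _ ≤ ‖1 - t * (v i / v j)‖ := norm_sub_norm_le _ _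

theorem ratioProd_ne_zero {t : ℂ} (ht : ‖t‖ < 1) {v : Fin N → ℂ} (h0 : ∀ i, v i ≠ 0)
    (hv : ∀ i ∈ low m N, ∀ j ∈ (low m N)ᶜ, ‖v i‖ ≤ ‖v j‖) : ratioProd m t v ≠ 0 := by
  rw [ratioProd]
  refine Finset.prod_ne_zero_iff.2 fun i hi => Finset.prod_ne_zero_iff.2 fun j hj => ?_
  intro h
  have h1 : t * (v i / v j) = 1 := (sub_eq_zero.1 h).symm
  have hb' : 0 < ‖v j‖ := norm_pos_iff.2 (h0 j)
  have h2 : ‖v i‖ / ‖v j‖ ≤ 1 := (div_le_one hb').2 (hv i hi j hj)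
  have h3 : ‖t‖ * (‖v i‖ / ‖v j‖) = 1 := by rw [← norm_div, ← norm_mul, h1, norm_one]
  nlinarith [norm_nonneg t, div_nonneg (norm_nonneg (v i)) hb'.le]

theorem norm_le_of_low {v : Fin N → ℂ} (hv : Monotone fun i => ‖v i‖) :
    ∀ i ∈ low m N, ∀ j ∈ (low m N)ᶜ, ‖v i‖ ≤ ‖v j‖ := by
  intro i hi j hj
  simp only [low, Finset.mem_compl, Finset.mem_filter, Finset.mem_univ, true_and] at hi hj
  exact hv (Fin.le_def.2 (by omega))

/-- The last small index. -/
abbrev lastLow : Fin N := ⟨m - 1, by have := Q.m_lt; omega⟩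

/-- The first large index. -/
abbrev firstHigh : Fin N := ⟨m, Q.m_lt⟩

theorem lastLow_mem : Q.lastLow ∈ low m N := by
  have := Q.m_pos
  simp only [low, Finset.mem_filter, Finset.mem_univ, true_and]; omega

theorem firstHigh_mem : Q.firstHigh ∈ (low m N)ᶜ := by
  simp [low]

/-- The set `Γ` has no isolated points: otherwise `ratioProd m t` would, for `|t| < 1`, define a
zero-free analytic function near such a point, bounded below on a circle uniformly in `t`, while
its value at the point vanishes for a suitable `t` with `|t| = 1`. -/
theorem not_isolated {lam₀ : ℂ} (hG : lam₀ ∈ Q.Gam) : ¬ ∀ᶠ lam in 𝓝[≠] lam₀, lam ∉ Q.Gam := by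
  intro hiso
  rw [eventually_nhdsWithin_iff] at hiso
  obtain ⟨R, hR, hball⟩ := Metric.eventually_nhds_iff_ball.1 hiso
  obtain ⟨g, hg⟩ := exists_ultrafilter_le (𝓝[≠] lam₀)
  obtain ⟨v, hv, hvm, hvt⟩ := Q.exists_tendsto_root g (hg.trans nhdsWithin_le_nhds)
  have hr : 0 < R / 2 := by linarith
  have hoff : ∀ z ∈ Metric.ball lam₀ R, z ≠ lam₀ → z ∉ Q.Gam := fun z hz hne => hball z hz hne
  have hlowle := fun lam => norm_le_of_low (m := m) (Q.mono lam)
  -- uniform separation of the small and the large roots on the circle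
  obtain ⟨θ, hθ1, hθ⟩ : ∃ θ < (1 : ℝ), ∀ z ∈ Metric.sphere lam₀ (R / 2),
      ‖Q.root z Q.lastLow‖ ≤ θ * ‖Q.root z Q.firstHigh‖ := by
    have hne : (Metric.sphere lam₀ (R / 2)).Nonempty := NormedSpace.sphere_nonempty.2 hr.le
    have hpos : ∀ z, 0 < ‖Q.root z Q.firstHigh‖ := fun z =>
      norm_pos_iff.2 ((Q.isRoots_root z).ne_zero _)
    have hc : Continuous fun z => ‖Q.root z Q.lastLow‖ / ‖Q.root z Q.firstHigh‖ :=
      (Q.continuous_norm_root _).div (Q.continuous_norm_root _) fun z => (hpos z).ne'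
    obtain ⟨z₁, hz₁, hmax⟩ := (isCompact_sphere lam₀ (R / 2)).exists_isMaxOn hne hc.continuousOn
    refine ⟨_, ?_, fun z hz => (div_le_iff₀ (hpos z)).1 (hmax hz)⟩
    rw [div_lt_one (hpos z₁)]
    have h1 : z₁ ∉ Q.Gam := by
      have h2 : dist z₁ lam₀ = R / 2 := hz₁
      refine hoff z₁ (by rw [Metric.mem_ball, h2]; linarith) ?_
      rintro rfl
      rw [dist_self] at h2
      linarith
    exact lt_of_le_of_ne (hlowle z₁ _ Q.lastLow_mem _ Q.firstHigh_mem) h1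
  have hsep : ∀ z ∈ Metric.sphere lam₀ (R / 2), ∀ i ∈ low m N, ∀ j ∈ (low m N)ᶜ,
      ‖Q.root z i‖ ≤ θ * ‖Q.root z j‖ := by
    intro z hz i hi j hj
    have hθ0 : 0 ≤ θ := by
      have h1 := (norm_nonneg _).trans (hθ z hz)
      exact nonneg_of_mul_nonneg_left h1 (norm_pos_iff.2 ((Q.isRoots_root z).ne_zero _))
    simp only [low, Finset.mem_compl, Finset.mem_filter, Finset.mem_univ, true_and] at hi hj
    calc ‖Q.root z i‖ ≤ ‖Q.root z Q.lastLow‖ := Q.mono z (Fin.le_def.2 (by simp; omega))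
      _ ≤ θ * ‖Q.root z Q.firstHigh‖ := hθ z hz
      _ ≤ θ * ‖Q.root z j‖ := by
        gcongr
        exact Q.mono z (Fin.le_def.2 (by simp; omega))
  set c : ℝ := ∏ _i ∈ low m N, ∏ _j ∈ (low m N)ᶜ, (1 - θ) with hc
  have hcpos : 0 < c := Finset.prod_pos fun _ _ => Finset.prod_pos fun _ _ => by linarith
  have key : ∀ t : ℂ, ‖t‖ < 1 → c ≤ ‖ratioProd m t v‖ := by
    intro t ht
    set F : ℂ → ℂ := fun z => ratioProd m t (Q.root z) with hF
    have hFd : DifferentiableOn ℂ F (Metric.ball lam₀ R \ {lam₀}) :=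
      (Q.differentiableOn_comp_root (splitSymmetric_ratioProd t)).mono fun z hz =>
        hoff z hz.1 hz.2
    have hbdd : BddAbove (norm ∘ F '' (Metric.ball lam₀ R \ {lam₀})) := by
      refine ⟨∏ _i ∈ low m N, ∏ _j ∈ (low m N)ᶜ, 2, ?_⟩
      rintro _ ⟨z, -, rfl⟩
      exact norm_ratioProd_le ht.le (fun i => (Q.isRoots_root z).ne_zero i) (hlowle z)
    have hext := Complex.differentiableOn_update_limUnder_of_bddAbove (Metric.ball_mem_nhds lam₀ hR)
      hFd hbdd
    set L := limUnder (𝓝[≠] lam₀) F with hL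
    have hLv : L = ratioProd m t v := by
      have h1 : ContinuousAt (Function.update F lam₀ L) lam₀ :=
        (hext.differentiableAt (Metric.ball_mem_nhds lam₀ hR)).continuousAt
      have h2 : Tendsto F g (𝓝 L) := (continuousAt_update_same.1 h1).mono_left hg
      have h3 : Tendsto F g (𝓝 (ratioProd m t v)) :=
        (differentiableAt_ratioProd t hv.ne_zero).continuousAt.tendsto.comp hvt
      exact tendsto_nhds_unique h2 h3
    have hne : ∀ z ∈ Metric.ball lam₀ R, Function.update F lam₀ L z ≠ 0 := by
      intro z hz
      by_cases h1 : z = lam₀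
      · rw [h1, Function.update_self, hLv]
        exact ratioProd_ne_zero ht hv.ne_zero (norm_le_of_low hvm)
      · rw [Function.update_of_ne h1]
        exact ratioProd_ne_zero ht (fun i => (Q.isRoots_root z).ne_zero i) (hlowle z)
    have hinv : DiffContOnCl ℂ (fun z => (Function.update F lam₀ L z)⁻¹)
        (Metric.ball lam₀ (R / 2)) := by
      refine DifferentiableOn.diffContOnCl_ball (U := Metric.ball lam₀ R) (hext.fun_inv hne) ?_
      exact Metric.closedBall_subset_ball (by linarith)
    have hmax := Complex.norm_le_of_forall_mem_frontier_norm_le (C := c⁻¹) Metric.isBounded_ball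
      hinv (fun z hz => ?_) (subset_closure (Metric.mem_ball_self hr))
    · rw [Function.update_self, hLv, norm_inv] at hmax
      have h0 : 0 < ‖ratioProd m t v‖ :=
        norm_pos_iff.2 (ratioProd_ne_zero ht hv.ne_zero (norm_le_of_low hvm))
      exact (inv_le_inv₀ h0 hcpos).1 hmax
    · rw [frontier_ball lam₀ hr.ne'] at hz
      have h1 : z ≠ lam₀ := by
        rintro rfl
        rw [mem_sphere_iff_norm, sub_self, norm_zero] at hz
        linarith
      rw [Function.update_of_ne h1, norm_inv]
      have h2 := le_norm_ratioProd (m := m) ht.le (fun i => (Q.isRoots_root z).ne_zero i) hθ1.le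
        (hsep z hz)
      exact (inv_le_inv₀ (hcpos.trans_le h2) hcpos).2 h2
  -- at `t₀` the product vanishes, and `t₀` is a limit of numbers of modulus less than `1`
  set t₀ : ℂ := v Q.firstHigh / v Q.lastLow with ht₀
  have hnorm : ‖v Q.lastLow‖ = ‖v Q.firstHigh‖ := by
    rw [hv.norm_eq hvm, hv.norm_eq hvm]
    exact hG
  have ht₀1 : ‖t₀‖ = 1 := by
    rw [ht₀, norm_div, hnorm, div_self (norm_ne_zero_iff.2 (hv.ne_zero _))]
  have hzero : ratioProd m t₀ v = 0 := by
    refine Finset.prod_eq_zero Q.lastLow_mem (Finset.prod_eq_zero Q.firstHigh_mem ?_)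
    have h1 := hv.ne_zero Q.lastLow
    have h2 := hv.ne_zero Q.firstHigh
    rw [ht₀, div_mul_div_cancel₀ h1, div_self h2, sub_self]
  have hcont : Tendsto (fun s : ℝ => ‖ratioProd m ((s : ℂ) * t₀) v‖) (𝓝[<] 1) (𝓝 0) := by
    have h1 : Continuous fun s : ℝ => ‖ratioProd m ((s : ℂ) * t₀) v‖ := by
      unfold ratioProd
      fun_prop
    have h2 := h1.tendsto 1
    simp only [Complex.ofReal_one, one_mul, hzero, norm_zero] at h2
    exact h2.mono_left nhdsWithin_le_nhds
  have hle : ∀ᶠ s : ℝ in 𝓝[<] 1, c ≤ ‖ratioProd m ((s : ℂ) * t₀) v‖ := by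
    filter_upwards [Ioo_mem_nhdsLT (zero_lt_one (α := ℝ))] with s hs
    refine key _ ?_
    rw [norm_mul, ht₀1, mul_one, Complex.norm_real, Real.norm_eq_abs, abs_of_pos hs.1]
    exact hs.2
  exact absurd (ge_of_tendsto hcont hle) (not_le.2 hcpos)

/-- A choice of `m` roots whose product has modulus `|w|`, the least possible, consists of `m` smallest
roots: exchanging one root of the choice for another cannot decrease the modulus. -/
theorem IsRoots.le_of_norm_w_eq {Q : Pencil N m} {lam : ℂ} {v : Fin N → ℂ} (h : Q.IsRoots lam v)
    {S : Finset (Fin N)} (hS : S.card = m) (hw : ‖Q.w lam‖ = ‖∏ i ∈ S, v i‖) {i j : Fin N}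
    (hi : i ∈ S) (hj : j ∉ S) : ‖v i‖ ≤ ‖v j‖ := by
  have hj' : j ∉ S.erase i := fun h => hj (Finset.mem_of_mem_erase h)
  have hcard : (insert j (S.erase i)).card = m := by
    have := Finset.card_pos.2 ⟨i, hi⟩
    rw [Finset.card_insert_of_notMem hj', Finset.card_erase_of_mem hi]
    omega
  have h1 := h.norm_w_le hcard
  rw [hw, Finset.prod_insert hj', ← Finset.mul_prod_erase S _ hi, norm_mul, norm_mul] at h1
  have h2 : 0 < ‖∏ x ∈ S.erase i, v x‖ :=
    norm_pos_iff.2 (Finset.prod_ne_zero_iff.2 fun x _ => h.ne_zero x)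
  exact le_of_mul_le_mul_right h1 h2

/-- The logarithmic derivative of `w` has no analytic continuation across a point of `Γ`. Near such a
point, `w` is off `Γ` one of finitely many products `W S` of root functions, all with the continued
logarithmic derivative, hence constant multiples of each other. By continuity `|w| / |W S|` is then
constant, so a single choice `S` of roots is smallest on both sides of `Γ`. A tie between a root in
`S` and one outside makes their quotient attain its maximum modulus, so the two are proportional. -/
theorem no_continuation {lam₀ : ℂ} (hG : lam₀ ∈ Q.Gam) {O : Set ℂ} (hO : IsOpen O)
    (hlam : lam₀ ∈ O) {G : ℂ → ℂ} (hGd : DifferentiableOn ℂ G O)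
    (heq : ∀ lam ∈ O, lam ∈ Q.good → G lam = logDeriv Q.w lam) : False := by
  obtain ⟨lam₁, h1O, h1G, h1s⟩ : ∃ lam ∈ O, lam ∈ Q.Gam ∧ lam ∈ Q.Simple := by
    have h1 : ∃ᶠ lam in 𝓝[≠] lam₀, lam ∈ Q.Gam := by
      have := Q.not_isolated hG
      simpa only [not_eventually, not_not] using this
    obtain ⟨lam, h2, h3, h4⟩ := (h1.and_eventually ((Q.eventually_simple lam₀).and
      ((hO.eventually_mem hlam).filter_mono nhdsWithin_le_nhds))).exists
    exact ⟨lam, h4, h2, h3⟩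
  obtain ⟨ψ, -, hψ⟩ := Q.exists_localRoots (Q.isRoots_root lam₁) h1s
  obtain ⟨r, hr, hball⟩ := Metric.eventually_nhds_iff_ball.1 (hψ.and (hO.eventually_mem h1O))
  set B := Metric.ball lam₁ r with hB
  have hBo : IsOpen B := Metric.isOpen_ball
  have hBc : IsPreconnected B := (convex_ball _ _).isPreconnected
  have h1B : lam₁ ∈ B := Metric.mem_ball_self hr
  -- `Γ` has area zero, so the points off `Γ` are dense.
  have hdense : ∀ U : Set ℂ, IsOpen U → U.Nonempty → ∃ x ∈ U, x ∉ Q.Gam := by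
    intro U hU hne
    by_contra! h
    exact (hU.measure_pos volume hne).ne' (measure_mono_null h Q.volume_gam)
  set W : Finset (Fin N) → ℂ → ℂ := fun S z => ∏ i ∈ S, ψ i z with hW
  have hWd : ∀ S, DifferentiableOn ℂ (W S) B := fun S z hz =>
    (differentiableAt_prod fun i _ => ((hball z hz).1.analytic i).differentiableAt).differentiableWithinAt
  have hW0 : ∀ S, ∀ z ∈ B, W S z ≠ 0 := fun S z hz =>
    Finset.prod_ne_zero_iff.2 fun i _ => (hball z hz).1.roots.ne_zero i
  have hpt : ∀ z ∈ B, z ∉ Q.Gam → ∃ S : Finset (Fin N), S.card = m ∧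
      Set.EqOn (logDeriv (W S)) G B ∧ Q.w z = W S z := by
    intro z hz hzG
    obtain ⟨S, hS⟩ := (hball z hz).1.roots.notMem_Gam_iff.1 hzG
    have hψz : ∀ᶠ lam in 𝓝 z, Q.LocalRoots lam ψ := by
      filter_upwards [hBo.mem_nhds hz] with x hx using (hball x hx).1
    have hwe := Q.w_eventuallyEq hψz hS
    refine ⟨S, hS.1, ?_, hwe.self_of_nhds⟩
    have ha1 : AnalyticOnNhd ℂ (logDeriv (W S)) B := by
      have := ((hWd S).deriv hBo).div (hWd S) (hW0 S)
      exact DifferentiableOn.analyticOnNhd this hBo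
    have ha2 : AnalyticOnNhd ℂ G B :=
      (hGd.mono fun x hx => (hball x hx).2).analyticOnNhd hBo
    refine ha1.eqOn_of_preconnected_of_eventuallyEq ha2 hBc hz ?_
    filter_upwards [hwe.eventually_nhds, hBo.mem_nhds hz, Q.isClosed_Gam.isOpen_compl.mem_nhds hzG]
      with x hx hxB hxG
    rw [heq x (hball x hxB).2 ⟨(hball x hxB).1.simple, hxG⟩, logDeriv_apply, logDeriv_apply,
      EventuallyEq.deriv_eq hx, hx.self_of_nhds]
  obtain ⟨zs, hzsB, hzsG⟩ := hdense B hBo ⟨lam₁, h1B⟩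
  obtain ⟨S, hSc, hSG, hSw⟩ := hpt zs hzsB hzsG
  -- the quotient `|w| / |W S|` is continuous and takes finitely many values
  set u : ℂ → ℝ := fun z => ‖Q.w z‖ / ‖W S z‖ with hu
  have huc : ContinuousOn u B :=
    Q.continuous_norm_w.continuousOn.div (hWd S).continuousOn.norm fun z hz =>
      norm_ne_zero_iff.2 (hW0 S z hz)
  set T : Set ℝ := Set.range fun S' : Finset (Fin N) => ‖W S' lam₁‖ / ‖W S lam₁‖ with hT
  have hTf : T.Finite := Set.finite_range _
  have hTu : ∀ z ∈ B, z ∉ Q.Gam → u z ∈ T := by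
    intro z hz hzG
    obtain ⟨S', -, hS'G, hS'w⟩ := hpt z hz hzG
    obtain ⟨c, -, hc⟩ := (logDeriv_eqOn_iff (hWd S') (hWd S) hBo hBc (hW0 S) (hW0 S')).1
      (hS'G.trans hSG.symm)
    have hval : ∀ x ∈ B, ‖W S' x‖ / ‖W S x‖ = ‖c‖ := by
      intro x hx
      rw [hc hx, Pi.smul_apply, smul_eq_mul, norm_mul,
        mul_div_cancel_right₀ _ (norm_ne_zero_iff.2 (hW0 S x hx))]
    refine ⟨S', ?_⟩
    simp only [hu]
    rw [hS'w, hval _ h1B, hval _ hz]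
  have hTall : Set.MapsTo u B T := by
    intro z hz
    by_contra hzT
    have h2 : B ∩ u ⁻¹' Tᶜ ∈ 𝓝 z := by
      have := huc.isOpen_inter_preimage hBo hTf.isClosed.isOpen_compl
      exact this.mem_nhds ⟨hz, hzT⟩
    obtain ⟨O', hO', hO'o, hzO'⟩ := mem_nhds_iff.1 h2
    obtain ⟨x, hx, hxG⟩ := hdense O' hO'o ⟨z, hzO'⟩
    exact (hO' hx).2 (hTu x (hO' hx).1 hxG)
  have hconst : ∀ z ∈ B, ‖Q.w z‖ = ‖W S z‖ := by
    intro z hz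
    have h2 : u z = u zs := hBc.constant_of_mapsTo hTf.isDiscrete huc hTall hz hzsB
    have h3 : u zs = 1 := by
      simp only [hu]
      rw [hSw, div_self (norm_ne_zero_iff.2 (hW0 S zs hzsB))]
    rw [h3] at h2
    exact (div_eq_one_iff_eq (norm_ne_zero_iff.2 (hW0 S z hz))).1 h2
  have hle : ∀ z ∈ B, ∀ i ∈ S, ∀ j ∉ S, ‖ψ i z‖ ≤ ‖ψ j z‖ := fun z hz i hi j hj =>
    (hball z hz).1.roots.le_of_norm_w_eq hSc (hconst z hz) hi hj
  have hnot : ¬ Bottom m (fun i => ψ i lam₁) S := fun h =>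
    (hball lam₁ h1B).1.roots.notMem_Gam_iff.2 ⟨S, h⟩ h1G
  obtain ⟨i, hi, j, hj, hij⟩ : ∃ i ∈ S, ∃ j ∉ S, ‖ψ j lam₁‖ ≤ ‖ψ i lam₁‖ := by
    by_contra! h
    exact hnot ⟨hSc, h⟩
  have htie : ‖ψ i lam₁‖ = ‖ψ j lam₁‖ := le_antisymm (hle _ h1B i hi j hj) hij
  have hj0 : ∀ z ∈ B, 0 < ‖ψ j z‖ := fun z hz => norm_pos_iff.2 ((hball z hz).1.roots.ne_zero j)
  have hconst' := Complex.eventually_eq_of_isLocalMax_norm (f := fun z => ψ i z / ψ j z) (c := lam₁)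
    (by
      filter_upwards [hBo.mem_nhds h1B] with z hz
      exact ((hball z hz).1.analytic i).differentiableAt.div
        ((hball z hz).1.analytic j).differentiableAt ((hball z hz).1.roots.ne_zero j))
    (by
      filter_upwards [hBo.mem_nhds h1B] with z hz
      simp only [Function.comp_apply, norm_div]
      rw [htie, div_self (hj0 _ h1B).ne', div_le_one (hj0 z hz)]
      exact hle z hz i hi j hj)
  have hne : i ≠ j := fun h => hj (by rwa [← h])
  refine Q.not_eventually_proportional hψ hne (ψ i lam₁ / ψ j lam₁) ?_
  filter_upwards [hconst', hBo.mem_nhds h1B] with z h2 hz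
  rw [← h2, div_mul_cancel₀ _ ((hball z hz).1.roots.ne_zero j)]

end Pencil

/-! ### The Cauchy–Pompeiu formula and Green's formula in half planes -/

/-- The Wirtinger derivative `∂φ/∂\bar z`. -/
def dbar (φ : ℂ → ℂ) (z : ℂ) : ℂ := (fderiv ℝ φ z 1 + Complex.I * fderiv ℝ φ z Complex.I) / 2

theorem continuous_dbar {φ : ℂ → ℂ} (hφ : ContDiff ℝ 1 φ) : Continuous (dbar φ) := by
  have h := hφ.continuous_fderiv one_ne_zero
  unfold dbar
  fun_prop

theorem hasCompactSupport_dbar {φ : ℂ → ℂ} (hφ : HasCompactSupport φ) :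
    HasCompactSupport (dbar φ) := by
  refine (hφ.fderiv (𝕜 := ℝ)).mono fun z hz h => hz ?_
  have h' : fderiv ℝ φ z = 0 := h
  simp [dbar, h']

/-- The unit vector of angle `θ`. -/
def unitVec (θ : ℝ) : ℂ := (Real.cos θ : ℂ) + (Real.sin θ : ℂ) * Complex.I

theorem unitVec_eq (θ : ℝ) : unitVec θ = Complex.exp (θ * Complex.I) := by
  rw [Complex.exp_mul_I, unitVec, Complex.ofReal_cos, Complex.ofReal_sin]

theorem norm_unitVec (θ : ℝ) : ‖unitVec θ‖ = 1 := by
  rw [unitVec_eq, Complex.norm_exp_ofReal_mul_I]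

theorem unitVec_ne_zero (θ : ℝ) : unitVec θ ≠ 0 := by
  rw [unitVec_eq]; exact Complex.exp_ne_zero _

theorem hasDerivAt_unitVec (θ : ℝ) : HasDerivAt unitVec (Complex.I * unitVec θ) θ := by
  have h1 : HasDerivAt (fun x : ℝ => Complex.exp (x * Complex.I))
      (Complex.exp (θ * Complex.I) * (1 * Complex.I)) θ :=
    ((Complex.ofRealCLM.hasDerivAt (x := θ)).mul_const Complex.I).cexp
  rw [show unitVec = fun x : ℝ => Complex.exp (x * Complex.I) from funext unitVec_eq]
  exact h1.congr_deriv (by ring)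

theorem continuous_unitVec : Continuous unitVec :=
  continuous_iff_continuousAt.2 fun θ => (hasDerivAt_unitVec θ).continuousAt

theorem dbar_div_unitVec (φ : ℂ → ℂ) (z : ℂ) (θ : ℝ) : dbar φ z / unitVec θ =
    (fderiv ℝ φ z (unitVec θ) + Complex.I * fderiv ℝ φ z (Complex.I * unitVec θ)) / 2 := by
  set a := Real.cos θ with ha
  set b := Real.sin θ with hb
  have h1 : unitVec θ = a • (1 : ℂ) + b • Complex.I := by simp [unitVec, ha, hb]
  have h2 : Complex.I * unitVec θ = a • Complex.I + (-b) • (1 : ℂ) := by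
    simp only [unitVec, ← ha, ← hb, Complex.real_smul]
    push_cast
    linear_combination (b : ℂ) * Complex.I_sq
  rw [div_eq_iff (unitVec_ne_zero θ), h2]
  conv_rhs => rw [h1]
  have hab : (a : ℂ) ^ 2 + (b : ℂ) ^ 2 = 1 := by
    exact_mod_cast Real.cos_sq_add_sin_sq θ
  simp only [map_add, map_smul]
  simp only [dbar, Complex.real_smul, mul_one]
  push_cast
  set p := fderiv ℝ φ z 1
  set q := fderiv ℝ φ z Complex.I
  linear_combination (-(p + Complex.I * q) / 2) * hab
    - ((a : ℂ) * b * q - (b : ℂ) ^ 2 * p) / 2 * Complex.I_sq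

theorem integrableOn_polar {g : ℝ × ℝ → ℂ} (hg : Continuous g) {R : ℝ}
    (hR : ∀ p : ℝ × ℝ, R < p.1 → g p = 0) :
    IntegrableOn g (Set.Ioi 0 ×ˢ Set.Ioo (-Real.pi) Real.pi) := by
  have h1 : IntegrableOn g (Set.Icc 0 R ×ˢ Set.Icc (-Real.pi) Real.pi) :=
    hg.continuousOn.integrableOn_compact (isCompact_Icc.prod isCompact_Icc)
  refine h1.of_forall_sdiff_eq_zero (measurableSet_Ioi.prod measurableSet_Ioo) ?_
  rintro ⟨r, θ⟩ ⟨⟨h2, h3⟩, h4⟩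
  refine hR _ ?_
  by_contra h5
  exact h4 ⟨⟨le_of_lt h2, not_lt.1 h5⟩, h3.1.le, h3.2.le⟩

/-- The **Cauchy–Pompeiu formula** at the origin, for functions of compact support. -/
theorem integral_dbar_div {φ : ℂ → ℂ} (hφ : ContDiff ℝ 1 φ) (hc : HasCompactSupport φ) :
    ∫ z, dbar φ z / z = -(Real.pi : ℂ) * φ 0 := by
  have hfd : Continuous (fderiv ℝ φ) := hφ.continuous_fderiv one_ne_zero
  have hd : ∀ z, HasFDerivAt φ (fderiv ℝ φ z) z := fun z =>
    (hφ.differentiable one_ne_zero z).hasFDerivAt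
  set e : ℝ × ℝ → ℂ := fun p => (p.1 : ℂ) * unitVec p.2 with he
  have hec : Continuous e := by
    have := continuous_unitVec
    fun_prop
  set g₁ : ℝ × ℝ → ℂ := fun p => fderiv ℝ φ (e p) (unitVec p.2) with hg₁
  set g₂ : ℝ × ℝ → ℂ := fun p => fderiv ℝ φ (e p) (Complex.I * unitVec p.2) with hg₂
  have hg₁c : Continuous g₁ := (hfd.comp hec).clm_apply (continuous_unitVec.comp continuous_snd)
  have hg₂c : Continuous g₂ := (hfd.comp hec).clm_apply
    (continuous_const.mul (continuous_unitVec.comp continuous_snd))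
  obtain ⟨R, hR⟩ := (hc.fderiv (𝕜 := ℝ)).isCompact.isBounded.subset_closedBall 0
  have hzero : ∀ p : ℝ × ℝ, max R 0 < p.1 → fderiv ℝ φ (e p) = 0 := by
    intro p hp
    by_contra h
    have h1 := hR (subset_closure h)
    rw [mem_closedBall_zero_iff, he, norm_mul, norm_unitVec, mul_one, Complex.norm_real,
      Real.norm_eq_abs] at h1
    have := (le_max_left R 0).trans_lt hp
    linarith [le_abs_self p.1]
  have hi₁ := integrableOn_polar hg₁c (R := max R 0) fun p hp => by simp [hg₁, hzero p hp]
  have hi₂ := integrableOn_polar hg₂c (R := max R 0) fun p hp => by simp [hg₂, hzero p hp]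
  have h1 : ∫ p in Set.Ioi 0 ×ˢ Set.Ioo (-Real.pi) Real.pi, g₁ p = -(2 * Real.pi : ℂ) * φ 0 := by
    rw [Measure.volume_eq_prod, ← Measure.prod_restrict, integral_prod_symm]
    · have h2 : ∀ θ : ℝ, ∫ r in Set.Ioi (0 : ℝ), g₁ (r, θ) = -φ 0 := by
        intro θ
        have hemb : IsClosedEmbedding fun r : ℝ => (r : ℂ) * unitVec θ := by
          refine Isometry.isClosedEmbedding (Isometry.of_dist_eq fun x y => ?_)
          rw [dist_eq_norm, ← sub_mul, norm_mul, norm_unitVec, mul_one, ← Complex.ofReal_sub,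
            Complex.norm_real, dist_eq_norm]
        have hcd : ContDiff ℝ 1 fun r : ℝ => φ ((r : ℂ) * unitVec θ) :=
          hφ.comp (Complex.ofRealCLM.contDiff.mul contDiff_const)
        have h3 := HasCompactSupport.integral_Ioi_deriv_eq hcd (hc.comp_isClosedEmbedding hemb) 0
        simp only [Complex.ofReal_zero, zero_mul] at h3
        rw [← h3]
        congr 1
        funext r
        have h4 : HasDerivAt (fun r : ℝ => (r : ℂ) * unitVec θ) (unitVec θ) r := by
          simpa using (Complex.ofRealCLM.hasDerivAt (x := r)).mul_const (unitVec θ)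
        exact ((hd _).comp_hasDerivAt r h4).deriv.symm
      simp only [h2]
      rw [setIntegral_const, Measure.real, Real.volume_Ioo, ENNReal.toReal_ofReal (by linarith [Real.pi_pos]),
        Complex.real_smul]
      push_cast
      ring
    · rw [Measure.prod_restrict]
      exact hi₁
  have h2 : ∫ p in Set.Ioi 0 ×ˢ Set.Ioo (-Real.pi) Real.pi, g₂ p = 0 := by
    rw [Measure.volume_eq_prod, setIntegral_prod _ hi₂]
    refine setIntegral_eq_zero_of_forall_eq_zero fun r hr => ?_
    have hr0 : (r : ℂ) ≠ 0 := Complex.ofReal_ne_zero.2 (ne_of_gt hr)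
    have h3 : ∀ θ : ℝ, HasDerivAt (fun θ : ℝ => φ ((r : ℂ) * unitVec θ)) ((r : ℂ) * g₂ (r, θ)) θ := by
      intro θ
      have h4 := (hd ((r : ℂ) * unitVec θ)).comp_hasDerivAt θ
        ((hasDerivAt_unitVec θ).const_mul (r : ℂ))
      refine h4.congr_deriv ?_
      have h5 : (r : ℂ) * (Complex.I * unitVec θ) = r • (Complex.I * unitVec θ) :=
        Complex.real_smul.symm
      rw [h5, map_smul, Complex.real_smul]
    have h5 := intervalIntegral.integral_eq_sub_of_hasDerivAt (a := -Real.pi) (b := Real.pi)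
      (fun θ _ => h3 θ) (Continuous.intervalIntegrable (by fun_prop) _ _)
    have h6 : unitVec Real.pi = unitVec (-Real.pi) := by simp [unitVec]
    rw [h6, sub_self, intervalIntegral.integral_const_mul,
      intervalIntegral.integral_of_le (by linarith [Real.pi_pos]), integral_Ioc_eq_integral_Ioo] at h5
    exact (mul_eq_zero.1 h5).resolve_left hr0
  rw [← Complex.integral_comp_polarCoord_symm, polarCoord_target]
  have h3 : ∫ p in Set.Ioi (0 : ℝ) ×ˢ Set.Ioo (-Real.pi) Real.pi,
      p.1 • (dbar φ (Complex.polarCoord.symm p) / Complex.polarCoord.symm p) =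
      ∫ p in Set.Ioi (0 : ℝ) ×ˢ Set.Ioo (-Real.pi) Real.pi, (g₁ p + Complex.I * g₂ p) / 2 := by
    refine setIntegral_congr_fun (measurableSet_Ioi.prod measurableSet_Ioo) fun p hp => ?_
    have h4 : Complex.polarCoord.symm p = e p := by
      rw [Complex.polarCoord_symm_apply]; rfl
    have hr0 : (p.1 : ℂ) ≠ 0 := Complex.ofReal_ne_zero.2 (ne_of_gt hp.1)
    simp only [h4, Complex.real_smul]
    rw [hg₁, hg₂, ← dbar_div_unitVec, he, mul_div_assoc', mul_div_mul_left _ _ hr0]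
  rw [h3, integral_div, integral_add hi₁ (hi₂.const_mul _), integral_const_mul, h1, h2]
  ring

/-- Green's formula in the upper half plane. -/
theorem integral_dbar_upper {U : ℂ → ℂ} (hU : ContDiff ℝ 1 U) (hc : HasCompactSupport U) :
    ∫ z in {z : ℂ | 0 < z.im}, dbar U z = -(Complex.I / 2) * ∫ x : ℝ, U x := by
  have hfd : Continuous (fderiv ℝ U) := hU.continuous_fderiv one_ne_zero
  have hfc : HasCompactSupport (fderiv ℝ U) := hc.fderiv (𝕜 := ℝ)
  have hd : ∀ z, HasFDerivAt U (fderiv ℝ U z) z := fun z =>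
    (hU.differentiable one_ne_zero z).hasFDerivAt
  set e : ℝ × ℝ → ℂ := fun p => (p.1 : ℂ) + p.2 * Complex.I with he
  have heq : ∀ p, e p = Complex.measurableEquivRealProd.symm p := fun p => by
    simp [he, Complex.mk_eq_add_mul_I]
  have hemb : IsClosedEmbedding e := by
    have : e = Complex.equivRealProdCLM.symm := by
      funext p
      simp [he, Complex.equivRealProdCLM_symm_apply]
    rw [this]
    exact Complex.equivRealProdCLM.symm.toHomeomorph.isClosedEmbedding
  set g₁ : ℝ × ℝ → ℂ := fun p => fderiv ℝ U (e p) 1 with hg₁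
  set g₂ : ℝ × ℝ → ℂ := fun p => fderiv ℝ U (e p) Complex.I with hg₂
  have hs : HasCompactSupport fun p => fderiv ℝ U (e p) := hfc.comp_isClosedEmbedding hemb
  have hi : ∀ w : ℂ, Integrable (fun p => fderiv ℝ U (e p) w) := fun w => by
    refine Continuous.integrable_of_hasCompactSupport
      ((hfd.comp hemb.continuous).clm_apply continuous_const) ?_
    refine hs.mono fun p hp h => hp ?_
    have h' : fderiv ℝ U (e p) = 0 := h
    simp [h']
  have hset : e ⁻¹' {z : ℂ | 0 < z.im} = Set.univ ×ˢ Set.Ioi 0 := by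
    ext p
    simp [he]
  have h0 : ∫ z in {z : ℂ | 0 < z.im}, dbar U z =
      ∫ p in Set.univ ×ˢ Set.Ioi (0 : ℝ), (g₁ p + Complex.I * g₂ p) / 2 := by
    rw [← Complex.volume_preserving_equiv_real_prod.symm.setIntegral_preimage_emb
      Complex.measurableEquivRealProd.symm.measurableEmbedding, ← hset]
    simp only [← heq]
    rw [show (⇑Complex.measurableEquivRealProd.symm : ℝ × ℝ → ℂ) = e from (funext heq).symm]
    rfl
  have h1 : ∫ p in Set.univ ×ˢ Set.Ioi (0 : ℝ), g₁ p = 0 := by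
    rw [Measure.volume_eq_prod, ← Measure.prod_restrict, integral_prod_symm]
    · refine setIntegral_eq_zero_of_forall_eq_zero fun y _ => ?_
      rw [Measure.restrict_univ]
      have hline : IsClosedEmbedding fun x : ℝ => (x : ℂ) + y * Complex.I :=
        Isometry.isClosedEmbedding (Isometry.of_dist_eq fun a b => by
          rw [dist_add_right, Complex.isometry_ofReal.dist_eq])
      have h2 : ∀ x : ℝ, HasDerivAt (fun x : ℝ => U ((x : ℂ) + y * Complex.I)) (g₁ (x, y)) x := by
        intro x
        have h3 : HasDerivAt (fun x : ℝ => (x : ℂ) + y * Complex.I) 1 x := by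
          simpa using (Complex.ofRealCLM.hasDerivAt (x := x)).add_const (y * Complex.I)
        exact (hd _).comp_hasDerivAt x h3
      refine integral_eq_zero_of_hasDerivAt_of_integrable h2 ?_ ?_
      · refine Continuous.integrable_of_hasCompactSupport
          ((hfd.comp hline.continuous).clm_apply continuous_const) ?_
        refine (hfc.comp_isClosedEmbedding hline).mono fun p hp h => hp ?_
        have h' : fderiv ℝ U ((p : ℂ) + y * Complex.I) = 0 := h
        simp [hg₁, he, h']
      · exact Continuous.integrable_of_hasCompactSupport (hU.continuous.comp hline.continuous)
          (hc.comp_isClosedEmbedding hline)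
    · rw [Measure.prod_restrict]
      exact (hi 1).integrableOn
  have h2 : ∫ p in Set.univ ×ˢ Set.Ioi (0 : ℝ), g₂ p = - ∫ x : ℝ, U x := by
    rw [Measure.volume_eq_prod, setIntegral_prod _ (hi Complex.I).integrableOn,
      Measure.restrict_univ, ← integral_neg]
    congr 1
    funext x
    have hline : IsClosedEmbedding fun y : ℝ => (x : ℂ) + y * Complex.I :=
      Isometry.isClosedEmbedding (Isometry.of_dist_eq fun a b => by
        rw [dist_add_left, dist_eq_norm, ← sub_mul, norm_mul, Complex.norm_I, mul_one,
          ← dist_eq_norm, Complex.isometry_ofReal.dist_eq])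
    have hcd : ContDiff ℝ 1 fun y : ℝ => U ((x : ℂ) + y * Complex.I) :=
      hU.comp (contDiff_const.add (Complex.ofRealCLM.contDiff.mul contDiff_const))
    have h3 := HasCompactSupport.integral_Ioi_deriv_eq hcd (hc.comp_isClosedEmbedding hline) 0
    simp only [Complex.ofReal_zero, zero_mul, add_zero] at h3
    rw [← h3]
    congr 1
    funext y
    have h4 : HasDerivAt (fun y : ℝ => (x : ℂ) + y * Complex.I) Complex.I y := by
      simpa using ((Complex.ofRealCLM.hasDerivAt (x := y)).mul_const Complex.I).const_add (x : ℂ)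
    exact ((hd _).comp_hasDerivAt y h4).deriv.symm
  rw [h0, integral_div, integral_add (hi 1).integrableOn ((hi Complex.I).integrableOn.const_mul _),
    integral_const_mul, h1, h2]
  ring

/-- Green's formula in the lower half plane. -/
theorem integral_dbar_lower {U : ℂ → ℂ} (hU : ContDiff ℝ 1 U) (hc : HasCompactSupport U) :
    ∫ z in {z : ℂ | z.im < 0}, dbar U z = (Complex.I / 2) * ∫ x : ℝ, U x := by
  have h1 := integral_dbar_upper (U := fun z => U (-z)) (hU.comp contDiff_neg)
    (hc.comp_isClosedEmbedding (Homeomorph.neg ℂ).isClosedEmbedding)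
  have h2 : ∀ z, dbar (fun z => U (-z)) z = - dbar U (-z) := by
    intro z
    have hd : HasFDerivAt U (fderiv ℝ U (-z)) (-z) :=
      (hU.differentiable one_ne_zero (-z)).hasFDerivAt
    have h3 : fderiv ℝ (fun z => U (-z)) z = -fderiv ℝ U (-z) := by
      have h4 : HasFDerivAt (fun z => U (-z))
          ((fderiv ℝ U (-z)).comp (-ContinuousLinearMap.id ℝ ℂ)) z :=
        hd.comp z (hasFDerivAt_id z).neg
      rw [h4.fderiv]
      ext; all_goals simp
    simp only [dbar, h3, neg_apply]
    ring
  simp only [h2] at h1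
  have h3 := (Measure.measurePreserving_neg (volume : Measure ℂ)).setIntegral_preimage_emb
    (MeasurableEquiv.neg ℂ).measurableEmbedding (dbar U) {z : ℂ | z.im < 0}
  have h4 : Neg.neg ⁻¹' {z : ℂ | z.im < 0} = {z : ℂ | 0 < z.im} := by
    ext z; simp
  rw [h4] at h3
  rw [integral_neg, h3] at h1
  have h5 : ∫ x : ℝ, U (-(x : ℂ)) = ∫ x : ℝ, U x := by
    rw [← integral_neg_eq_self (fun x : ℝ => U x)]
    push_cast
    rfl
  rw [h5] at h1
  linear_combination -h1

/-! ### Cauchy transforms of measures -/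

theorem lintegral_enorm_inv_lt_top :
    ∫⁻ z : ℂ, (Metric.ball (0 : ℂ) 1).indicator (fun z => ‖z⁻¹‖ₑ) z < ⊤ := by
  rw [← Complex.lintegral_comp_polarCoord_symm, polarCoord_target]
  set B : Set (ℝ × ℝ) := Set.Ioo 0 1 ×ˢ Set.Ioo (-Real.pi) Real.pi with hB
  have hBm : MeasurableSet B := measurableSet_Ioo.prod measurableSet_Ioo
  have h1 : ∀ p ∈ Set.Ioi (0 : ℝ) ×ˢ Set.Ioo (-Real.pi) Real.pi,
      ENNReal.ofReal p.1 • (Metric.ball (0 : ℂ) 1).indicator (fun z => ‖z⁻¹‖ₑ)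
        (Complex.polarCoord.symm p) ≤ B.indicator 1 p := by
    intro p hp
    have hp1 : 0 < p.1 := hp.1
    have hn : ‖Complex.polarCoord.symm p‖ = p.1 := by
      rw [Complex.norm_polarCoord_symm, abs_of_pos hp1]
    by_cases h2 : p.1 < 1
    · have h3 : Complex.polarCoord.symm p ∈ Metric.ball (0 : ℂ) 1 := by
        rw [mem_ball_zero_iff, hn]; exact h2
      have h4 : p ∈ B := ⟨⟨hp1, h2⟩, hp.2⟩
      rw [Set.indicator_of_mem h3, Set.indicator_of_mem h4, ← ofReal_norm, norm_inv, hn,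
        smul_eq_mul, ← ENNReal.ofReal_mul hp1.le, mul_inv_cancel₀ hp1.ne']
      simp
    · have h3 : Complex.polarCoord.symm p ∉ Metric.ball (0 : ℂ) 1 := by
        rw [mem_ball_zero_iff, hn]; exact h2
      rw [Set.indicator_of_notMem h3, smul_zero]
      exact zero_le
  calc _ ≤ ∫⁻ p in Set.Ioi (0 : ℝ) ×ˢ Set.Ioo (-Real.pi) Real.pi, B.indicator 1 p :=
        setLIntegral_mono' (measurableSet_Ioi.prod measurableSet_Ioo) h1
    _ ≤ ∫⁻ p, B.indicator 1 p := setLIntegral_le_lintegral _ _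
    _ = volume B := lintegral_indicator_one hBm
    _ < ⊤ := by
      rw [hB, Measure.volume_eq_prod, Measure.prod_prod]
      simp

/-- The kernel `1 / z` is locally integrable in the plane, uniformly in translations. -/
theorem exists_lintegral_div_le {g : ℂ → ℂ} (hg : Continuous g) (hc : HasCompactSupport g) :
    ∃ B : ℝ≥0∞, B < ⊤ ∧ ∀ x : ℂ, ∫⁻ z, ‖g z / (z - x)‖ₑ ≤ B := by
  obtain ⟨C, hC⟩ := hc.exists_bound_of_continuous hg
  set K : ℂ → ℝ≥0∞ := (Metric.ball (0 : ℂ) 1).indicator (fun z => ‖z⁻¹‖ₑ) with hK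
  have hKm : Measurable K := (measurable_inv.enorm).indicator Metric.isOpen_ball.measurableSet
  refine ⟨ENNReal.ofReal C * (∫⁻ z, K z) + ∫⁻ z, ‖g z‖ₑ, ?_, fun x => ?_⟩
  · refine ENNReal.add_lt_top.2 ⟨ENNReal.mul_lt_top ENNReal.ofReal_lt_top
      lintegral_enorm_inv_lt_top, ?_⟩
    exact (hg.integrable_of_hasCompactSupport hc).hasFiniteIntegral
  · have h1 : ∀ z, ‖g z / (z - x)‖ₑ ≤ ENNReal.ofReal C * K (z - x) + ‖g z‖ₑ := by
      intro z
      rw [div_eq_mul_inv, enorm_mul]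
      by_cases h2 : z - x ∈ Metric.ball (0 : ℂ) 1
      · rw [hK, Set.indicator_of_mem h2]
        refine le_add_right ?_
        gcongr
        rw [← ofReal_norm]
        exact ENNReal.ofReal_le_ofReal (hC z)
      · rw [hK, Set.indicator_of_notMem h2, mul_zero, zero_add]
        refine mul_le_of_le_one_right zero_le ?_
        rw [mem_ball_zero_iff, not_lt] at h2
        rw [← ofReal_norm, norm_inv, ENNReal.ofReal_le_one]
        exact inv_le_one_of_one_le₀ h2
    calc ∫⁻ z, ‖g z / (z - x)‖ₑ ≤ ∫⁻ z, (ENNReal.ofReal C * K (z - x) + ‖g z‖ₑ) :=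
          lintegral_mono h1
      _ = ENNReal.ofReal C * (∫⁻ z, K (z - x)) + ∫⁻ z, ‖g z‖ₑ := by
          rw [lintegral_add_right _ hg.measurable.enorm,
            lintegral_const_mul (f := fun z => K (z - x)) _ (hKm.comp (measurable_id.sub_const x))]
      _ = _ := by rw [lintegral_sub_right_eq_self]

theorem integrable_div_sub {g : ℂ → ℂ} (hg : Continuous g) (hc : HasCompactSupport g) (x : ℂ) :
    Integrable fun z => g z / (z - x) := by
  obtain ⟨B, hB, h⟩ := exists_lintegral_div_le hg hc
  exact ⟨(hg.measurable.div (measurable_id.sub_const x)).aestronglyMeasurable, (h x).trans_lt hB⟩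

theorem dbar_comp_affine {φ : ℂ → ℂ} (hφ : ContDiff ℝ 1 φ) (r : ℝ) (x z : ℂ) :
    dbar (fun z => φ (r • (z - x))) z = r * dbar φ (r • (z - x)) := by
  have hd : HasFDerivAt φ (fderiv ℝ φ (r • (z - x))) (r • (z - x)) :=
    (hφ.differentiable one_ne_zero _).hasFDerivAt
  have h1 : HasFDerivAt (fun z => r • (z - x)) (r • ContinuousLinearMap.id ℝ ℂ) z :=
    ((hasFDerivAt_id z).sub_const x).const_smul r
  have h2 : HasFDerivAt (fun z => φ (r • (z - x))) _ z := hd.comp z h1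
  rw [dbar, dbar, h2.fderiv]
  simp only [ContinuousLinearMap.comp_apply, smul_apply, ContinuousLinearMap.id_apply, map_smul]
  generalize fderiv ℝ φ (r • (z - x)) = T
  simp only [Complex.real_smul]
  ring

theorem hasCompactSupport_comp_affine {φ : ℂ → ℂ} (hc : HasCompactSupport φ) {r : ℝ} (hr : r ≠ 0)
    (x : ℂ) : HasCompactSupport fun z => φ (r • (z - x)) := by
  exact hc.comp_homeomorph ((Homeomorph.subRight x).trans (Homeomorph.smulOfNeZero r hr))

/-- The **Cauchy–Pompeiu formula** for functions of compact support. -/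
theorem integral_dbar_div_sub {φ : ℂ → ℂ} (hφ : ContDiff ℝ 1 φ) (hc : HasCompactSupport φ)
    (x : ℂ) : ∫ z, dbar φ z / (z - x) = -(Real.pi : ℂ) * φ x := by
  have h1 : ContDiff ℝ 1 fun z => φ ((1 : ℝ) • (z - -x)) := by fun_prop
  have h2 := integral_dbar_div h1 (hasCompactSupport_comp_affine hc one_ne_zero (-x))
  simp only [dbar_comp_affine hφ] at h2
  simp only [one_smul, sub_neg_eq_add, zero_add, Complex.ofReal_one,
    one_mul] at h2
  rw [← h2, ← integral_sub_right_eq_self (fun z => dbar φ (z + x) / z) x]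
  simp

/-- The Cauchy transform `z ↦ ∫ dμ(x) / (z - x)` of a measure. -/
def cauchyTransform (μ : Measure ℂ) (z : ℂ) : ℂ := ∫ x, 1 / (z - x) ∂μ

theorem integral_div_sub_eq (μ : Measure ℂ) (a z : ℂ) :
    ∫ x, a / (z - x) ∂μ = a * cauchyTransform μ z := by
  rw [cauchyTransform, ← integral_const_mul]
  simp only [mul_one_div]

section Fubini

variable (μ : Measure ℂ) [IsFiniteMeasure μ]

theorem integrable_prod_dbar {g : ℂ → ℂ} (hg : Continuous g) (hc : HasCompactSupport g) :
    Integrable (fun p : ℂ × ℂ => g p.2 / (p.2 - p.1)) (μ.prod volume) := by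
  obtain ⟨B, hB, h⟩ := exists_lintegral_div_le hg hc
  have hm : Measurable fun p : ℂ × ℂ => g p.2 / (p.2 - p.1) :=
    (hg.measurable.comp measurable_snd).div (measurable_snd.sub measurable_fst)
  refine ⟨hm.aestronglyMeasurable, ?_⟩
  rw [HasFiniteIntegral, lintegral_prod _ hm.enorm.aemeasurable]
  calc _ ≤ ∫⁻ _, B ∂μ := lintegral_mono fun x => h x
    _ = B * μ Set.univ := lintegral_const B
    _ < ⊤ := ENNReal.mul_lt_top hB (measure_lt_top _ _)

theorem integrable_mul_cauchyTransform {g : ℂ → ℂ} (hg : Continuous g)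
    (hc : HasCompactSupport g) : Integrable fun z => g z * cauchyTransform μ z := by
  have h := (integrable_prod_dbar μ hg hc).integral_prod_right
  simpa only [integral_div_sub_eq] using h

/-- A measure is recovered from its Cauchy transform. -/
theorem integral_eq_cauchyTransform {φ : ℂ → ℂ} (hφ : ContDiff ℝ 1 φ) (hc : HasCompactSupport φ) :
    ∫ x, φ x ∂μ = -(1 / (Real.pi : ℂ)) * ∫ z, dbar φ z * cauchyTransform μ z := by
  have hpi : (Real.pi : ℂ) ≠ 0 := Complex.ofReal_ne_zero.2 Real.pi_ne_zero
  have h := integral_integral_swap (μ := μ) (ν := volume) (f := fun x z => dbar φ z / (z - x))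
    (integrable_prod_dbar μ (continuous_dbar hφ) (hasCompactSupport_dbar hc))
  simp only [integral_dbar_div_sub hφ hc, integral_div_sub_eq, integral_const_mul] at h
  rw [← h]
  field_simp

/-- The mass of a measure near a point, or near infinity, is read off from the size of its Cauchy
transform there. -/
theorem norm_integral_scaled_sub_le {φ : ℂ → ℂ} (hφ : ContDiff ℝ 1 φ) (hc : HasCompactSupport φ)
    {r : ℝ} (hr : 0 < r) (x c : ℂ) {η : ℝ}
    (h : ∀ᵐ z, dbar φ (r • (z - x)) ≠ 0 → ‖(z - x) * cauchyTransform μ z - c‖ ≤ η) :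
    ‖∫ y, φ (r • (y - x)) ∂μ - c * φ 0‖ ≤ 1 / Real.pi * (η * ∫ u, ‖dbar φ u / u‖) := by
  have hpi : (Real.pi : ℂ) ≠ 0 := Complex.ofReal_ne_zero.2 Real.pi_ne_zero
  set ψ : ℂ → ℂ := fun z => φ (r • (z - x)) with hψ
  have hψ1 : ContDiff ℝ 1 ψ := by fun_prop
  have hψc : HasCompactSupport ψ := hasCompactSupport_comp_affine hc hr.ne' x
  have hd := continuous_dbar hψ1
  have hdc := hasCompactSupport_dbar hψc
  have h1 := integral_eq_cauchyTransform μ hψ1 hψc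
  have h2 := integral_dbar_div_sub hψ1 hψc x
  have hψx : ψ x = φ 0 := by simp [hψ]
  have hi := integrable_div_sub hd hdc x
  have h3 : ∫ y, ψ y ∂μ - c * φ 0 =
      -(1 / (Real.pi : ℂ)) * ∫ z, dbar ψ z / (z - x) * ((z - x) * cauchyTransform μ z - c) := by
    have h4 : ∫ z, dbar ψ z / (z - x) * ((z - x) * cauchyTransform μ z - c) =
        ∫ z, (dbar ψ z * cauchyTransform μ z - dbar ψ z / (z - x) * c) := by
      refine integral_congr_ae ?_
      have hne : ∀ᵐ z : ℂ, z ≠ x := by simp [ae_iff]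
      filter_upwards [hne] with z hz
      have := sub_ne_zero.2 hz
      field_simp
    rw [h4, integral_sub (integrable_mul_cauchyTransform μ hd hdc) (hi.mul_const c),
      integral_mul_const, h1, h2, hψx]
    field_simp
    ring
  have h5 : ∫ z, ‖dbar ψ z / (z - x)‖ = ∫ u, ‖dbar φ u / u‖ := by
    have h6 : ∀ z, ‖dbar ψ z / (z - x)‖ = r ^ 2 * ‖dbar φ (r • (z - x)) / (r • (z - x))‖ := by
      intro z
      rw [hψ, dbar_comp_affine hφ, norm_div, norm_div, norm_mul, norm_smul, Complex.norm_real,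
        Real.norm_eq_abs, abs_of_pos hr]
      by_cases h0 : ‖z - x‖ = 0
      · simp [h0]
      · field_simp
    simp only [h6]
    rw [integral_const_mul, integral_sub_right_eq_self (fun z => ‖dbar φ (r • z) / (r • z)‖) x,
      Measure.integral_comp_smul volume (fun u => ‖dbar φ u / u‖) r, Complex.finrank_real_complex,
      smul_eq_mul, abs_of_pos (by positivity)]
    field_simp
  rw [h3, norm_mul, norm_neg, norm_div, norm_one, Complex.norm_real, Real.norm_eq_abs,
    abs_of_pos Real.pi_pos]
  refine mul_le_mul_of_nonneg_left ?_ (by positivity)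
  rw [← h5, ← integral_const_mul]
  refine norm_integral_le_of_norm_le (hi.norm.const_mul η) ?_
  filter_upwards [h] with z hz
  rw [norm_mul, mul_comm]
  by_cases h0 : dbar φ (r • (z - x)) = 0
  · have : dbar ψ z = 0 := by rw [hψ, dbar_comp_affine hφ, h0, mul_zero]
    simp [this]
  · exact mul_le_mul_of_nonneg_right (hz h0) (norm_nonneg _)

end Fubini

open scoped ContDiff in
/-- Two finite measures with the same integrals of test functions supported in an open set agree
on this set. -/
theorem restrict_eq_of_integral_eq {μ ν : Measure ℂ} [IsFiniteMeasure μ] [IsFiniteMeasure ν]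
    {O : Set ℂ} (hO : IsOpen O)
    (h : ∀ φ : ℂ → ℝ, ContDiff ℝ ∞ φ → HasCompactSupport φ → tsupport φ ⊆ O →
      ∫ x, φ x ∂μ = ∫ x, φ x ∂ν) : μ.restrict O = ν.restrict O := by
  set π := μ + ν with hπ
  have hμ : μ ≪ π := Measure.AbsolutelyContinuous.rfl.add_right ν
  have hν : ν ≪ π := by
    rw [hπ, add_comm]; exact Measure.AbsolutelyContinuous.rfl.add_right μ
  have hi : ∀ ρ : Measure ℂ, IsFiniteMeasure ρ →
      Integrable (fun x => (ρ.rnDeriv π x).toReal) π := fun ρ _ => Measure.integrable_toReal_rnDeriv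
  have h1 : ∀ᵐ x ∂π, x ∈ O → (μ.rnDeriv π x).toReal - (ν.rnDeriv π x).toReal = 0 := by
    refine hO.ae_eq_zero_of_integral_contDiff_smul_eq_zero
      (((hi μ inferInstance).sub (hi ν inferInstance)).locallyIntegrable.locallyIntegrableOn O)
      fun φ hφ hc hs => ?_
    have h2 : ∀ ρ : Measure ℂ, IsFiniteMeasure ρ → ρ ≪ π →
        Integrable (fun x => (ρ.rnDeriv π x).toReal • φ x) π ∧
        ∫ x, (ρ.rnDeriv π x).toReal • φ x ∂π = ∫ x, φ x ∂ρ := fun ρ _ hρ =>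
      ⟨(integrable_rnDeriv_smul_iff hρ).2 (hφ.continuous.integrable_of_hasCompactSupport hc),
        integral_rnDeriv_smul hρ⟩
    have e1 := h2 μ inferInstance hμ
    have e2 := h2 ν inferInstance hν
    calc ∫ x, φ x • ((μ.rnDeriv π x).toReal - (ν.rnDeriv π x).toReal) ∂π
        = ∫ x, ((μ.rnDeriv π x).toReal • φ x - (ν.rnDeriv π x).toReal • φ x) ∂π := by
          congr 1; funext x; simp only [smul_eq_mul]; ring
      _ = 0 := by rw [integral_sub e1.1 e2.1, e1.2, e2.2, h φ hφ hc hs, sub_self]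
  have h3 : μ.rnDeriv π =ᵐ[π.restrict O] ν.rnDeriv π := by
    rw [EventuallyEq, ae_restrict_iff' hO.measurableSet]
    filter_upwards [h1, Measure.rnDeriv_lt_top μ π, Measure.rnDeriv_lt_top ν π] with x hx hx1 hx2 hxO
    exact (ENNReal.toReal_eq_toReal_iff' hx1.ne hx2.ne).1 (sub_eq_zero.1 (hx hxO))
  rw [← Measure.withDensity_rnDeriv_eq μ π hμ, ← Measure.withDensity_rnDeriv_eq ν π hν,
    restrict_withDensity hO.measurableSet, restrict_withDensity hO.measurableSet,
    withDensity_congr_ae h3]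

/-- Measures that agree near each point of a set agree on the set. -/
theorem restrict_eq_of_locally_eq {μ ν : Measure ℂ} {A : Set ℂ}
    (h : ∀ x ∈ A, ∃ U : Set ℂ, IsOpen U ∧ x ∈ U ∧ μ.restrict (A ∩ U) = ν.restrict (A ∩ U)) :
    μ.restrict A = ν.restrict A := by
  choose! U hU hxU heq using h
  obtain ⟨t, hts, htc, hcov⟩ := TopologicalSpace.countable_cover_nhdsWithin (s := A) (f := U)
    fun x hx => mem_nhdsWithin_of_mem_nhds ((hU x hx).mem_nhds (hxU x hx))
  have : Countable t := htc
  have hA : A = ⋃ x : t, A ∩ U x := by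
    ext y
    simp only [Set.mem_iUnion, Set.mem_inter_iff, exists_and_left, Subtype.exists, exists_prop]
    refine ⟨fun hy => ⟨hy, ?_⟩, fun hy => hy.1⟩
    simpa using hcov hy
  rw [hA]
  exact Measure.restrict_iUnion_congr.2 fun x => heq x (hts x.2)

/-! ### Vague limits and zero counting measures -/

/-- Measures of bounded mass have vague limits along ultrafilters. -/
theorem exists_vague_limit (𝒰 : Ultrafilter ℕ) (ν : ℕ → Measure ℂ) (M : ℝ≥0)
    (h : ∀ᶠ n in (𝒰 : Filter ℕ), ν n Set.univ ≤ M) :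
    ∃ μ : Measure ℂ, μ Set.univ ≤ M ∧ ∀ f : ℂ → ℝ, Continuous f → HasCompactSupport f →
      Tendsto (fun n => ∫ x, f x ∂(ν n)) 𝒰 (𝓝 (∫ x, f x ∂μ)) := by
  have hfin : ∀ᶠ n in (𝒰 : Filter ℕ), IsFiniteMeasure (ν n) := h.mono fun n hn =>
    ⟨hn.trans_lt ENNReal.coe_lt_top⟩
  have hint : ∀ n, IsFiniteMeasure (ν n) → ∀ g : CompactlySupportedContinuousMap ℂ ℝ,
      Integrable g (ν n) := fun n _ g =>
    g.continuous.integrable_of_hasCompactSupport g.hasCompactSupport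
  have L (g : CompactlySupportedContinuousMap ℂ ℝ) : ∃ x : ℝ,
      Tendsto (fun n => ∫ x, g x ∂(ν n)) 𝒰 (𝓝 x) := by
    obtain ⟨C, hC⟩ := g.hasCompactSupport.exists_bound_of_continuous g.continuous
    have hC0 : 0 ≤ C := (norm_nonneg _).trans (hC 0)
    have h1 : ∀ᶠ n in (𝒰 : Filter ℕ), ∫ x, g x ∂(ν n) ∈ Set.Icc (-(C * M)) (C * M) := by
      filter_upwards [h, hfin] with n hn hn'
      rw [Set.mem_Icc, ← abs_le, ← Real.norm_eq_abs]
      refine (norm_integral_le_of_norm_le_const (Eventually.of_forall hC)).trans ?_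
      gcongr
      exact ENNReal.toReal_le_coe_of_le_coe hn
    obtain ⟨x, -, hx⟩ := isCompact_Icc.ultrafilter_le_nhds' (𝒰.map fun n => ∫ x, g x ∂(ν n)) h1
    exact ⟨x, hx⟩
  choose Λ hΛ using L
  let Λ' : CompactlySupportedContinuousMap ℂ ℝ →ₚ[ℝ] ℝ :=
  { toFun := Λ
    map_add' g g' := by
      refine tendsto_nhds_unique (hΛ (g + g')) (((hΛ g).add (hΛ g')).congr' ?_)
      filter_upwards [hfin] with n hn
      rw [← integral_add (hint n hn g) (hint n hn g')]
      rfl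
    map_smul' c g := by
      refine tendsto_nhds_unique (hΛ (c • g)) (((hΛ g).const_smul c).congr fun n => ?_)
      rw [← integral_smul]
      rfl
    monotone' g g' hgg' := by
      refine le_of_tendsto_of_tendsto (hΛ g) (hΛ g') ?_
      filter_upwards [hfin] with n hn
      exact integral_mono (hint n hn g) (hint n hn g') hgg' }
  have hball : ∀ R : ℕ, RealRMK.rieszMeasure Λ' (Metric.closedBall 0 R) ≤ M := by
    intro R
    let g : CompactlySupportedContinuousMap ℂ ℝ :=
      { toFun := fun x => max 0 (min 1 ((R : ℝ) + 1 - ‖x‖))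
        continuous_toFun := by fun_prop
        hasCompactSupport' := by
          refine HasCompactSupport.intro (isCompact_closedBall 0 ((R : ℝ) + 1)) fun x hx => ?_
          rw [mem_closedBall_zero_iff, not_le] at hx
          exact max_eq_left ((min_le_right _ _).trans (by linarith)) }
    have h0 : ∀ x, 0 ≤ g x := fun x => le_max_left _ _
    have h1 : ∀ x, g x ≤ 1 := fun x => max_le zero_le_one (min_le_left _ _)
    have h2 : RealRMK.rieszMeasure Λ' (Metric.closedBall 0 R) ≤ ENNReal.ofReal (Λ' g) :=
      RealRMK.rieszMeasure_le_of_eq_one Λ' h0 (isCompact_closedBall _ _) fun x hx => by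
        rw [mem_closedBall_zero_iff] at hx
        have h3 : min 1 ((R : ℝ) + 1 - ‖x‖) = 1 := min_eq_left (by linarith)
        change max 0 (min 1 ((R : ℝ) + 1 - ‖x‖)) = 1
        rw [h3]
        simp
    refine h2.trans ?_
    rw [ENNReal.ofReal_le_iff_le_toReal ENNReal.coe_ne_top, ENNReal.coe_toReal]
    refine le_of_tendsto (hΛ g) ?_
    filter_upwards [h, hfin] with n hn hn'
    calc ∫ x, g x ∂(ν n) ≤ ∫ _, (1 : ℝ) ∂(ν n) :=
          integral_mono (hint n hn' g) (integrable_const _) h1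
      _ ≤ M := by
          rw [integral_const, smul_eq_mul, mul_one]
          exact ENNReal.toReal_le_coe_of_le_coe hn
  refine ⟨RealRMK.rieszMeasure Λ', ?_, fun f hf hc => ?_⟩
  · have hmono : Monotone fun R : ℕ => Metric.closedBall (0 : ℂ) R := fun a b hab =>
      Metric.closedBall_subset_closedBall (by exact_mod_cast hab)
    rw [← Metric.iUnion_closedBall_nat (0 : ℂ), hmono.measure_iUnion]
    exact iSup_le hball
  · have := hΛ ⟨⟨f, hf⟩, hc⟩
    rwa [show Λ ⟨⟨f, hf⟩, hc⟩ = ∫ x, f x ∂(RealRMK.rieszMeasure Λ') from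
      (RealRMK.integral_rieszMeasure Λ' ⟨⟨f, hf⟩, hc⟩).symm] at this

/-- Vague convergence upgrades to convergence for functions whose integrals outside large compact
sets are uniformly small. -/
theorem tendsto_integral_of_cutoff {l : Filter ℕ} {ν : ℕ → Measure ℂ} {μ : Measure ℂ}
    [IsFiniteMeasure μ] (hfin : ∀ᶠ n in l, IsFiniteMeasure (ν n))
    (hv : ∀ f : ℂ → ℝ, Continuous f → HasCompactSupport f →
      Tendsto (fun n => ∫ x, f x ∂(ν n)) l (𝓝 (∫ x, f x ∂μ)))
    {f : ℂ → ℂ} (hf : Continuous f) {C : ℝ} (hC : ∀ x, ‖f x‖ ≤ C)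
    (h : ∀ η > 0, ∃ χ : ℂ → ℝ, Continuous χ ∧ HasCompactSupport χ ∧
      (∀ᶠ n in l, ‖∫ x, ((1 - χ x : ℝ) : ℂ) * f x ∂(ν n)‖ ≤ η) ∧
      ‖∫ x, ((1 - χ x : ℝ) : ℂ) * f x ∂μ‖ ≤ η) :
    Tendsto (fun n => ∫ x, f x ∂(ν n)) l (𝓝 (∫ x, f x ∂μ)) := by
  have hcs : ∀ g : ℂ → ℂ, Continuous g → HasCompactSupport g →
      Tendsto (fun n => ∫ x, g x ∂(ν n)) l (𝓝 (∫ x, g x ∂μ)) := by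
    intro g hg hc
    have hre := hv (fun x => (g x).re) (Complex.continuous_re.comp hg) (hc.comp_left Complex.zero_re)
    have him := hv (fun x => (g x).im) (Complex.continuous_im.comp hg) (hc.comp_left Complex.zero_im)
    have h1 : ∀ ρ : Measure ℂ, IsFiniteMeasure ρ →
        ((∫ x, (g x).re ∂ρ : ℝ) : ℂ) + ((∫ x, (g x).im ∂ρ : ℝ) : ℂ) * Complex.I = ∫ x, g x ∂ρ :=
      fun ρ _ => integral_re_add_im (𝕜 := ℂ) (hg.integrable_of_hasCompactSupport hc)
    rw [← h1 μ inferInstance]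
    refine Tendsto.congr' ?_ (((Complex.continuous_ofReal.tendsto _).comp hre).add
      (((Complex.continuous_ofReal.tendsto _).comp him).mul_const Complex.I))
    filter_upwards [hfin] with n hn using h1 _ hn
  rw [Metric.tendsto_nhds]
  intro ε hε
  obtain ⟨χ, hχ, hχc, hn, hμ⟩ := h (ε / 4) (by linarith)
  have hg : Continuous fun x => (χ x : ℂ) * f x := (Complex.continuous_ofReal.comp hχ).mul hf
  have hgc : HasCompactSupport fun x => (χ x : ℂ) * f x :=
    (hχc.comp_left (g := fun x : ℝ => (x : ℂ)) Complex.ofReal_zero).mul_right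
  have hsplit : ∀ ρ : Measure ℂ, IsFiniteMeasure ρ → ∫ x, f x ∂ρ =
      ∫ x, (χ x : ℂ) * f x ∂ρ + ∫ x, ((1 - χ x : ℝ) : ℂ) * f x ∂ρ := by
    intro ρ _
    have hi : Integrable f ρ := Integrable.of_bound hf.aestronglyMeasurable C (Eventually.of_forall hC)
    have hi' := hg.integrable_of_hasCompactSupport hgc (μ := ρ)
    have h1 : ∫ x, ((1 - χ x : ℝ) : ℂ) * f x ∂ρ = ∫ x, (f x - (χ x : ℂ) * f x) ∂ρ := by
      congr 1; funext x; push_cast; ring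
    rw [h1, integral_sub hi hi']
    ring
  have h2 := Metric.tendsto_nhds.1 (hcs _ hg hgc) (ε / 4) (by linarith)
  filter_upwards [hn, h2, hfin] with n h3 h4 h5
  rw [dist_eq_norm] at h4 ⊢
  rw [hsplit _ h5, hsplit μ inferInstance]
  set A := ∫ x, (χ x : ℂ) * f x ∂(ν n)
  set B := ∫ x, ((1 - χ x : ℝ) : ℂ) * f x ∂(ν n)
  set A' := ∫ x, (χ x : ℂ) * f x ∂μ
  set B' := ∫ x, ((1 - χ x : ℝ) : ℂ) * f x ∂μ
  calc ‖A + B - (A' + B')‖ = ‖(A - A') + (B - B')‖ := by congr 1; ring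
    _ ≤ ‖A - A'‖ + (‖B‖ + ‖B'‖) := (norm_add_le _ _).trans (by gcongr; exact norm_sub_le _ _)
    _ < ε := by linarith

/-- A continuous cutoff function, equal to `1` on the disc of radius `R` and supported in the
disc of radius `R + 1`. -/
def cutoff (R : ℝ) (x : ℂ) : ℝ := max 0 (min 1 (R + 1 - ‖x‖))

theorem continuous_cutoff (R : ℝ) : Continuous (cutoff R) := by
  unfold cutoff
  fun_prop

theorem hasCompactSupport_cutoff (R : ℝ) : HasCompactSupport (cutoff R) := by
  refine HasCompactSupport.intro (isCompact_closedBall 0 (R + 1)) fun x hx => ?_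
  rw [mem_closedBall_zero_iff, not_le] at hx
  exact max_eq_left ((min_le_right _ _).trans (by linarith))

theorem cutoff_nonneg (R : ℝ) (x : ℂ) : 0 ≤ cutoff R x := le_max_left _ _

theorem cutoff_le_one (R : ℝ) (x : ℂ) : cutoff R x ≤ 1 := max_le zero_le_one (min_le_left _ _)

theorem cutoff_eq_one {R : ℝ} {x : ℂ} (h : ‖x‖ ≤ R) : cutoff R x = 1 := by
  rw [cutoff, min_eq_left (by linarith), max_eq_right zero_le_one]

/-- The zero counting measure of a polynomial, divided by `n`. -/
def countMeas (n : ℕ) (D : ℂ[X]) : Measure ℂ :=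
  (n : ℝ≥0∞)⁻¹ • (D.roots.map Measure.dirac).sum

theorem sum_dirac_apply_univ (s : Multiset ℂ) :
    (s.map Measure.dirac).sum Set.univ = Multiset.card s := by
  induction s using Multiset.induction with
  | empty => simp
  | cons a s ih =>
    rw [Multiset.map_cons, Multiset.sum_cons, Measure.add_apply, ih]
    simp [add_comm]

theorem integral_sum_dirac {E : Type*} [NormedAddCommGroup E] [NormedSpace ℝ E] [CompleteSpace E]
    (f : ℂ → E) (s : Multiset ℂ) :
    Integrable f (s.map Measure.dirac).sum ∧
      ∫ x, f x ∂(s.map Measure.dirac).sum = (s.map f).sum := by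
  induction s using Multiset.induction with
  | empty => simp
  | cons a s ih =>
    have h1 : Integrable f (Measure.dirac a) := integrable_dirac (by simp)
    simp only [Multiset.map_cons, Multiset.sum_cons]
    exact ⟨h1.add_measure ih.1, by rw [integral_add_measure h1 ih.1, integral_dirac, ih.2]⟩

theorem integral_countMeas {E : Type*} [NormedAddCommGroup E] [NormedSpace ℝ E] [CompleteSpace E]
    (n : ℕ) (D : ℂ[X]) (f : ℂ → E) :
    ∫ x, f x ∂(countMeas n D) = (n : ℝ)⁻¹ • (D.roots.map f).sum := by
  rw [countMeas, integral_smul_measure, (integral_sum_dirac f _).2, ENNReal.toReal_inv,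
    ENNReal.toReal_natCast]

theorem countMeas_univ_le {n : ℕ} (hn : n ≠ 0) {D : ℂ[X]} {M : ℝ≥0}
    (h : (D.natDegree : ℝ) ≤ n * M) : countMeas n D Set.univ ≤ M := by
  rw [countMeas, Measure.smul_apply, sum_dirac_apply_univ, smul_eq_mul]
  have h1 : ((Multiset.card D.roots : ℕ) : ℝ≥0) ≤ n * M := by
    have h2 : ((Multiset.card D.roots : ℕ) : ℝ) ≤ n * M :=
      le_trans (by exact_mod_cast D.card_roots') h
    exact_mod_cast h2
  have hn' : (n : ℝ≥0∞) ≠ 0 := by exact_mod_cast hn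
  calc (n : ℝ≥0∞)⁻¹ * (Multiset.card D.roots : ℕ) ≤ (n : ℝ≥0∞)⁻¹ * (n * M) := by
        gcongr
        exact_mod_cast h1
    _ = M := by
        rw [← mul_assoc, ENNReal.inv_mul_cancel hn' (ENNReal.natCast_ne_top n), one_mul]

/-! ### Limits of the zero counting measures -/

/-- The function `x ↦ 1 / (z - x)`, regularized to be continuous in the disc of radius `ε`
about `z`. -/
def regKernel (z : ℂ) (ε : ℝ) (x : ℂ) : ℂ :=
  (starRingEnd ℂ) (z - x) / ((max (‖z - x‖ ^ 2) (ε ^ 2) : ℝ) : ℂ)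

theorem continuous_regKernel (z : ℂ) {ε : ℝ} (hε : 0 < ε) : Continuous (regKernel z ε) := by
  unfold regKernel
  refine Continuous.div ?_ ?_ fun x => ?_
  · exact Complex.continuous_conj.comp (continuous_const.sub continuous_id)
  · exact Complex.continuous_ofReal.comp (by fun_prop)
  · rw [Complex.ofReal_ne_zero]
    exact ((by positivity : 0 < ε ^ 2).trans_le (le_max_right _ _)).ne'

theorem regKernel_eq {z x : ℂ} {ε : ℝ} (hε : 0 < ε) (h : ε ≤ ‖z - x‖) :
    regKernel z ε x = 1 / (z - x) := by
  have h0 : z - x ≠ 0 := norm_pos_iff.1 (hε.trans_le h)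
  have h1 : max (‖z - x‖ ^ 2) (ε ^ 2) = ‖z - x‖ ^ 2 := max_eq_left (by gcongr)
  rw [regKernel, h1, div_eq_div_iff _ h0, Complex.conj_mul', one_mul]
  · push_cast; rfl
  · rw [Complex.ofReal_ne_zero]
    exact pow_ne_zero _ (norm_ne_zero_iff.2 h0)

theorem norm_regKernel_le (z : ℂ) {ε : ℝ} (hε : 0 < ε) (x : ℂ) : ‖regKernel z ε x‖ ≤ 1 / ε := by
  rw [regKernel, norm_div, RCLike.norm_conj, Complex.norm_real, Real.norm_eq_abs,
    abs_of_pos ((by positivity : 0 < ε ^ 2).trans_le (le_max_right _ _)),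
    div_le_div_iff₀ ((by positivity : 0 < ε ^ 2).trans_le (le_max_right _ _)) hε, one_mul]
  rcases le_total ‖z - x‖ ε with h | h
  · refine le_trans ?_ (le_max_right _ _)
    nlinarith
  · refine le_trans ?_ (le_max_left _ _)
    nlinarith

theorem norm_regKernel_le_of_le {z x : ℂ} {ε δ : ℝ} (hε : 0 < ε) (hδ : ε ≤ δ) (h : δ ≤ ‖z - x‖) :
    ‖regKernel z ε x‖ ≤ 1 / δ := by
  rw [regKernel_eq hε (hδ.trans h), norm_div, norm_one]
  have := hε.trans_le hδ
  gcongr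

namespace Pencil

variable {N m : ℕ} {Q : Pencil N m}

theorem ae_good : ∀ᵐ z : ℂ, z ∈ Q.good := by
  have h1 : ∀ᵐ z : ℂ, z ∉ Q.Gam := measure_eq_zero_iff_ae_notMem.1 Q.volume_gam
  have h2 : ∀ᵐ z : ℂ, z ∉ Q.Simpleᶜ :=
    measure_eq_zero_iff_ae_notMem.1 (Q.finite_compl_simple.measure_zero _)
  filter_upwards [h1, h2] with z h3 h4
  exact ⟨not_not.1 h4, h3⟩

/-- The properties shared by all limits of the zero counting measures: being finite, carried by `Γ` and
without atoms, and having the Cauchy transform `-w'/w`. -/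
structure IsLimitMeasure (Q : Pencil N m) (μ : Measure ℂ) : Prop where
  finite : IsFiniteMeasure μ
  carried : μ Q.Gamᶜ = 0
  cauchy : ∀ z ∈ Q.good, cauchyTransform μ z = -logDeriv Q.w z
  atom : ∀ x, μ {x} = 0

/-- A measure with Cauchy transform `-w'/w` has no atoms, because an atom would give the transform a
simple pole. -/
theorem measure_singleton_eq_zero {μ : Measure ℂ} [IsFiniteMeasure μ]
    (hμ : ∀ z ∈ Q.good, cauchyTransform μ z = -logDeriv Q.w z) (x : ℂ) : μ {x} = 0 := by
  let b : ContDiffBump (0 : ℂ) := ⟨1, 2, one_pos, one_lt_two⟩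
  set φ : ℂ → ℂ := fun z => (b z : ℂ) with hφ
  have hφ1 : ContDiff ℝ 1 φ := Complex.ofRealCLM.contDiff.comp b.contDiff
  have hφc : HasCompactSupport φ :=
    b.hasCompactSupport.comp_left (g := fun x : ℝ => (x : ℂ)) Complex.ofReal_zero
  obtain ⟨R, hR⟩ := (hasCompactSupport_dbar hφc).isCompact.isBounded.subset_closedBall 0
  have hR' : ∀ u, dbar φ u ≠ 0 → ‖u‖ ≤ max R 1 := fun u hu =>
    (mem_closedBall_zero_iff.1 (hR (subset_closure hu))).trans (le_max_left _ _)
  have hR1 : 0 < max R 1 := one_pos.trans_le (le_max_right _ _)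
  set J := ∫ u, ‖dbar φ u / u‖
  have hb0 : b 0 = 1 := b.one_of_mem_closedBall (by simp [b])
  have key : ∀ η > 0, (μ {x}).toReal ≤ 1 / Real.pi * (η * J) := by
    intro η hη
    have h1 := Metric.tendsto_nhds.1 (Q.tendsto_sub_mul_logDeriv_w x) η hη
    rw [eventually_inf_principal] at h1
    obtain ⟨δ, hδ, hball⟩ := Metric.eventually_nhds_iff_ball.1 h1
    have hr : 0 < 2 * max R 1 / δ := by positivity
    have h2 := norm_integral_scaled_sub_le μ hφ1 hφc hr x 0 (η := η) (by
      filter_upwards [ae_good (Q := Q)] with z hz hne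
      rw [sub_zero, hμ z hz]
      have h3 := hR' _ hne
      rw [norm_smul, Real.norm_eq_abs, abs_of_pos hr, div_mul_eq_mul_div, div_le_iff₀ hδ] at h3
      have h4 : z ∈ Metric.ball x δ := by
        rw [mem_ball_iff_norm]
        nlinarith [norm_nonneg (z - x)]
      have h5 := hball z h4 hz
      rw [dist_zero_right] at h5
      exact h5.le)
    rw [zero_mul, sub_zero] at h2
    refine le_trans ?_ h2
    have h3 : ∫ y, φ ((2 * max R 1 / δ) • (y - x)) ∂μ =
        ((∫ y, b ((2 * max R 1 / δ) • (y - x)) ∂μ : ℝ) : ℂ) := by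
      rw [← integral_complex_ofReal]
    rw [h3, Complex.norm_real, Real.norm_eq_abs]
    refine le_trans ?_ (le_abs_self _)
    have hc : Continuous fun y => b ((2 * max R 1 / δ) • (y - x)) := by
      have := b.continuous
      fun_prop
    have hi : Integrable (fun y => b ((2 * max R 1 / δ) • (y - x))) μ :=
      Integrable.of_bound hc.aestronglyMeasurable 1 (Eventually.of_forall fun y => by
        rw [Real.norm_eq_abs, abs_of_nonneg b.nonneg]
        exact b.le_one)
    calc (μ {x}).toReal = ∫ y in {x}, b ((2 * max R 1 / δ) • (y - x)) ∂μ := by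
          rw [integral_singleton]
          simp [hb0, Measure.real]
      _ ≤ _ := setIntegral_le_integral hi (Eventually.of_forall fun y => b.nonneg)
  have hle : (μ {x}).toReal ≤ 0 := by
    refine ge_of_tendsto (x := 𝓝[>] (0 : ℝ)) (f := fun η => 1 / Real.pi * (η * J)) ?_ ?_
    · have : Tendsto (fun η : ℝ => 1 / Real.pi * (η * J)) (𝓝 0) (𝓝 (1 / Real.pi * (0 * J))) :=
        (continuous_const.mul (continuous_id.mul continuous_const)).tendsto 0
      rw [zero_mul, mul_zero] at this
      exact this.mono_left nhdsWithin_le_nhds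
    · filter_upwards [self_mem_nhdsWithin] with η hη using key η hη
  have h0 : (μ {x}).toReal = 0 := le_antisymm hle ENNReal.toReal_nonneg
  exact (ENNReal.toReal_eq_zero_iff _).1 h0 |>.resolve_right (measure_ne_top _ _)

/-- A measure with Cauchy transform `-w'/w` has at least the mass prescribed by the behaviour of `w'/w`
at infinity. -/
theorem mass_le_measure_univ {μ : Measure ℂ} [IsFiniteMeasure μ]
    (hμ : ∀ z ∈ Q.good, cauchyTransform μ z = -logDeriv Q.w z) :
    Q.mass ≤ (μ Set.univ).toReal := by
  let b : ContDiffBump (0 : ℂ) := ⟨1, 2, one_pos, one_lt_two⟩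
  set φ : ℂ → ℂ := fun z => (b z : ℂ) with hφ
  have hφ1 : ContDiff ℝ 1 φ := Complex.ofRealCLM.contDiff.comp b.contDiff
  have hφc : HasCompactSupport φ :=
    b.hasCompactSupport.comp_left (g := fun x : ℝ => (x : ℂ)) Complex.ofReal_zero
  have hφ0 : φ 0 = 1 := by
    simp only [hφ]
    rw [b.one_of_mem_closedBall (by simp [b]), Complex.ofReal_one]
  have hR' : ∀ u, dbar φ u ≠ 0 → 1 ≤ ‖u‖ := by
    intro u hu
    by_contra! h
    refine hu ?_
    have h1 : φ =ᶠ[𝓝 u] fun _ => 1 := by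
      filter_upwards [Metric.isOpen_ball.mem_nhds (mem_ball_zero_iff.2 h)] with y hy
      simp only [hφ]
      rw [b.one_of_mem_closedBall (Metric.ball_subset_closedBall hy), Complex.ofReal_one]
    rw [dbar, h1.fderiv_eq]
    simp
  set J := ∫ u, ‖dbar φ u / u‖
  have key : ∀ η > 0, Q.mass - (μ Set.univ).toReal ≤ 1 / Real.pi * (η * J) := by
    intro η hη
    have h1 := Metric.tendsto_nhds.1 Q.tendsto_mul_logDeriv_w η hη
    rw [eventually_inf_principal, ← comap_norm_atTop, eventually_comap] at h1
    obtain ⟨R, hR⟩ := eventually_atTop.1 h1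
    have hR1 : 0 < max R 1 := one_pos.trans_le (le_max_right _ _)
    have hr : 0 < (max R 1)⁻¹ := inv_pos.2 hR1
    have h2 := norm_integral_scaled_sub_le μ hφ1 hφc hr 0 Q.mass (η := η) (by
      filter_upwards [ae_good (Q := Q)] with z hz hne
      rw [hμ z hz, ← dist_eq_norm, sub_zero]
      have h3 := hR' _ hne
      rw [sub_zero, norm_smul, Real.norm_eq_abs, abs_of_pos hr, ← div_eq_inv_mul,
        le_div_iff₀ hR1, one_mul] at h3
      exact (hR ‖z‖ ((le_max_left _ _).trans h3) z rfl hz).le)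
    rw [hφ0, mul_one] at h2
    refine le_trans ?_ h2
    have h3 : ‖∫ y, φ ((max R 1)⁻¹ • (y - 0)) ∂μ‖ ≤ (μ Set.univ).toReal := by
      have := norm_integral_le_of_norm_le_const (μ := μ) (C := 1)
        (f := fun y => φ ((max R 1)⁻¹ • (y - 0))) (Eventually.of_forall fun y => by
          simp only [hφ]
          rw [Complex.norm_real, Real.norm_eq_abs, abs_of_nonneg b.nonneg]
          exact b.le_one)
      rwa [one_mul] at this
    have h4 : ‖(Q.mass : ℂ)‖ = Q.mass := by
      rw [Complex.norm_real, Real.norm_eq_abs, abs_of_nonneg Q.mass_nonneg]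
    have h5 := norm_sub_norm_le (Q.mass : ℂ) (∫ y, φ ((max R 1)⁻¹ • (y - 0)) ∂μ)
    rw [norm_sub_rev] at h5
    linarith
  have hle : Q.mass - (μ Set.univ).toReal ≤ 0 := by
    refine ge_of_tendsto (x := 𝓝[>] (0 : ℝ)) (f := fun η => 1 / Real.pi * (η * J)) ?_ ?_
    · have : Tendsto (fun η : ℝ => 1 / Real.pi * (η * J)) (𝓝 0) (𝓝 (1 / Real.pi * (0 * J))) :=
        (continuous_const.mul (continuous_id.mul continuous_const)).tendsto 0
      rw [zero_mul, mul_zero] at this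
      exact this.mono_left nhdsWithin_le_nhds
    · filter_upwards [self_mem_nhdsWithin] with η hη using key η hη
  linarith

/-- The number `Q.mass` as a nonnegative real. -/
def massNN (Q : Pencil N m) : ℝ≥0 := ⟨Q.mass, Q.mass_nonneg⟩

variable {D : ℕ → ℂ[X]}

theorem eventually_countMeas_le
    (hD : ∀ n lam, (D n).eval lam = (polyToeplitz m n (Q.f lam)).det) :
    ∀ᶠ n in atTop, countMeas n (D n) Set.univ ≤ Q.massNN := by
  filter_upwards [eventually_ne_atTop 0] with n hn
  exact countMeas_univ_le (M := Q.massNN) hn (Q.natDegree_le_mass (hD n))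

/-- The zero counting measures have limits along all ultrafilters, for weak convergence. -/
theorem exists_isLimitMeasure
    (hD : ∀ n lam, (D n).eval lam = (polyToeplitz m n (Q.f lam)).det) (𝒰 : Ultrafilter ℕ)
    (h𝒰 : (𝒰 : Filter ℕ) ≤ atTop) :
    ∃ μ, Q.IsLimitMeasure μ ∧ (∀ φ : ℂ → ℂ, Continuous φ → (∃ C, ∀ x, ‖φ x‖ ≤ C) →
      Tendsto (fun n => ∫ x, φ x ∂(countMeas n (D n))) 𝒰 (𝓝 (∫ x, φ x ∂μ))) := by
  set M : ℝ≥0 := Q.massNN with hM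
  have hmass : ∀ᶠ n in (𝒰 : Filter ℕ), countMeas n (D n) Set.univ ≤ M :=
    h𝒰 (eventually_countMeas_le hD)
  obtain ⟨μ, hμM, hv⟩ := exists_vague_limit 𝒰 (fun n => countMeas n (D n)) M hmass
  have hfin : IsFiniteMeasure μ := ⟨hμM.trans_lt ENNReal.coe_lt_top⟩
  have hfinn : ∀ᶠ n in (𝒰 : Filter ℕ), IsFiniteMeasure (countMeas n (D n)) :=
    hmass.mono fun n hn => ⟨hn.trans_lt ENNReal.coe_lt_top⟩
  have hroot : ∀ {n x}, x ∈ (D n).roots → (D n).eval x = 0 := fun hx => by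
    rw [Polynomial.mem_roots'] at hx
    exact hx.2
  -- Near a point off `Γ` there are eventually no zeros, so `μ` vanishes there.
  have hzero : ∀ lam₀ ∉ Q.Gam, ∃ ε > 0, μ (Metric.ball lam₀ ε) = 0 ∧
      ∀ᶠ n in (𝒰 : Filter ℕ), ∀ x ∈ (D n).roots, x ∉ Metric.ball lam₀ ε := by
    intro lam₀ hG
    obtain ⟨ε, hε, hball⟩ := exists_ball_eval_ne_zero hD hG
    have hno : ∀ᶠ n in (𝒰 : Filter ℕ), ∀ x ∈ (D n).roots, x ∉ Metric.ball lam₀ ε := by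
      filter_upwards [h𝒰 hball] with n hn x hx hxb using hn x hxb (hroot hx)
    refine ⟨ε, hε, ?_, hno⟩
    set φ : ℂ → ℝ := fun x => max 0 (ε - dist x lam₀) with hφ
    have hφc : Continuous φ := by fun_prop
    have hφs : HasCompactSupport φ :=
      HasCompactSupport.intro (isCompact_closedBall lam₀ ε) fun x hx => by
        rw [Metric.mem_closedBall, not_le] at hx
        exact max_eq_left (by linarith)
    have h1 := hv φ hφc hφs
    have h2 : ∫ x, φ x ∂μ = 0 := by
      refine tendsto_nhds_unique h1 (tendsto_const_nhds.congr' ?_)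
      filter_upwards [hno] with n hn
      rw [integral_countMeas, Multiset.map_congr rfl (g := fun _ => (0 : ℝ)) fun x hx => ?_]
      · simp
      · have := hn x hx
        rw [Metric.mem_ball, not_lt] at this
        exact max_eq_left (by linarith)
    have h3 : φ =ᵐ[μ] 0 := (integral_eq_zero_iff_of_nonneg (fun x => le_max_left _ _)
      (hφc.integrable_of_hasCompactSupport hφs)).1 h2
    refine measure_mono_null (fun x hx => ?_) (ae_iff.1 h3)
    have hx' : dist x lam₀ < ε := hx
    simp only [hφ, Pi.zero_apply]
    intro h4
    have := le_max_right 0 (ε - dist x lam₀)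
    linarith [h4 ▸ this]
  have hcarried : μ Q.Gamᶜ = 0 := by
    refine measure_null_of_locally_null _ fun x hx => ?_
    obtain ⟨ε, hε, h1, -⟩ := hzero x hx
    exact ⟨_, mem_nhdsWithin_of_mem_nhds (Metric.ball_mem_nhds x hε), h1⟩
  have hcauchy : ∀ z ∈ Q.good, cauchyTransform μ z = -logDeriv Q.w z := by
    intro z hz
    obtain ⟨ε, hε, h1, h2⟩ := hzero z hz.2
    have hk : Tendsto (fun n => ∫ x, regKernel z ε x ∂(countMeas n (D n))) 𝒰
        (𝓝 (∫ x, regKernel z ε x ∂μ)) := by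
      refine tendsto_integral_of_cutoff hfinn hv (continuous_regKernel z hε)
        (norm_regKernel_le z hε) fun η hη => ?_
      set δ := max ε (M / η + 1) with hδ
      have hδ0 : 0 < δ := hε.trans_le (le_max_left _ _)
      set R := ‖z‖ + δ
      have hpt : ∀ x, ‖((1 - cutoff R x : ℝ) : ℂ) * regKernel z ε x‖ ≤ 1 / δ := by
        intro x
        rw [norm_mul, Complex.norm_real, Real.norm_eq_abs,
          abs_of_nonneg (by linarith [cutoff_le_one R x])]
        by_cases hx : ‖x‖ ≤ R
        · rw [cutoff_eq_one hx, sub_self, zero_mul]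
          positivity
        · push Not at hx
          have h3 : δ ≤ ‖z - x‖ := by
            have := norm_sub_norm_le x z
            rw [norm_sub_rev] at this
            linarith
          calc (1 - cutoff R x) * ‖regKernel z ε x‖ ≤ 1 * ‖regKernel z ε x‖ := by
                gcongr
                linarith [cutoff_nonneg R x]
            _ ≤ 1 / δ := by
                rw [one_mul]
                exact norm_regKernel_le_of_le hε (le_max_left _ _) h3
      have hbound : ∀ ρ : Measure ℂ, ρ Set.univ ≤ M →
          ‖∫ x, ((1 - cutoff R x : ℝ) : ℂ) * regKernel z ε x ∂ρ‖ ≤ η := by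
        intro ρ hρ
        have : IsFiniteMeasure ρ := ⟨hρ.trans_lt ENNReal.coe_lt_top⟩
        refine (norm_integral_le_of_norm_le_const (Eventually.of_forall hpt)).trans ?_
        have h4 : ρ.real Set.univ ≤ M := ENNReal.toReal_le_coe_of_le_coe hρ
        have h5 : (M : ℝ) ≤ η * δ := by
          have : M / η + 1 ≤ δ := le_max_right _ _
          have h6 : (M : ℝ) / η ≤ δ := by linarith
          rw [div_le_iff₀ hη] at h6
          linarith
        rw [one_div, inv_mul_le_iff₀ hδ0]
        linarith
      exact ⟨cutoff R, continuous_cutoff R, hasCompactSupport_cutoff R,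
        hmass.mono fun n hn => hbound _ hn, hbound _ hμM⟩
    have h3 : cauchyTransform μ z = ∫ x, regKernel z ε x ∂μ := by
      refine integral_congr_ae ?_
      have h4 : ∀ᵐ x ∂μ, x ∉ Metric.ball z ε := measure_eq_zero_iff_ae_notMem.1 h1
      filter_upwards [h4] with x hx
      rw [mem_ball_iff_norm', not_lt] at hx
      exact (regKernel_eq hε hx).symm
    rw [h3]
    refine tendsto_nhds_unique hk (((tendsto_logDeriv_eval hD hz.2).mono_left h𝒰).congr' ?_)
    filter_upwards [h2] with n hn
    have hne : (D n).eval z = 0 → D n = 0 := by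
      intro h5
      by_contra h6
      exact hn z ((Polynomial.mem_roots h6).2 h5) (Metric.mem_ball_self hε)
    rw [integral_countMeas]
    have h5 : (D n).roots.map (regKernel z ε) = (D n).roots.map fun x => 1 / (z - x) := by
      refine Multiset.map_congr rfl fun x hx => regKernel_eq hε ?_
      have := hn x hx
      rwa [mem_ball_iff_norm', not_lt] at this
    rw [h5, Complex.real_smul]
    push_cast
    by_cases h6 : D n = 0
    · simp [h6]
    · rw [(IsAlgClosed.splits (D n)).eval_derivative_div_eval_of_ne_zero fun h7 => h6 (hne h7)]
  refine ⟨μ, ⟨hfin, hcarried, hcauchy, fun x => measure_singleton_eq_zero hcauchy x⟩, ?_⟩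
  rintro φ hφ ⟨C, hC⟩
  have hC0 : 0 ≤ C := (norm_nonneg _).trans (hC 0)
  refine tendsto_integral_of_cutoff hfinn hv hφ hC fun η hη => ?_
  have hci : ∀ R : ℝ, ∀ ρ : Measure ℂ, IsFiniteMeasure ρ → Integrable (cutoff R) ρ := fun R ρ _ =>
    (continuous_cutoff R).integrable_of_hasCompactSupport (hasCompactSupport_cutoff R)
  have hlim : Tendsto (fun R : ℕ => ∫ x, cutoff R x ∂μ) atTop (𝓝 (∫ _, (1 : ℝ) ∂μ)) := by
    refine tendsto_integral_of_dominated_convergence (fun _ => 1)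
      (fun R => (continuous_cutoff R).aestronglyMeasurable) (integrable_const _)
      (fun R => Eventually.of_forall fun x => ?_) (Eventually.of_forall fun x => ?_)
    · rw [Real.norm_eq_abs, abs_of_nonneg (cutoff_nonneg _ x)]
      exact cutoff_le_one _ x
    · refine tendsto_const_nhds.congr' ?_
      filter_upwards [eventually_ge_atTop ⌈‖x‖⌉₊] with R hR
      exact (cutoff_eq_one ((Nat.le_ceil _).trans (by exact_mod_cast hR))).symm
  rw [integral_const, smul_eq_mul, mul_one] at hlim
  set η' := η / (C + 1) with hη'
  have hη'0 : 0 < η' := by positivity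
  obtain ⟨R, hR⟩ := (hlim.eventually (lt_mem_nhds (show μ.real Set.univ - η' < μ.real Set.univ by
    linarith))).exists
  -- `μ` has the largest mass that the counting measures can have, so for these, too, all but a small
  -- part of the mass lies where `cutoff R` is positive.
  have hmassle := mass_le_measure_univ hcauchy
  have hbound : ∀ ρ : Measure ℂ, IsFiniteMeasure ρ → ρ.real Set.univ ≤ Q.mass →
      Q.mass - η' ≤ ∫ x, cutoff R x ∂ρ →
      ‖∫ x, ((1 - cutoff R x : ℝ) : ℂ) * φ x ∂ρ‖ ≤ η := by
    intro ρ _ h1 h2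
    have h3 : ‖∫ x, ((1 - cutoff R x : ℝ) : ℂ) * φ x ∂ρ‖ ≤ ∫ x, (1 - cutoff R x) * C ∂ρ := by
      refine norm_integral_le_of_norm_le (((integrable_const 1).sub (hci R ρ inferInstance)).mul_const C)
        (Eventually.of_forall fun x => ?_)
      rw [norm_mul, Complex.norm_real, Real.norm_eq_abs,
        abs_of_nonneg (by linarith [cutoff_le_one (R : ℝ) x])]
      exact mul_le_mul_of_nonneg_left (hC x) (by linarith [cutoff_le_one (R : ℝ) x])
    rw [integral_mul_const, integral_sub (integrable_const 1) (hci R ρ inferInstance),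
      integral_const, smul_eq_mul, mul_one] at h3
    calc _ ≤ (ρ.real Set.univ - ∫ x, cutoff R x ∂ρ) * C := h3
      _ ≤ η' * (C + 1) := by
          have : ρ.real Set.univ - ∫ x, cutoff R x ∂ρ ≤ η' := by linarith
          nlinarith
      _ = η := by rw [hη']; field_simp
  have hμM' : μ.real Set.univ ≤ Q.mass := ENNReal.toReal_le_coe_of_le_coe hμM
  have hmassle' : Q.mass ≤ μ.real Set.univ := hmassle
  refine ⟨cutoff R, continuous_cutoff R, hasCompactSupport_cutoff R, ?_,
    hbound μ hfin hμM' (by linarith)⟩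
  have h1 := (hv _ (continuous_cutoff R) (hasCompactSupport_cutoff R)).eventually (lt_mem_nhds hR)
  filter_upwards [h1, hmass, hfinn] with n h2 h3 h4
  have h5 : (countMeas n (D n)).real Set.univ ≤ M := ENNReal.toReal_le_coe_of_le_coe h3
  exact hbound _ h4 h5 (by linarith)

end Pencil

/-! ### The sides of an analytic arc -/

/-- A real analytic function of a real variable extends to a holomorphic function. -/
theorem exists_holomorphic_extension {γ : ℝ → ℂ} {x₀ : ℝ} (hγ : AnalyticAt ℝ γ x₀) :
    ∃ H : ℂ → ℂ, AnalyticAt ℂ H x₀ ∧ ∀ᶠ x : ℝ in 𝓝 x₀, H x = γ x := by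
  obtain ⟨p, r, hp⟩ := hγ
  set q := FormalMultilinearSeries.ofScalars ℂ (𝕜 := ℂ) fun n => p.coeff n with hq
  obtain ⟨s, hs0, hsr⟩ := ENNReal.lt_iff_exists_nnreal_btwn.1 hp.r_pos
  have hs0' : 0 < s := by exact_mod_cast hs0
  have hqr : (s : ℝ≥0∞) ≤ q.radius := by
    obtain ⟨C, -, hC⟩ := p.norm_mul_pow_le_of_lt_radius (hsr.trans_le hp.r_le)
    refine q.le_radius_of_bound C fun n => ?_
    rw [hq, FormalMultilinearSeries.ofScalars_norm, ← FormalMultilinearSeries.norm_apply_eq_norm_coef]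
    exact hC n
  have hqb := q.hasFPowerSeriesOnBall (hs0.trans_le hqr)
  refine ⟨fun z => q.sum (z - x₀), ?_, ?_⟩
  · have h1 : AnalyticAt ℂ q.sum ((x₀ : ℂ) - x₀) := by
      rw [sub_self]
      exact hqb.analyticAt
    exact AnalyticAt.comp (g := q.sum) (f := fun z => z - (x₀ : ℂ)) h1
      (analyticAt_id.sub analyticAt_const)
  · filter_upwards [Metric.eball_mem_nhds x₀ hs0] with x hx
    have hx' : edist x x₀ < s := hx
    have hy : x - x₀ ∈ Metric.eball (0 : ℝ) r := by
      rw [Metric.mem_eball, edist_zero_right, ← edist_eq_enorm_sub]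
      exact hx'.trans hsr
    have h1 := hp.hasSum hy
    have hz : (x : ℂ) - x₀ ∈ Metric.eball (0 : ℂ) q.radius := by
      rw [Metric.mem_eball, edist_zero_right, ← Complex.ofReal_sub]
      refine lt_of_lt_of_le ?_ hqr
      rw [edist_eq_enorm_sub] at hx'
      rwa [← ofReal_norm, Complex.norm_real, ofReal_norm]
    have h2 := hqb.hasSum hz
    rw [zero_add] at h2
    rw [add_sub_cancel] at h1
    have h3 : (fun n => q n fun _ => (x : ℂ) - x₀) = fun n => p n fun _ => x - x₀ := by
      funext n
      rw [hq, FormalMultilinearSeries.ofScalars_apply_eq, p.apply_eq_pow_smul_coeff, smul_eq_mul,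
        Complex.real_smul]
      push_cast
      ring
    rw [h3] at h2
    exact h2.unique h1

/-- Points on one side of an analytic arc are images of points in the corresponding half plane
under the holomorphic extension of the parametrization. -/
theorem eventually_side {H : ℂ → ℂ} {γ : ℝ → ℂ} {x : ℝ} (hH : AnalyticAt ℂ H x)
    (hd : deriv H x ≠ 0) (hγ : AnalyticAt ℝ γ x) (heq : ∀ᶠ y : ℝ in 𝓝 x, H y = γ y)
    (hdγ : deriv γ x = deriv H x) {D : Set ℂ}
    (hD : D ∈ 𝓝 (x : ℂ)) {σ : ℝ} (hσ : σ ^ 2 = 1) :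
    ∀ᶠ v : ℝ × ℝ in 𝓝 x ×ˢ 𝓝[>] (0 : ℝ), ∃ ζ ∈ D,
      H ζ = γ v.1 + (σ : ℂ) * Complex.I * (v.2 : ℂ) * deriv γ v.1 ∧ 0 < σ * ζ.im := by
  have hst := hH.hasStrictDerivAt
  set E := hst.localInverse H _ _ hd with hE
  have hHx : H x = γ x := heq.self_of_nhds
  have hEst : HasStrictDerivAt E (deriv H x)⁻¹ (γ x) := by
    rw [← hHx]
    exact hst.to_localInverse hd
  have hEx : E (γ x) = x := by
    rw [← hHx]
    exact (hst.eventually_left_inverse hd).self_of_nhds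
  have hleft : ∀ᶠ ζ in 𝓝 (x : ℂ), E (H ζ) = ζ := hst.eventually_left_inverse hd
  have hright : ∀ᶠ y in 𝓝 (γ x), H (E y) = y := by
    rw [← hHx]
    exact hst.eventually_right_inverse hd
  set a := (deriv H x)⁻¹ with ha
  have ha0 : 0 < ‖a‖ := norm_pos_iff.2 (inv_ne_zero hd)
  have hlo := hEst.isLittleO.def (c := ‖a‖ / 4) (by positivity)
  set P : ℝ × ℝ → ℂ := fun v => γ v.1 + (σ : ℂ) * Complex.I * (v.2 : ℂ) * deriv γ v.1 with hP
  have hl : (𝓝 x ×ˢ 𝓝[>] (0 : ℝ)) ≤ 𝓝 (x, (0 : ℝ)) := by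
    rw [nhds_prod_eq]
    exact Filter.prod_mono le_rfl nhdsWithin_le_nhds
  have hγc : ContinuousAt γ x := hγ.continuousAt
  have hγd : ContinuousAt (deriv γ) x := hγ.deriv.continuousAt
  have hPc : Tendsto P (𝓝 x ×ˢ 𝓝[>] (0 : ℝ)) (𝓝 (γ x)) := by
    have h1 : ContinuousAt P (x, 0) := by
      have e1 : ContinuousAt (fun v : ℝ × ℝ => γ v.1) (x, 0) :=
        ContinuousAt.comp (g := γ) hγc continuousAt_fst
      have e2 : ContinuousAt (fun v : ℝ × ℝ => deriv γ v.1) (x, 0) :=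
        ContinuousAt.comp (g := deriv γ) hγd continuousAt_fst
      have e3 : ContinuousAt (fun v : ℝ × ℝ => (v.2 : ℂ)) (x, 0) := by fun_prop
      exact e1.add ((continuousAt_const.mul e3).mul e2)
    have h2 := h1.tendsto
    simp only [hP, Complex.ofReal_zero, mul_zero, zero_mul, add_zero] at h2
    exact h2.mono_left hl
  have hγ1 : Tendsto (fun v : ℝ × ℝ => γ v.1) (𝓝 x ×ˢ 𝓝[>] (0 : ℝ)) (𝓝 (γ x)) :=
    hγc.tendsto.comp tendsto_fst
  have hg1 : Tendsto (fun v : ℝ × ℝ => a * deriv γ v.1) (𝓝 x ×ˢ 𝓝[>] (0 : ℝ)) (𝓝 1) := by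
    have h1 : Tendsto (fun v : ℝ × ℝ => a * deriv γ v.1) (𝓝 x ×ˢ 𝓝[>] (0 : ℝ))
        (𝓝 (a * deriv γ x)) := (hγd.tendsto.comp tendsto_fst).const_mul a
    rwa [hdγ, ha, inv_mul_cancel₀ hd] at h1
  have hlo' := (hPc.prodMk_nhds hγ1).eventually hlo
  have hDE : ∀ᶠ v in 𝓝 x ×ˢ 𝓝[>] (0 : ℝ), E (P v) ∈ D := by
    have h1 := hEst.hasDerivAt.continuousAt.tendsto
    rw [hEx] at h1
    exact (h1.comp hPc).eventually hD
  have hcast : Tendsto (fun v : ℝ × ℝ => (v.1 : ℂ)) (𝓝 x ×ˢ 𝓝[>] (0 : ℝ)) (𝓝 (x : ℂ)) :=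
    (Complex.continuous_ofReal.tendsto x).comp tendsto_fst
  have hpos : ∀ᶠ v : ℝ × ℝ in 𝓝 x ×ˢ 𝓝[>] (0 : ℝ), 0 < v.2 :=
    tendsto_snd.eventually self_mem_nhdsWithin
  filter_upwards [hlo', hDE, hPc.eventually hright, hcast.eventually hleft,
    tendsto_fst.eventually heq, hpos, Metric.tendsto_nhds.1 hg1 (1 / 4) (by norm_num)]
    with v h1 h2 h3 h4 h5 h6 h7
  refine ⟨E (P v), h2, h3, ?_⟩
  rw [← h5, h4] at h1
  set g := a * deriv γ v.1 with hg
  have hdiff : P v - H v.1 = (σ : ℂ) * Complex.I * (v.2 : ℂ) * deriv γ v.1 := by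
    rw [hP, h5]; ring
  simp only [hdiff] at h1
  set err := E (P v) - v.1 - a * ((σ : ℂ) * Complex.I * (v.2 : ℂ) * deriv γ v.1) with herr
  have hσn : ‖(σ : ℂ)‖ = 1 := by
    rw [Complex.norm_real, Real.norm_eq_abs, ← abs_one, ← sq_eq_sq_iff_abs_eq_abs, hσ, one_pow]
  have hgn : ‖g‖ ≤ 5 / 4 := by
    have h8 : ‖g‖ ≤ ‖g - 1‖ + ‖(1 : ℂ)‖ := by simpa using norm_add_le (g - 1) 1
    rw [dist_eq_norm] at h7
    rw [norm_one] at h8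
    linarith
  have herrn : ‖err‖ ≤ v.2 * (5 / 16) := by
    refine (le_of_eq_of_le (by rw [herr]; simp [mul_comm]) h1).trans ?_
    rw [norm_mul, norm_mul, norm_mul, hσn, Complex.norm_I, Complex.norm_real, Real.norm_eq_abs,
      abs_of_pos h6]
    have h9 : ‖a‖ * ‖deriv γ v.1‖ = ‖g‖ := by rw [hg, norm_mul]
    calc ‖a‖ / 4 * (1 * 1 * v.2 * ‖deriv γ v.1‖) = v.2 * (‖a‖ * ‖deriv γ v.1‖) / 4 := by ring
      _ ≤ v.2 * (5 / 4) / 4 := by rw [h9]; gcongr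
      _ = v.2 * (5 / 16) := by ring
  have hsplit : E (P v) = v.1 + (σ * v.2 : ℝ) * (Complex.I * g) + err := by
    rw [herr, hg]; push_cast; ring
  have him : (E (P v)).im = σ * v.2 * g.re + err.im := by
    rw [hsplit]
    simp only [Complex.add_im, Complex.ofReal_im, Complex.im_ofReal_mul, Complex.I_mul_im, zero_add]
  have hgre : 3 / 4 ≤ g.re := by
    have h8 := Complex.abs_re_le_norm (g - 1)
    rw [dist_eq_norm] at h7
    have h9 := (abs_lt.1 (h8.trans_lt h7)).1
    simp only [Complex.sub_re, Complex.one_re] at h9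
    linarith
  have herri : |σ * err.im| ≤ v.2 * (5 / 16) := by
    rw [abs_mul]
    have h8 : |σ| = 1 := by rwa [Complex.norm_real, Real.norm_eq_abs] at hσn
    rw [h8, one_mul]
    exact (Complex.abs_im_le_norm err).trans herrn
  rw [him]
  have h8 : σ * (σ * v.2 * g.re + err.im) = σ ^ 2 * (v.2 * g.re) + σ * err.im := by ring
  rw [h8, hσ, one_mul]
  nlinarith [(abs_le.1 herri).1]

/-- A function of modulus one on the real axis and at most one above it has a logarithmic
derivative that is a nonnegative multiple of `i`. -/
theorem logDeriv_re_im {g : ℂ → ℂ} {x : ℝ} (hg : AnalyticAt ℂ g x)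
    (h1 : ∀ᶠ y : ℝ in 𝓝 x, ‖g y‖ = 1)
    (h2 : ∀ᶠ ζ : ℂ in 𝓝 (x : ℂ), 0 < ζ.im → ‖g ζ‖ ≤ 1) :
    (logDeriv g x).re = 0 ∧ 0 ≤ (logDeriv g x).im := by
  have hx1 : ‖g x‖ = 1 := h1.self_of_nhds
  have hx0 : g x ≠ 0 := norm_pos_iff.1 (by rw [hx1]; exact one_pos)
  set L : ℂ → ℂ := fun ζ => Complex.log (g ζ / g x) with hL
  have hLd : HasDerivAt L (logDeriv g x) x := by
    have := (hg.differentiableAt.hasDerivAt.div_const (g x)).clog (by simp [hx0])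
    simpa [hx0, logDeriv_apply] using this
  have hre : ∀ ζ, (L ζ).re = Real.log ‖g ζ‖ := fun ζ => by
    rw [hL, Complex.log_re, norm_div, hx1, div_one]
  have hline : ∀ c : ℂ, HasDerivAt (fun t : ℝ => (L (x + t * c)).re) (logDeriv g x * c).re 0 := by
    intro c
    have e1 : HasDerivAt (fun t : ℝ => (x : ℂ) + t * c) c 0 := by
      simpa using ((Complex.ofRealCLM.hasDerivAt (x := (0 : ℝ))).mul_const c).const_add (x : ℂ)
    have e2 : HasDerivAt L (logDeriv g x) ((x : ℂ) + ((0 : ℝ) : ℂ) * c) := by simpa using hLd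
    exact Complex.reCLM.hasFDerivAt.comp_hasDerivAt 0 (HasDerivAt.comp 0 e2 e1)
  constructor
  · have h3 := hline 1
    have h4 : (fun t : ℝ => (L (x + t * 1)).re) =ᶠ[𝓝 0] fun _ => 0 := by
      have h5 : Tendsto (fun t : ℝ => x + t) (𝓝 0) (𝓝 x) := by
        simpa using (continuous_const.add continuous_id).tendsto (0 : ℝ) (f := fun t : ℝ => x + t)
      filter_upwards [h5.eventually h1] with t ht
      rw [hre, mul_one, ← Complex.ofReal_add, ht, Real.log_one]
    have h6 := h3.unique (h4.hasDerivAt_iff.2 (hasDerivAt_const 0 (0 : ℝ)))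
    simpa using h6
  · have h3 := hline Complex.I
    have h4 : (logDeriv g x * Complex.I).re ≤ 0 := by
      have h5 := h3.tendsto_slope_zero_right
      refine le_of_tendsto h5 ?_
      have h6 : Tendsto (fun t : ℝ => (x : ℂ) + t * Complex.I) (𝓝[>] 0) (𝓝 (x : ℂ)) := by
        have : Continuous fun t : ℝ => (x : ℂ) + t * Complex.I := by fun_prop
        simpa using (this.tendsto 0).mono_left nhdsWithin_le_nhds
      filter_upwards [h6.eventually h2, self_mem_nhdsWithin] with t ht ht0
      have ht0' : 0 < t := ht0
      have h7 := ht (by simpa using ht0')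
      rw [zero_add, hre, hre]
      simp only [Complex.ofReal_zero, zero_mul, add_zero, hx1, Real.log_one, sub_zero, smul_eq_mul]
      exact mul_nonpos_of_nonneg_of_nonpos (inv_nonneg.2 ht0'.le)
        (Real.log_nonpos (norm_nonneg _) h7)
    simpa using h4

/-! ### Charts around regular arcs -/

/-- The open square of side `2 δ` centred at the real point `x₀`. -/
def box (x₀ δ : ℝ) : Set ℂ := {ζ | |ζ.re - x₀| < δ ∧ |ζ.im| < δ}

theorem isOpen_box (x₀ δ : ℝ) : IsOpen (box x₀ δ) := by
  have h1 : IsOpen {ζ : ℂ | |ζ.re - x₀| < δ} := isOpen_lt (by fun_prop) continuous_const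
  have h2 : IsOpen {ζ : ℂ | |ζ.im| < δ} := isOpen_lt (by fun_prop) continuous_const
  exact h1.inter h2

theorem convex_box (x₀ δ : ℝ) : Convex ℝ (box x₀ δ) := by
  have h : box x₀ δ = Complex.reCLM ⁻¹' Metric.ball x₀ δ ∩ Complex.imCLM ⁻¹' Metric.ball 0 δ := by
    ext ζ
    simp [box, Real.dist_eq]
  rw [h]
  exact ((convex_ball x₀ δ).is_linear_preimage Complex.reCLM.isBoundedLinearMap.toIsLinearMap).inter
    ((convex_ball 0 δ).is_linear_preimage Complex.imCLM.isBoundedLinearMap.toIsLinearMap)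

theorem ofReal_mem_box {x x₀ δ : ℝ} (h : |x - x₀| < δ) : (x : ℂ) ∈ box x₀ δ :=
  ⟨by simpa using h, by simpa using (abs_nonneg _).trans_lt h⟩

theorem box_mono {x₀ δ δ' : ℝ} (h : δ' ≤ δ) : box x₀ δ' ⊆ box x₀ δ :=
  fun _ hζ => ⟨hζ.1.trans_le h, hζ.2.trans_le h⟩

theorem exists_box_subset {x₀ : ℝ} {V : Set ℂ} (hV : V ∈ 𝓝 (x₀ : ℂ)) :
    ∃ δ > 0, box x₀ δ ⊆ V := by
  obtain ⟨ε, hε, hball⟩ := Metric.mem_nhds_iff.1 hV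
  refine ⟨ε / 2, by linarith, fun ζ hζ => hball ?_⟩
  rw [mem_ball_iff_norm]
  have h1 := Complex.norm_le_abs_re_add_abs_im (ζ - x₀)
  simp only [Complex.sub_re, Complex.ofReal_re, Complex.sub_im, Complex.ofReal_im, sub_zero] at h1
  linarith [hζ.1, hζ.2]

namespace Pencil

variable {N m : ℕ} {Q : Pencil N m}

/-- On a connected set mapped off `Γ` the same branches stay the small ones. -/
theorem exists_bottom_of_preconnected {A : Set ℂ} (hA : IsPreconnected A) (hAo : IsOpen A)
    (hne : A.Nonempty) {H : ℂ → ℂ} {ψ : Fin N → ℂ → ℂ} (hH : ∀ ζ ∈ A, ContinuousAt H ζ)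
    (hr : ∀ ζ ∈ A, Q.LocalRoots (H ζ) ψ) (hG : ∀ ζ ∈ A, H ζ ∉ Q.Gam) :
    ∃ S : Finset (Fin N), ∀ ζ ∈ A, Bottom m (fun i => ψ i (H ζ)) S := by
  obtain ⟨ζ₀, h0⟩ := hne
  obtain ⟨S, hS⟩ := (hr ζ₀ h0).roots.notMem_Gam_iff.1 (hG ζ₀ h0)
  have hop : ∀ T : Finset (Fin N), IsOpen {ζ ∈ A | Bottom m (fun i => ψ i (H ζ)) T} := by
    intro T
    rw [isOpen_iff_mem_nhds]
    rintro ζ ⟨hζ, hT⟩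
    have h1 := eventually_bottom (m := m) (lam₀ := ζ) (ψ := fun i ζ => ψ i (H ζ)) (fun i =>
      ContinuousAt.comp (g := ψ i) ((hr ζ hζ).analytic i).continuousAt (hH ζ hζ)) hT
    filter_upwards [hAo.mem_nhds hζ, h1] with z hz hz' using ⟨hz, hz'⟩
  refine ⟨S, fun ζ hζ => ?_⟩
  have hsub := hA.subset_left_of_subset_union (hop S)
    (v := ⋃ T ∈ {T : Finset (Fin N) | T ≠ S}, {ζ ∈ A | Bottom m (fun i => ψ i (H ζ)) T})
    (isOpen_biUnion fun T _ => hop T) ?_ ?_ ⟨ζ₀, h0, h0, hS⟩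
  · exact (hsub hζ).2
  · rw [Set.disjoint_left]
    rintro z hz hz'
    simp only [Set.mem_iUnion] at hz'
    obtain ⟨T, hT, hz'⟩ := hz'
    exact hT (hz'.2.unique hz.2)
  · intro z hz
    obtain ⟨T, hT⟩ := (hr z hz).roots.notMem_Gam_iff.1 (hG z hz)
    by_cases h : T = S
    · exact Or.inl ⟨hz, h ▸ hT⟩
    · exact Or.inr (Set.mem_biUnion (show T ∈ {T : Finset (Fin N) | T ≠ S} from h) ⟨hz, hT⟩)

/-- A holomorphic straightening of a regular arc `γ` of `Γ` near `γ x₀`: the map `H` extends `γ`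
to a square, and carries the upper and the lower half of the square to regions off `Γ` in which
the small roots are those with indices in `Sp` and in `Sm`, respectively. -/
structure ArcChart (Q : Pencil N m) (γ : ℝ → ℂ) (s t x₀ δ : ℝ) (H : ℂ → ℂ) (ψ : Fin N → ℂ → ℂ)
    (Sp Sm : Finset (Fin N)) : Prop where
  pos : 0 < δ
  analytic : AnalyticOnNhd ℂ H (box x₀ δ)
  deriv_ne : ∀ ζ ∈ box x₀ δ, deriv H ζ ≠ 0
  inj : Set.InjOn H (box x₀ δ)
  mem : ∀ x, |x - x₀| < δ → x ∈ Set.Ioo s t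
  real : ∀ x : ℝ, |x - x₀| < δ → H x = γ x
  gam : ∀ ζ ∈ box x₀ δ, H ζ ∈ Q.Gam ↔ ζ.im = 0
  roots : ∀ ζ ∈ box x₀ δ, Q.LocalRoots (H ζ) ψ
  upper : ∀ ζ ∈ box x₀ δ, 0 < ζ.im → Bottom m (fun i => ψ i (H ζ)) Sp
  lower : ∀ ζ ∈ box x₀ δ, ζ.im < 0 → Bottom m (fun i => ψ i (H ζ)) Sm

theorem ArcChart.shrink {γ : ℝ → ℂ} {s t x₀ δ δ' : ℝ} {H : ℂ → ℂ} {ψ : Fin N → ℂ → ℂ}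
    {Sp Sm : Finset (Fin N)} (c : Q.ArcChart γ s t x₀ δ H ψ Sp Sm) (h0 : 0 < δ') (h : δ' ≤ δ) :
    Q.ArcChart γ s t x₀ δ' H ψ Sp Sm where
  pos := h0
  analytic := c.analytic.mono (box_mono h)
  deriv_ne ζ hζ := c.deriv_ne ζ (box_mono h hζ)
  inj := c.inj.mono (box_mono h)
  mem x hx := c.mem x (hx.trans_le h)
  real x hx := c.real x (hx.trans_le h)
  gam ζ hζ := c.gam ζ (box_mono h hζ)
  roots ζ hζ := c.roots ζ (box_mono h hζ)
  upper ζ hζ := c.upper ζ (box_mono h hζ)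
  lower ζ hζ := c.lower ζ (box_mono h hζ)

theorem IsArc.exists_chart {γ : ℝ → ℂ} {s t : ℝ} (hγ : Q.IsArc γ s t) {x₀ : ℝ}
    (hx₀ : x₀ ∈ Set.Ioo s t) :
    ∃ (δ : ℝ) (H : ℂ → ℂ) (ψ : Fin N → ℂ → ℂ) (Sp Sm : Finset (Fin N)),
      Q.ArcChart γ s t x₀ δ H ψ Sp Sm := by
  obtain ⟨H, hHa, hHγ⟩ := exists_holomorphic_extension (hγ.analytic x₀ hx₀)
  have hHx : H x₀ = γ x₀ := hHγ.self_of_nhds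
  have hd : deriv H x₀ ≠ 0 := by
    have h1 := hHa.differentiableAt.hasDerivAt.comp_ofReal
    have h2 : deriv γ x₀ = deriv H x₀ := by
      have h3 : (fun x : ℝ => H x) =ᶠ[𝓝 x₀] γ := hHγ
      rw [← h3.deriv_eq, h1.deriv]
    rw [← h2]
    exact hγ.deriv_ne_zero x₀ hx₀
  set e := (hHa.hasStrictDerivAt.hasStrictFDerivAt_equiv hd).toOpenPartialHomeomorph H with he
  have hsrc : (x₀ : ℂ) ∈ e.source :=
    (hHa.hasStrictDerivAt.hasStrictFDerivAt_equiv hd).mem_toOpenPartialHomeomorph_source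
  obtain ⟨ψ, -, hψ⟩ := Q.exists_localRoots (Q.isRoots_root _) (hγ.simple x₀ hx₀)
  rw [← hHx] at hψ
  have hev1 : ∀ᶠ ζ in 𝓝 (x₀ : ℂ), ζ ∈ e.source ∧ AnalyticAt ℂ H ζ ∧ deriv H ζ ≠ 0 ∧
      Q.LocalRoots (H ζ) ψ :=
    (e.open_source.eventually_mem hsrc).and (hHa.eventually_analyticAt.and
      ((hHa.deriv.continuousAt.eventually_ne hd).and (hHa.continuousAt.eventually hψ)))
  obtain ⟨δ₁, hδ₁, hbox₁⟩ := exists_box_subset hev1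
  obtain ⟨δ₂, hδ₂, hbox₂⟩ := Metric.eventually_nhds_iff_ball.1
    (hHγ.and (isOpen_Ioo.eventually_mem hx₀))
  set δ₃ := min δ₁ δ₂ with hδ₃
  have hδ₃0 : 0 < δ₃ := lt_min hδ₁ hδ₂
  have hreal : ∀ x : ℝ, |x - x₀| < δ₃ → H x = γ x ∧ x ∈ Set.Ioo s t := fun x hx =>
    hbox₂ x (by rw [Metric.mem_ball, Real.dist_eq]; exact hx.trans_le (min_le_right _ _))
  have hinj : Set.InjOn H (box x₀ δ₃) := e.injOn.mono fun ζ hζ =>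
    (hbox₁ (box_mono (min_le_left _ _) hζ)).1
  -- the part of the arc with parameters near `x₀` is relatively open in `Γ`
  obtain ⟨U, hU, himg⟩ := hγ.image_eq
  obtain ⟨U', hU', hUeq⟩ : ∃ U' : Set ℂ, IsOpen U' ∧
      ∀ x ∈ Set.Ioo s t, γ x ∈ U' ↔ |x - x₀| < δ₃ := by
    have hop : IsOpen {x : Set.Ioo s t | |(x : ℝ) - x₀| < δ₃} :=
      isOpen_lt (by fun_prop) continuous_const
    obtain ⟨U', hU', h1⟩ := hγ.embedding.isInducing.isOpen_iff.1 hop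
    refine ⟨U', hU', fun x hx => ?_⟩
    have := Set.ext_iff.1 h1 ⟨x, hx⟩
    simpa using this
  have hmemU : H x₀ ∈ U ∩ U' := by
    rw [hHx]
    refine ⟨?_, (hUeq x₀ hx₀).2 (by simpa using hδ₃0)⟩
    have : γ x₀ ∈ Q.Gam ∩ U := himg ▸ Set.mem_image_of_mem γ hx₀
    exact this.2
  obtain ⟨δ₄, hδ₄, hbox₄⟩ := exists_box_subset
    (hHa.continuousAt.preimage_mem_nhds ((hU.inter hU').mem_nhds hmemU))
  set δ := min δ₃ δ₄ with hδ
  have hδ0 : 0 < δ := lt_min hδ₃0 hδ₄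
  have h3 : δ ≤ δ₃ := min_le_left _ _
  have hall : ∀ ζ ∈ box x₀ δ, ζ ∈ e.source ∧ AnalyticAt ℂ H ζ ∧ deriv H ζ ≠ 0 ∧
      Q.LocalRoots (H ζ) ψ := fun ζ hζ => hbox₁ (box_mono (h3.trans (min_le_left _ _)) hζ)
  have hgam : ∀ ζ ∈ box x₀ δ, H ζ ∈ Q.Gam ↔ ζ.im = 0 := by
    intro ζ hζ
    constructor
    · intro h
      have h4 := hbox₄ (box_mono (min_le_right _ _) hζ)
      have h5 : H ζ ∈ γ '' Set.Ioo s t := by rw [himg]; exact ⟨h, h4.1⟩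
      obtain ⟨x, hx, hxe⟩ := h5
      have h6 : |x - x₀| < δ₃ := (hUeq x hx).1 (by rw [hxe]; exact h4.2)
      rw [← (hreal x h6).1] at hxe
      have h7 := hinj (ofReal_mem_box h6) (box_mono h3 hζ) hxe
      rw [← h7, Complex.ofReal_im]
    · intro h
      have h4 : ζ = (ζ.re : ℂ) := by apply Complex.ext <;> simp [h]
      have h5 := hreal ζ.re (hζ.1.trans_le h3)
      rw [h4, h5.1]
      have : γ ζ.re ∈ Q.Gam ∩ U := himg ▸ Set.mem_image_of_mem γ h5.2
      exact this.1
  have hhalf : ∀ A : Set ℂ, IsOpen A → Convex ℝ A → (box x₀ δ ∩ A).Nonempty →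
      (∀ ζ ∈ A, ζ.im ≠ 0) → ∃ S : Finset (Fin N), ∀ ζ ∈ box x₀ δ ∩ A,
        Bottom m (fun i => ψ i (H ζ)) S := fun A hA hAc hne him =>
    exists_bottom_of_preconnected ((convex_box _ _).inter hAc).isPreconnected
      ((isOpen_box _ _).inter hA) hne (fun ζ hζ => (hall ζ hζ.1).2.1.continuousAt)
      (fun ζ hζ => (hall ζ hζ.1).2.2.2) fun ζ hζ h => him ζ hζ.2 ((hgam ζ hζ.1).1 h)
  obtain ⟨Sp, hSp⟩ := hhalf {ζ | 0 < ζ.im} (isOpen_lt continuous_const Complex.continuous_im)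
    (convex_halfSpace_im_gt 0) ⟨x₀ + ((δ / 2 : ℝ) : ℂ) * Complex.I, by
      have h4 : |δ / 2| < δ := by rw [abs_of_pos (half_pos hδ0)]; exact half_lt_self hδ0
      simp only [box, Set.mem_inter_iff, Set.mem_ofPred_eq]
      simp [hδ0, h4]⟩ fun ζ hζ => ne_of_gt hζ
  obtain ⟨Sm, hSm⟩ := hhalf {ζ | ζ.im < 0} (isOpen_lt Complex.continuous_im continuous_const)
    (convex_halfSpace_im_lt 0) ⟨x₀ + ((-(δ / 2) : ℝ) : ℂ) * Complex.I, by
      have h4 : |δ / 2| < δ := by rw [abs_of_pos (half_pos hδ0)]; exact half_lt_self hδ0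
      simp only [box, Set.mem_inter_iff, Set.mem_ofPred_eq]
      simp [hδ0, h4]⟩ fun ζ hζ => ne_of_lt hζ
  exact ⟨δ, H, ψ, Sp, Sm, hδ0, fun ζ hζ => (hall ζ hζ).2.1, fun ζ hζ => (hall ζ hζ).2.2.1,
    hinj.mono (box_mono h3), fun x hx => (hreal x (hx.trans_le h3)).2,
    fun x hx => (hreal x (hx.trans_le h3)).1, hgam, fun ζ hζ => (hall ζ hζ).2.2.2,
    fun ζ hζ h => hSp ζ ⟨hζ, h⟩, fun ζ hζ h => hSm ζ ⟨hζ, h⟩⟩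

/-- The product of the root functions with indices in `S`. -/
def branchProd (ψ : Fin N → ℂ → ℂ) (S : Finset (Fin N)) (z : ℂ) : ℂ := ∏ i ∈ S, ψ i z

theorem LocalRoots.analyticAt_branchProd {lam : ℂ} {ψ : Fin N → ℂ → ℂ} (h : Q.LocalRoots lam ψ)
    (S : Finset (Fin N)) : AnalyticAt ℂ (branchProd ψ S) lam :=
  Finset.analyticAt_fun_prod S fun i _ => h.analytic i

theorem LocalRoots.branchProd_ne_zero {lam : ℂ} {ψ : Fin N → ℂ → ℂ} (h : Q.LocalRoots lam ψ)
    (S : Finset (Fin N)) : branchProd ψ S lam ≠ 0 :=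
  Finset.prod_ne_zero_iff.2 fun i _ => h.roots.ne_zero i

theorem LocalRoots.analyticAt_logDeriv {lam : ℂ} {ψ : Fin N → ℂ → ℂ} (h : Q.LocalRoots lam ψ)
    (S : Finset (Fin N)) : AnalyticAt ℂ (logDeriv (branchProd ψ S)) lam :=
  (h.analyticAt_branchProd S).deriv.div (h.analyticAt_branchProd S) (h.branchProd_ne_zero S)

namespace ArcChart

variable {γ : ℝ → ℂ} {s t x₀ δ : ℝ} {H : ℂ → ℂ} {ψ : Fin N → ℂ → ℂ} {Sp Sm : Finset (Fin N)}
  (c : Q.ArcChart γ s t x₀ δ H ψ Sp Sm)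
include c

theorem map_nhds {ζ : ℂ} (hζ : ζ ∈ box x₀ δ) : map H (𝓝 ζ) = 𝓝 (H ζ) :=
  (c.analytic ζ hζ).hasStrictDerivAt.map_nhds_eq (c.deriv_ne ζ hζ)

theorem image_mem_nhds {ζ : ℂ} (hζ : ζ ∈ box x₀ δ) : H '' box x₀ δ ∈ 𝓝 (H ζ) := by
  rw [← c.map_nhds hζ]
  exact image_mem_map ((isOpen_box _ _).mem_nhds hζ)

theorem isOpen_image : IsOpen (H '' box x₀ δ) := by
  rw [isOpen_iff_mem_nhds]
  rintro _ ⟨ζ, hζ, rfl⟩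
  exact c.image_mem_nhds hζ

theorem eventually_localRoots {ζ : ℂ} (hζ : ζ ∈ box x₀ δ) :
    ∀ᶠ lam in 𝓝 (H ζ), Q.LocalRoots lam ψ := by
  filter_upwards [c.image_mem_nhds hζ]
  rintro _ ⟨z, hz, rfl⟩
  exact c.roots z hz

theorem logDeriv_w_eq {ζ : ℂ} (hζ : ζ ∈ box x₀ δ) {S : Finset (Fin N)}
    (hS : Bottom m (fun i => ψ i (H ζ)) S) :
    logDeriv Q.w (H ζ) = logDeriv (branchProd ψ S) (H ζ) := by
  have h := Q.w_eventuallyEq (c.eventually_localRoots hζ) hS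
  rw [logDeriv_apply, logDeriv_apply, h.deriv_eq, h.self_of_nhds]
  rfl

theorem deriv_eq {x : ℝ} (hx : |x - x₀| < δ) : deriv γ x = deriv H x := by
  have h1 := (c.analytic x (ofReal_mem_box hx)).differentiableAt.hasDerivAt.comp_ofReal
  have h2 : (fun x : ℝ => H x) =ᶠ[𝓝 x] γ := by
    have h3 : IsOpen {y : ℝ | |y - x₀| < δ} := isOpen_lt (by fun_prop) continuous_const
    filter_upwards [h3.mem_nhds hx] with y hy using c.real y hy
  rw [← h2.deriv_eq, h1.deriv]

theorem hasSideLimit {x : ℝ} (hx : |x - x₀| < δ) (hγ : AnalyticAt ℝ γ x) {σ : ℝ}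
    (hσ : σ ^ 2 = 1) {S : Finset (Fin N)}
    (hS : ∀ ζ ∈ box x₀ δ, 0 < σ * ζ.im → Bottom m (fun i => ψ i (H ζ)) S) :
    HasSideLimit (logDeriv Q.w) γ σ x (logDeriv (branchProd ψ S) (γ x)) := by
  have hxb := ofReal_mem_box hx
  have h3 : IsOpen {y : ℝ | |y - x₀| < δ} := isOpen_lt (by fun_prop) continuous_const
  have heq : ∀ᶠ y : ℝ in 𝓝 x, H y = γ y := by
    filter_upwards [h3.mem_nhds hx] with y hy using c.real y hy
  have hlim : Tendsto (logDeriv (branchProd ψ S)) (𝓝 (γ x))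
      (𝓝 (logDeriv (branchProd ψ S) (γ x))) := by
    rw [← c.real x hx]
    exact ((c.roots _ hxb).analyticAt_logDeriv S).continuousAt.tendsto
  have hP : Tendsto (fun v : ℝ × ℝ => γ v.1 + (σ : ℂ) * Complex.I * (v.2 : ℂ) * deriv γ v.1)
      (𝓝 x ×ˢ 𝓝[>] (0 : ℝ)) (𝓝 (γ x)) := by
    have e1 : Tendsto (fun v : ℝ × ℝ => γ v.1) (𝓝 x ×ˢ 𝓝[>] (0 : ℝ)) (𝓝 (γ x)) :=
      hγ.continuousAt.tendsto.comp tendsto_fst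
    have e2 : Tendsto (fun v : ℝ × ℝ => deriv γ v.1) (𝓝 x ×ˢ 𝓝[>] (0 : ℝ)) (𝓝 (deriv γ x)) :=
      hγ.deriv.continuousAt.tendsto.comp tendsto_fst
    have e3 : Tendsto (fun v : ℝ × ℝ => (v.2 : ℂ)) (𝓝 x ×ˢ 𝓝[>] (0 : ℝ)) (𝓝 ((0 : ℝ) : ℂ)) :=
      (Complex.continuous_ofReal.tendsto 0).comp
        (tendsto_snd.mono_right nhdsWithin_le_nhds)
    have := e1.add ((e3.const_mul ((σ : ℂ) * Complex.I)).mul e2)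
    simpa using this
  refine (hlim.comp hP).congr' ?_
  filter_upwards [eventually_side (c.analytic x hxb) (c.deriv_ne x hxb) hγ heq (c.deriv_eq hx)
    ((isOpen_box x₀ δ).mem_nhds hxb) hσ] with v hv
  obtain ⟨ζ, hζ, hζe, him⟩ := hv
  simp only [Function.comp_apply]
  rw [← hζe]
  exact (c.logDeriv_w_eq hζ (hS ζ hζ him)).symm

theorem norm_w_eq {σ : ℝ} (hσ : σ ^ 2 = 1) {S : Finset (Fin N)}
    (hS : ∀ ζ ∈ box x₀ δ, 0 < σ * ζ.im → Bottom m (fun i => ψ i (H ζ)) S) {x : ℝ}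
    (hx : |x - x₀| < δ) : ‖Q.w (H x)‖ = ‖branchProd ψ S (H x)‖ := by
  have hxb := ofReal_mem_box hx
  have hp : Tendsto (fun r : ℝ => (x : ℂ) + (σ * r : ℝ) * Complex.I) (𝓝[>] 0) (𝓝 (x : ℂ)) := by
    have : Continuous fun r : ℝ => (x : ℂ) + (σ * r : ℝ) * Complex.I := by fun_prop
    simpa using (this.tendsto 0).mono_left nhdsWithin_le_nhds
  have hHc := (c.analytic x hxb).continuousAt.tendsto
  have h1 := (Q.continuous_norm_w.tendsto _).comp (hHc.comp hp)
  have h2 := ((c.roots _ hxb).analyticAt_branchProd S).continuousAt.norm.tendsto.comp (hHc.comp hp)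
  refine tendsto_nhds_unique h1 (h2.congr' ?_)
  filter_upwards [hp.eventually ((isOpen_box x₀ δ).mem_nhds hxb), self_mem_nhdsWithin] with r hr hr0
  have hr0' : 0 < r := hr0
  have h3 := hS _ hr (by
    simp only [Complex.add_im, Complex.ofReal_im, Complex.im_ofReal_mul, Complex.I_im, mul_one,
      zero_add]
    nlinarith)
  simp only [Function.comp_apply]
  rw [(c.roots _ hr).roots.w_eq h3]
  rfl

/-- The jump of the logarithmic derivative of `w` across an arc, times the line element, is a
nonnegative multiple of `i`: the quotient of the two branches has modulus one on the arc, and at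
most one on its left-hand side. -/
theorem jump_re_im {x : ℝ} (hx : |x - x₀| < δ) :
    ((logDeriv (branchProd ψ Sp) (γ x) - logDeriv (branchProd ψ Sm) (γ x)) * deriv γ x).re = 0 ∧
    0 ≤ ((logDeriv (branchProd ψ Sp) (γ x) - logDeriv (branchProd ψ Sm) (γ x)) *
      deriv γ x).im := by
  have hxb := ofReal_mem_box hx
  set g : ℂ → ℂ := fun ζ => branchProd ψ Sp (H ζ) / branchProd ψ Sm (H ζ) with hg
  have han : ∀ S, AnalyticAt ℂ (fun ζ => branchProd ψ S (H ζ)) x := fun S =>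
    AnalyticAt.comp (g := branchProd ψ S) ((c.roots _ hxb).analyticAt_branchProd S)
      (c.analytic x hxb)
  have hga : AnalyticAt ℂ g x :=
    (han Sp).div (han Sm) ((c.roots _ hxb).branchProd_ne_zero Sm)
  have hld : logDeriv g x =
      (logDeriv (branchProd ψ Sp) (γ x) - logDeriv (branchProd ψ Sm) (γ x)) * deriv γ x := by
    have hcomp : ∀ S, logDeriv (fun ζ => branchProd ψ S (H ζ)) (x : ℂ) =
        logDeriv (branchProd ψ S) (γ x) * deriv γ x := by
      intro S
      have h1 := logDeriv_comp (f := branchProd ψ S) (g := H) (x := (x : ℂ))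
        ((c.roots _ hxb).analyticAt_branchProd S).differentiableAt
        (c.analytic x hxb).differentiableAt
      rw [c.real x hx, ← c.deriv_eq hx] at h1
      exact h1
    have h2 := _root_.logDeriv_div (f := fun ζ => branchProd ψ Sp (H ζ))
      (g := fun ζ => branchProd ψ Sm (H ζ)) (x : ℂ) ((c.roots _ hxb).branchProd_ne_zero Sp)
      ((c.roots _ hxb).branchProd_ne_zero Sm) (han Sp).differentiableAt (han Sm).differentiableAt
    rw [hcomp, hcomp, ← sub_mul] at h2
    exact h2
  rw [← hld]
  refine logDeriv_re_im hga ?_ ?_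
  · have h3 : IsOpen {y : ℝ | |y - x₀| < δ} := isOpen_lt (by fun_prop) continuous_const
    filter_upwards [h3.mem_nhds hx] with y hy
    rw [hg, norm_div, ← c.norm_w_eq (σ := 1) (one_pow 2)
      (fun ζ hζ h => c.upper ζ hζ (by simpa using h)) hy, ← c.norm_w_eq (σ := -1) (by norm_num)
      (fun ζ hζ h => c.lower ζ hζ (by simpa using h)) hy]
    exact div_self (norm_ne_zero_iff.2 (Q.w_ne_zero _))
  · filter_upwards [(isOpen_box x₀ δ).mem_nhds hxb] with ζ hζ him
    have h4 := (c.roots ζ hζ).roots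
    have h5 : Q.w (H ζ) = branchProd ψ Sp (H ζ) := h4.w_eq (c.upper ζ hζ him)
    have hSm : Sm.card = m := by
      have hδ := c.pos
      refine (c.lower (x₀ + ((-(δ / 2) : ℝ) : ℂ) * Complex.I) ?_ ?_).1
      · have h6 : |δ / 2| < δ := by rw [abs_of_pos (half_pos hδ)]; exact half_lt_self hδ
        simp only [box, Set.mem_ofPred_eq]
        simp [hδ, h6]
      · simpa using hδ
    rw [hg, norm_div, ← h5, div_le_one (norm_pos_iff.2 ((c.roots ζ hζ).branchProd_ne_zero Sm))]
    exact h4.norm_w_le hSm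

end ArcChart

end Pencil

/-! ### Green's formula in a chart -/

/-- Extension by zero of a function whose support in an open set `B` lies in a closed set `K ⊆ B`. -/
theorem contDiff_indicator {B K : Set ℂ} (hB : IsOpen B) (hK : IsClosed K) {g : ℂ → ℂ}
    (hKB : K ⊆ B) (hg : ∀ ζ ∈ B, ContDiffAt ℝ 1 g ζ) (h0 : ∀ ζ ∈ B, ζ ∉ K → g ζ = 0) :
    ContDiff ℝ 1 (B.indicator g) := by
  rw [contDiff_iff_contDiffAt]
  intro ζ
  by_cases hζ : ζ ∈ B
  · refine (hg ζ hζ).congr_of_eventuallyEq ?_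
    filter_upwards [hB.mem_nhds hζ] with z hz using Set.indicator_of_mem hz g
  · refine (contDiffAt_const (c := (0 : ℂ))).congr_of_eventuallyEq ?_
    filter_upwards [hK.isOpen_compl.mem_nhds fun h => hζ (hKB h)] with z hz
    by_cases hzB : z ∈ B
    · rw [Set.indicator_of_mem hzB, h0 z hzB hz]
    · exact Set.indicator_of_notMem hzB g

theorem dbar_congr {f g : ℂ → ℂ} {z : ℂ} (h : f =ᶠ[𝓝 z] g) : dbar f z = dbar g z := by
  rw [dbar, dbar, h.fderiv_eq]

theorem dbar_eq_zero_of_notMem_tsupport {f : ℂ → ℂ} {z : ℂ} (h : z ∉ tsupport f) :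
    dbar f z = 0 := by
  have h1 : f =ᶠ[𝓝 z] fun _ => 0 := by
    filter_upwards [(isClosed_tsupport f).isOpen_compl.mem_nhds h] with y hy
    exact image_eq_zero_of_notMem_tsupport hy
  rw [dbar_congr h1]
  simp [dbar]

/-- The chain rule for `∂/∂\bar z` under a holomorphic substitution and a holomorphic factor. -/
theorem dbar_comp_mul {φ H F : ℂ → ℂ} {ζ : ℂ} (hφ : DifferentiableAt ℝ φ (H ζ))
    (hH : DifferentiableAt ℂ H ζ) (hF : DifferentiableAt ℂ F ζ) :
    dbar (fun z => φ (H z) * F z) ζ = (starRingEnd ℂ) (deriv H ζ) * dbar φ (H ζ) * F ζ := by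
  have hH' : HasFDerivAt H ((fderiv ℂ H ζ).restrictScalars ℝ) ζ :=
    hH.hasFDerivAt.restrictScalars ℝ
  have hF' : HasFDerivAt F ((fderiv ℂ F ζ).restrictScalars ℝ) ζ :=
    hF.hasFDerivAt.restrictScalars ℝ
  have h := (hφ.hasFDerivAt.comp ζ hH').fun_mul hF'
  have hlin : ∀ v : ℂ, fderiv ℝ φ (H ζ) v =
      (v.re : ℂ) * fderiv ℝ φ (H ζ) 1 + (v.im : ℂ) * fderiv ℝ φ (H ζ) Complex.I := by
    intro v
    have h1 : v = v.re • (1 : ℂ) + v.im • Complex.I := by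
      simp [Complex.re_add_im]
    conv_lhs => rw [h1]
    rw [map_add, map_smul, map_smul, Complex.real_smul, Complex.real_smul]
  have e1 : fderiv ℂ H ζ Complex.I = Complex.I * deriv H ζ := by
    simp
  have e2 : fderiv ℂ F ζ Complex.I = Complex.I * fderiv ℂ F ζ 1 := by
    simp [mul_comm]
  have e3 : fderiv ℂ H ζ 1 = deriv H ζ := by simp
  have hconj : (starRingEnd ℂ) (deriv H ζ) =
      ((deriv H ζ).re : ℂ) - ((deriv H ζ).im : ℂ) * Complex.I := by
    apply Complex.ext <;> simp
  unfold dbar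
  simp only [Function.comp_def] at h
  rw [h.fderiv]
  simp only [add_apply, smul_apply, ContinuousLinearMap.comp_apply,
    ContinuousLinearMap.coe_restrictScalars', e1, e2, e3, smul_eq_mul]
  rw [hlin (deriv H ζ), hlin (Complex.I * deriv H ζ), hconj]
  simp only [Complex.mul_re, Complex.mul_im, Complex.I_re, Complex.I_im, zero_mul, one_mul,
    zero_sub, zero_add, Complex.ofReal_neg]
  linear_combination (φ (H ζ) * fderiv ℂ F ζ 1 / 2 +
    F ζ * (deriv H ζ).im * fderiv ℝ φ (H ζ) Complex.I / 2) * Complex.I_sq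

/-- The real determinant of multiplication by `a`: the Jacobian of a holomorphic map. -/
theorem det_mul_complex (a : ℂ) :
    (((ContinuousLinearMap.toSpanSingleton ℂ a).restrictScalars ℝ : ℂ →L[ℝ] ℂ)).det = ‖a‖ ^ 2 := by
  have h : ((ContinuousLinearMap.toSpanSingleton ℂ a).restrictScalars ℝ : ℂ →L[ℝ] ℂ).det =
      LinearMap.det (Algebra.lmul ℝ ℂ a) := by
    unfold ContinuousLinearMap.det
    congr 1
    ext; simp [mul_comm]
  rw [h]
  have := Algebra.norm_complex_apply a
  rw [Algebra.norm_apply] at this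
  rw [this, Complex.normSq_eq_norm_sq]

theorem volume_im_eq_zero : volume {ζ : ℂ | ζ.im = 0} = 0 := by
  have h := Measure.addHaar_submodule (volume : Measure ℂ) (LinearMap.ker Complex.imLm) (by
    intro h
    have : Complex.I ∈ LinearMap.ker Complex.imLm := h ▸ Submodule.mem_top
    simp at this)
  have e : {ζ : ℂ | ζ.im = 0} = (LinearMap.ker Complex.imLm : Set ℂ) := by
    ext ζ
    simp
  rw [e, h]

theorem integral_eq_upper_add_lower {K Up Um : ℂ → ℂ} (hUp : Integrable Up) (hUm : Integrable Um)
    (hp : ∀ ζ : ℂ, 0 < ζ.im → K ζ = Up ζ) (hm : ∀ ζ : ℂ, ζ.im < 0 → K ζ = Um ζ) :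
    ∫ ζ, K ζ = (∫ ζ in {ζ : ℂ | 0 < ζ.im}, Up ζ) + ∫ ζ in {ζ : ℂ | ζ.im < 0}, Um ζ := by
  have m1 : MeasurableSet {ζ : ℂ | 0 < ζ.im} :=
    (isOpen_lt continuous_const Complex.continuous_im).measurableSet
  have m2 : MeasurableSet {ζ : ℂ | ζ.im < 0} :=
    (isOpen_lt Complex.continuous_im continuous_const).measurableSet
  have hae : ({ζ : ℂ | 0 < ζ.im} ∪ {ζ : ℂ | ζ.im < 0} : Set ℂ) =ᵐ[volume] Set.univ := by
    rw [ae_eq_univ]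
    refine measure_mono_null (fun ζ hζ => ?_) volume_im_eq_zero
    simp only [Set.mem_compl_iff, Set.mem_union, Set.mem_ofPred_eq, not_or, not_lt] at hζ
    exact le_antisymm hζ.1 hζ.2
  have e1 : Set.EqOn K Up {ζ : ℂ | 0 < ζ.im} := fun ζ h => hp ζ h
  have e2 : Set.EqOn K Um {ζ : ℂ | ζ.im < 0} := fun ζ h => hm ζ h
  rw [← setIntegral_univ, ← setIntegral_congr_set hae, setIntegral_union _ m2
    (hUp.integrableOn.congr_fun e1.symm m1) (hUm.integrableOn.congr_fun e2.symm m2),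
    setIntegral_congr_fun m1 e1, setIntegral_congr_fun m2 e2]
  rw [Set.disjoint_left]
  intro ζ h h'
  exact lt_asymm (show 0 < ζ.im from h) h'

namespace Pencil

variable {N m : ℕ} {Q : Pencil N m}

namespace ArcChart

variable {γ : ℝ → ℂ} {s t x₀ δ : ℝ} {H : ℂ → ℂ} {ψ : Fin N → ℂ → ℂ} {Sp Sm : Finset (Fin N)}
  (c : Q.ArcChart γ s t x₀ δ H ψ Sp Sm)
include c

theorem isCompact_preimage {K : Set ℂ} (hK : IsCompact K) (hKH : K ⊆ H '' box x₀ δ) :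
    IsCompact (box x₀ δ ∩ H ⁻¹' K) := by
  have hcont : ContinuousOn H (box x₀ δ) := c.analytic.continuousOn
  have hopen : IsOpenMap ((box x₀ δ).domRestrict H) := by
    rw [isOpenMap_iff_nhds_le]
    rintro ⟨ζ, hζ⟩
    have h1 : map ((box x₀ δ).domRestrict H) (𝓝 ⟨ζ, hζ⟩) = map H (𝓝 ζ) := by
      rw [Set.domRestrict_eq, ← Filter.map_map, map_nhds_subtype_coe_eq_nhds hζ
        ((isOpen_box _ _).mem_nhds hζ)]
    rw [h1, c.map_nhds hζ]
    rfl
  have hemb := IsOpenEmbedding.of_continuous_injective_isOpenMap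
    (continuousOn_iff_continuous_domRestrict.1 hcont) (Set.injOn_iff_injective.1 c.inj) hopen
  have h2 := hemb.isInducing.isCompact_preimage' hK (by rwa [Set.range_domRestrict])
  have h3 := h2.image continuous_subtype_val
  convert h3 using 1
  ext ζ
  simp [and_comm]

/-- The pull-back of a test function to the chart, times the pull-back of the logarithmic derivative of
the product of the branches in `S`, is of class `C¹` with compact support. -/
theorem contDiff_pullback {φ : ℂ → ℂ} (hφ : ContDiff ℝ 1 φ) (hc : HasCompactSupport φ)
    (hsub : tsupport φ ⊆ H '' box x₀ δ) (S : Finset (Fin N)) :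
    ContDiff ℝ 1 ((box x₀ δ).indicator
        fun ζ => φ (H ζ) * (logDeriv (branchProd ψ S) (H ζ) * deriv H ζ)) ∧
      HasCompactSupport ((box x₀ δ).indicator
        fun ζ => φ (H ζ) * (logDeriv (branchProd ψ S) (H ζ) * deriv H ζ)) := by
  have hK := c.isCompact_preimage hc hsub
  have h0 : ∀ ζ ∈ box x₀ δ, ζ ∉ box x₀ δ ∩ H ⁻¹' tsupport φ →
      φ (H ζ) * (logDeriv (branchProd ψ S) (H ζ) * deriv H ζ) = 0 := by
    intro ζ hζ h
    rw [image_eq_zero_of_notMem_tsupport fun h' => h ⟨hζ, h'⟩, zero_mul]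
  refine ⟨contDiff_indicator (isOpen_box _ _) hK.isClosed Set.inter_subset_left (fun ζ hζ => ?_)
    h0, HasCompactSupport.intro hK fun ζ hζ => ?_⟩
  · have hF : AnalyticAt ℂ (fun ζ => logDeriv (branchProd ψ S) (H ζ) * deriv H ζ) ζ :=
      (AnalyticAt.comp (g := logDeriv (branchProd ψ S)) ((c.roots ζ hζ).analyticAt_logDeriv S)
        (c.analytic ζ hζ)).mul (c.analytic ζ hζ).deriv
    exact (hφ.contDiffAt.comp ζ ((c.analytic ζ hζ).contDiffAt.restrict_scalars ℝ)).mul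
      (hF.contDiffAt.restrict_scalars ℝ)
  · by_cases h : ζ ∈ box x₀ δ
    · rw [Set.indicator_of_mem h, h0 ζ h hζ]
    · exact Set.indicator_of_notMem h _

/-- The factor `‖H'‖²` is the Jacobian of `H`, so the integral of the left-hand side is an integral
over the image of the chart. -/
theorem dbar_pullback {φ : ℂ → ℂ} (hφ : ContDiff ℝ 1 φ) (S : Finset (Fin N)) {ζ : ℂ}
    (hζ : ζ ∈ box x₀ δ) :
    dbar ((box x₀ δ).indicator
        fun ζ => φ (H ζ) * (logDeriv (branchProd ψ S) (H ζ) * deriv H ζ)) ζ =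
      (‖deriv H ζ‖ ^ 2 : ℝ) • (dbar φ (H ζ) * logDeriv (branchProd ψ S) (H ζ)) := by
  have h1 : (box x₀ δ).indicator
      (fun ζ => φ (H ζ) * (logDeriv (branchProd ψ S) (H ζ) * deriv H ζ)) =ᶠ[𝓝 ζ]
      fun ζ => φ (H ζ) * (logDeriv (branchProd ψ S) (H ζ) * deriv H ζ) := by
    filter_upwards [(isOpen_box _ _).mem_nhds hζ] with z hz using Set.indicator_of_mem hz _
  have hF : AnalyticAt ℂ (fun ζ => logDeriv (branchProd ψ S) (H ζ) * deriv H ζ) ζ :=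
    (AnalyticAt.comp (g := logDeriv (branchProd ψ S)) ((c.roots ζ hζ).analyticAt_logDeriv S)
      (c.analytic ζ hζ)).mul (c.analytic ζ hζ).deriv
  rw [dbar_congr h1, dbar_comp_mul (F := fun ζ => logDeriv (branchProd ψ S) (H ζ) * deriv H ζ)
    (hφ.differentiable one_ne_zero _) (c.analytic ζ hζ).differentiableAt hF.differentiableAt,
    Complex.real_smul]
  have h2 : (starRingEnd ℂ) (deriv H ζ) * deriv H ζ = ((‖deriv H ζ‖ ^ 2 : ℝ) : ℂ) := by
    rw [← Complex.normSq_eq_conj_mul_self, Complex.normSq_eq_norm_sq]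
  rw [← h2]
  ring

/-- Green's formula in the chart: the limit measure is the jump of `w'/w` across the arc. -/
theorem integral_eq {μ : Measure ℂ} (hμ : Q.IsLimitMeasure μ) {φ : ℂ → ℂ} (hφ : ContDiff ℝ 1 φ)
    (hc : HasCompactSupport φ) (hsub : tsupport φ ⊆ H '' box x₀ δ) :
    ∫ z, φ z ∂μ = ∫ x in {x : ℝ | |x - x₀| < δ}, φ (γ x) *
      (1 / (2 * (Real.pi : ℂ) * Complex.I) * (logDeriv (branchProd ψ Sp) (γ x) -
        logDeriv (branchProd ψ Sm) (γ x)) * deriv γ x) := by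
  have := hμ.finite
  set g : Finset (Fin N) → ℂ → ℂ := fun S => (box x₀ δ).indicator
    fun ζ => φ (H ζ) * (logDeriv (branchProd ψ S) (H ζ) * deriv H ζ) with hg
  have hgc : ∀ S, ContDiff ℝ 1 (g S) ∧ HasCompactSupport (g S) := fun S =>
    c.contDiff_pullback hφ hc hsub S
  have hgi : ∀ S, Integrable (dbar (g S)) := fun S =>
    (continuous_dbar (hgc S).1).integrable_of_hasCompactSupport (hasCompactSupport_dbar (hgc S).2)
  have hB : MeasurableSet (box x₀ δ) := (isOpen_box _ _).measurableSet
  have hout : ∀ S, ∀ ζ ∉ box x₀ δ, dbar (g S) ζ = 0 := by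
    intro S ζ hζ
    have hK := c.isCompact_preimage hc hsub
    have h1 : g S =ᶠ[𝓝 ζ] fun _ => 0 := by
      filter_upwards [hK.isClosed.isOpen_compl.mem_nhds fun h => hζ h.1] with z hz
      by_cases h : z ∈ box x₀ δ
      · rw [hg]
        simp only
        rw [Set.indicator_of_mem h, image_eq_zero_of_notMem_tsupport fun h' => hz ⟨h, h'⟩, zero_mul]
      · exact Set.indicator_of_notMem h _
    rw [dbar_congr h1]
    simp [dbar]
  have hKeq : ∀ S, ∀ ζ, (ζ ∈ box x₀ δ → Bottom m (fun i => ψ i (H ζ)) S) →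
      (box x₀ δ).indicator (fun ζ => |(((ContinuousLinearMap.toSpanSingleton ℂ
        (deriv H ζ)).restrictScalars ℝ : ℂ →L[ℝ] ℂ)).det| •
          (dbar φ (H ζ) * logDeriv Q.w (H ζ))) ζ = dbar (g S) ζ := by
    intro S ζ hS
    by_cases h : ζ ∈ box x₀ δ
    · rw [Set.indicator_of_mem h, det_mul_complex, abs_of_nonneg (by positivity),
        c.logDeriv_w_eq h (hS h)]
      exact (c.dbar_pullback hφ S h).symm
    · rw [Set.indicator_of_notMem h, hout S ζ h]
  have hcov := integral_image_eq_integral_abs_det_fderiv_smul volume hB (f := H)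
    (f' := fun ζ => ((ContinuousLinearMap.toSpanSingleton ℂ
        (deriv H ζ)).restrictScalars ℝ : ℂ →L[ℝ] ℂ)) (fun ζ hζ =>
      ((c.analytic ζ hζ).differentiableAt.hasDerivAt.hasFDerivAt.restrictScalars
        ℝ).hasFDerivWithinAt) c.inj (fun z => dbar φ z * logDeriv Q.w z)
  have hline : ∀ S, ∫ x : ℝ, g S x = ∫ x in {x : ℝ | |x - x₀| < δ},
      φ (γ x) * (logDeriv (branchProd ψ S) (γ x) * deriv γ x) := by
    intro S
    have hJ : MeasurableSet {x : ℝ | |x - x₀| < δ} :=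
      (isOpen_lt (by fun_prop) continuous_const).measurableSet
    rw [← integral_indicator hJ]
    congr 1
    funext x
    by_cases h : |x - x₀| < δ
    · rw [Set.indicator_of_mem (show x ∈ {x : ℝ | |x - x₀| < δ} from h), hg]
      simp only
      rw [Set.indicator_of_mem (ofReal_mem_box h), c.real x h, c.deriv_eq h]
    · rw [Set.indicator_of_notMem (show x ∉ {x : ℝ | |x - x₀| < δ} from h)]
      exact Set.indicator_of_notMem (fun hb => h (by simpa using hb.1)) _
  have hlinei : ∀ S, IntegrableOn (fun x => φ (γ x) * (logDeriv (branchProd ψ S) (γ x) *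
      deriv γ x)) {x : ℝ | |x - x₀| < δ} := by
    intro S
    have hJ : MeasurableSet {x : ℝ | |x - x₀| < δ} :=
      (isOpen_lt (by fun_prop) continuous_const).measurableSet
    have hc1 : Continuous fun x : ℝ => g S x := (hgc S).1.continuous.comp Complex.continuous_ofReal
    have hc2 : HasCompactSupport fun x : ℝ => g S x :=
      (hgc S).2.comp_isClosedEmbedding Complex.isometry_ofReal.isClosedEmbedding
    refine (hc1.integrable_of_hasCompactSupport hc2).integrableOn.congr_fun (fun x h => ?_) hJ
    rw [hg]
    simp only
    rw [Set.indicator_of_mem (ofReal_mem_box h), c.real x h, c.deriv_eq h]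
  calc ∫ z, φ z ∂μ
      = -(1 / (Real.pi : ℂ)) * ∫ z, dbar φ z * cauchyTransform μ z :=
        integral_eq_cauchyTransform μ hφ hc
    _ = (1 / (Real.pi : ℂ)) * ∫ z, dbar φ z * logDeriv Q.w z := by
        rw [neg_mul, ← mul_neg, ← integral_neg]
        congr 1
        refine integral_congr_ae ?_
        filter_upwards [Q.ae_good] with z hz
        rw [hμ.cauchy z hz]
        ring
    _ = (1 / (Real.pi : ℂ)) * ∫ z in H '' box x₀ δ, dbar φ z * logDeriv Q.w z := by
        rw [setIntegral_eq_integral_of_forall_compl_eq_zero]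
        intro z hz
        rw [dbar_eq_zero_of_notMem_tsupport fun h => hz (hsub h), zero_mul]
    _ = (1 / (Real.pi : ℂ)) * (-(Complex.I / 2) * (∫ x : ℝ, g Sp x) +
          Complex.I / 2 * ∫ x : ℝ, g Sm x) := by
        rw [hcov, ← integral_indicator hB, integral_eq_upper_add_lower (hgi Sp) (hgi Sm)
          (fun ζ him => hKeq Sp ζ fun h => c.upper ζ h him)
          (fun ζ him => hKeq Sm ζ fun h => c.lower ζ h him),
          integral_dbar_upper (hgc Sp).1 (hgc Sp).2, integral_dbar_lower (hgc Sm).1 (hgc Sm).2]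
    _ = 1 / (2 * (Real.pi : ℂ) * Complex.I) * ((∫ x : ℝ, g Sp x) - ∫ x : ℝ, g Sm x) := by
        have hpi : (Real.pi : ℂ) ≠ 0 := by exact_mod_cast Real.pi_ne_zero
        field_simp
        linear_combination (-(∫ x : ℝ, g Sp x) + ∫ x : ℝ, g Sm x) * Complex.I_sq
    _ = _ := by
        rw [hline, hline, ← integral_sub (hlinei Sp) (hlinei Sm), ← integral_const_mul]
        congr 1
        funext x
        ring

end ArcChart

end Pencil

/-! ### The density on regular arcs -/

/-- The limiting value of `f` at `γ x` from the side of `γ` given by the sign `σ`, when it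
exists. -/
def sideLim (f : ℂ → ℂ) (γ : ℝ → ℂ) (σ x : ℝ) : ℂ :=
  limUnder (𝓝 x ×ˢ 𝓝[>] (0 : ℝ))
    fun v : ℝ × ℝ => f (γ v.1 + (σ : ℂ) * Complex.I * (v.2 : ℂ) * deriv γ v.1)

theorem HasSideLimit.sideLim_eq {f : ℂ → ℂ} {γ : ℝ → ℂ} {σ x : ℝ} {L : ℂ}
    (h : HasSideLimit f γ σ x L) : sideLim f γ σ x = L :=
  Tendsto.limUnder_eq h

namespace Pencil

variable {N m : ℕ}

/-- The density of the limit measure on an arc `γ`, as a function of the parameter: the jump of `w'/w`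
times the line element, divided by `2πi`. Taking the nonnegative part of the real part gives values
in `ℝ≥0` by definition. -/
def arcDensity (Q : Pencil N m) (γ : ℝ → ℂ) (x : ℝ) : ℝ≥0 :=
  (1 / (2 * (Real.pi : ℂ) * Complex.I) * (sideLim (logDeriv Q.w) γ 1 x -
    sideLim (logDeriv Q.w) γ (-1) x) * deriv γ x).re.toNNReal

/-- The measure given on an arc by its density. -/
def arcMeasure (Q : Pencil N m) (γ : ℝ → ℂ) (s t : ℝ) : Measure ℂ :=
  Measure.map γ ((volume.restrict (Set.Ioo s t)).withDensity fun x => (Q.arcDensity γ x : ℝ≥0∞))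

variable {Q : Pencil N m}

namespace ArcChart

variable {γ : ℝ → ℂ} {s t x₀ δ : ℝ} {H : ℂ → ℂ} {ψ : Fin N → ℂ → ℂ} {Sp Sm : Finset (Fin N)}
  (c : Q.ArcChart γ s t x₀ δ H ψ Sp Sm)
include c

theorem hasSideLimit_left {x : ℝ} (hx : |x - x₀| < δ) (hγ : AnalyticAt ℝ γ x) :
    HasSideLimit (logDeriv Q.w) γ 1 x (logDeriv (branchProd ψ Sp) (γ x)) :=
  c.hasSideLimit hx hγ (one_pow 2) fun ζ hζ h => c.upper ζ hζ (by simpa using h)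

theorem hasSideLimit_right {x : ℝ} (hx : |x - x₀| < δ) (hγ : AnalyticAt ℝ γ x) :
    HasSideLimit (logDeriv Q.w) γ (-1) x (logDeriv (branchProd ψ Sm) (γ x)) :=
  c.hasSideLimit hx hγ (by norm_num) fun ζ hζ h => c.lower ζ hζ (by simpa using h)

/-- On an arc the side limits exist, and the jump of `w'/w` times the line element is a nonnegative
real multiple of `2πi`, so that no information is lost in the definition of `arcDensity`. -/
theorem arcDensity_eq {x : ℝ} (hx : |x - x₀| < δ) (hγ : AnalyticAt ℝ γ x) :
    ((Q.arcDensity γ x : ℝ) : ℂ) = 1 / (2 * (Real.pi : ℂ) * Complex.I) *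
      (logDeriv (branchProd ψ Sp) (γ x) - logDeriv (branchProd ψ Sm) (γ x)) * deriv γ x := by
  obtain ⟨h1, h2⟩ := c.jump_re_im hx
  rw [arcDensity, (c.hasSideLimit_left hx hγ).sideLim_eq, (c.hasSideLimit_right hx hγ).sideLim_eq,
    mul_assoc]
  set J := (logDeriv (branchProd ψ Sp) (γ x) - logDeriv (branchProd ψ Sm) (γ x)) * deriv γ x with hJ
  have h3 : J = (J.im : ℂ) * Complex.I := by
    apply Complex.ext
    · simpa using h1
    · simp
  have hpi : (Real.pi : ℂ) ≠ 0 := by exact_mod_cast Real.pi_ne_zero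
  have h4 : 1 / (2 * (Real.pi : ℂ) * Complex.I) * J = ((J.im / (2 * Real.pi) : ℝ) : ℂ) := by
    rw [h3]
    push_cast
    field_simp
    simp
  rw [h4, Complex.ofReal_re, Real.coe_toNNReal _ (div_nonneg h2 (by positivity))]

theorem continuousOn_arcDensity (hγ : Q.IsArc γ s t) :
    ContinuousOn (fun x => (Q.arcDensity γ x : ℝ)) {x | |x - x₀| < δ} := by
  have h : ContinuousOn (fun x => ((1 / (2 * (Real.pi : ℂ) * Complex.I) *
      (logDeriv (branchProd ψ Sp) (γ x) - logDeriv (branchProd ψ Sm) (γ x)) *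
        deriv γ x).re)) {x | |x - x₀| < δ} := by
    intro x hx
    have hxa := hγ.analytic x (c.mem x hx)
    have hl : ∀ S, ContinuousAt (fun y => logDeriv (branchProd ψ S) (γ y)) x := by
      intro S
      have h1 := ((c.roots _ (ofReal_mem_box hx)).analyticAt_logDeriv S).continuousAt
      rw [c.real x hx] at h1
      exact ContinuousAt.comp (g := logDeriv (branchProd ψ S)) h1 hxa.continuousAt
    refine ContinuousAt.continuousWithinAt ?_
    exact Complex.continuous_re.continuousAt.comp
      ((continuousAt_const.mul ((hl Sp).sub (hl Sm))).mul hxa.deriv.continuousAt)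
  refine h.congr fun x hx => ?_
  have := c.arcDensity_eq hx (hγ.analytic x (c.mem x hx))
  simp only
  rw [← this, Complex.ofReal_re]

theorem exists_arcDensity_le (hγ : Q.IsArc γ s t) {δ' : ℝ} (h : δ' < δ) :
    ∃ C : ℝ≥0, ∀ x, |x - x₀| < δ' → Q.arcDensity γ x ≤ C := by
  have hsub : Set.Icc (x₀ - δ') (x₀ + δ') ⊆ {x | |x - x₀| < δ} := by
    intro x hx
    have : |x - x₀| ≤ δ' := abs_le.2 ⟨by linarith [hx.1], by linarith [hx.2]⟩
    exact this.trans_lt h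
  obtain ⟨C, hC⟩ := isCompact_Icc.bddAbove_image ((c.continuousOn_arcDensity hγ).mono hsub)
  refine ⟨C.toNNReal, fun x hx => ?_⟩
  rw [abs_lt] at hx
  have h1 : (Q.arcDensity γ x : ℝ) ≤ C :=
    hC ⟨x, ⟨by linarith [hx.1], by linarith [hx.2]⟩, rfl⟩
  rw [← NNReal.coe_le_coe]
  exact h1.trans (Real.le_coe_toNNReal C)

/-- Near a point of a regular arc a limit measure has the density `arcDensity`: both measures have the
same integrals of test functions, by `ArcChart.integral_eq`. -/
theorem restrict_eq_map (hγ : Q.IsArc γ s t) {μ : Measure ℂ} (hμ : Q.IsLimitMeasure μ) {C : ℝ≥0}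
    (hC : ∀ x, |x - x₀| < δ → Q.arcDensity γ x ≤ C) :
    μ.restrict (H '' box x₀ δ) = (Measure.map γ ((volume.restrict {x | |x - x₀| < δ}).withDensity
      fun x => (Q.arcDensity γ x : ℝ≥0∞))).restrict (H '' box x₀ δ) := by
  set J : Set ℝ := {x | |x - x₀| < δ} with hJ
  have hJo : IsOpen J := isOpen_lt (by fun_prop) continuous_const
  have hJm : MeasurableSet J := hJo.measurableSet
  have hγm : AEMeasurable γ (volume.restrict J) := by
    refine ContinuousOn.aemeasurable (fun x hx => ?_) hJm
    exact (hγ.analytic x (c.mem x hx)).continuousAt.continuousWithinAt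
  have hdm : AEMeasurable (Q.arcDensity γ) (volume.restrict J) := by
    have h1 := (c.continuousOn_arcDensity hγ).aemeasurable (μ := volume) hJm
    have h2 := h1.real_toNNReal
    simpa using h2
  have hJfin : volume J < ∞ := by
    have : J = Metric.ball x₀ δ := by ext x; simp [hJ, Real.dist_eq]
    rw [this]
    exact measure_ball_lt_top
  set ρ := (volume.restrict J).withDensity fun x => (Q.arcDensity γ x : ℝ≥0∞) with hρ
  have hρfin : IsFiniteMeasure ρ := by
    refine isFiniteMeasure_withDensity (ne_of_lt ?_)
    calc ∫⁻ x in J, (Q.arcDensity γ x : ℝ≥0∞) ≤ ∫⁻ x in J, (C : ℝ≥0∞) :=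
          setLIntegral_mono' hJm fun x hx => by exact_mod_cast hC x hx
      _ < ∞ := by
          rw [setLIntegral_const]
          exact ENNReal.mul_lt_top ENNReal.coe_lt_top hJfin
  have hγm' : AEMeasurable γ ρ := hγm.mono_ac (withDensity_absolutelyContinuous _ _)
  have := hμ.finite
  refine restrict_eq_of_integral_eq c.isOpen_image fun φ hφ hc hsub => ?_
  have h1 := c.integral_eq hμ (φ := fun z => (φ z : ℂ))
    ((Complex.ofRealCLM.contDiff.comp hφ).of_le (by exact_mod_cast le_top))
    (hc.comp_left (g := fun r : ℝ => (r : ℂ)) Complex.ofReal_zero)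
    ((closure_mono fun z hz => by simpa using hz).trans hsub)
  rw [integral_map hγm' hφ.continuous.aestronglyMeasurable, hρ,
    integral_withDensity_eq_integral_smul₀ hdm]
  have h2 : ∫ z, (φ z : ℂ) ∂μ = ((∫ z, φ z ∂μ : ℝ) : ℂ) := integral_ofReal
  rw [h2] at h1
  have h3 : ∫ x in J, φ (γ x) * (1 / (2 * (Real.pi : ℂ) * Complex.I) *
      (logDeriv (branchProd ψ Sp) (γ x) - logDeriv (branchProd ψ Sm) (γ x)) * deriv γ x) =
      ((∫ x in J, Q.arcDensity γ x • φ (γ x) : ℝ) : ℂ) := by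
    have h4 : ∫ x in J, ((Q.arcDensity γ x • φ (γ x) : ℝ) : ℂ) =
        ((∫ x in J, Q.arcDensity γ x • φ (γ x) : ℝ) : ℂ) := integral_ofReal
    rw [← h4]
    refine setIntegral_congr_fun hJm fun x hx => ?_
    rw [← c.arcDensity_eq hx (hγ.analytic x (c.mem x hx)), NNReal.smul_def, smul_eq_mul]
    push_cast
    ring
  rw [h3] at h1
  exact_mod_cast h1

end ArcChart

theorem IsArc.measurableSet_image {γ : ℝ → ℂ} {s t : ℝ} (hγ : Q.IsArc γ s t) :
    MeasurableSet (γ '' Set.Ioo s t) := by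
  obtain ⟨U, hU, h⟩ := hγ.image_eq
  rw [h]
  exact Q.isClosed_Gam.measurableSet.inter hU.measurableSet

theorem IsArc.injOn {γ : ℝ → ℂ} {s t : ℝ} (hγ : Q.IsArc γ s t) : Set.InjOn γ (Set.Ioo s t) :=
  Set.injOn_iff_injective.2 hγ.embedding.injective

theorem IsArc.aemeasurable {γ : ℝ → ℂ} {s t : ℝ} (hγ : Q.IsArc γ s t) :
    AEMeasurable γ (volume.restrict (Set.Ioo s t)) :=
  ContinuousOn.aemeasurable (fun x hx => (hγ.analytic x hx).continuousAt.continuousWithinAt)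
    measurableSet_Ioo

theorem map_withDensity_apply {γ : ℝ → ℂ} {I : Set ℝ}
    (hγ : AEMeasurable γ (volume.restrict I)) (d : ℝ → ℝ≥0∞) {A : Set ℂ} (hA : MeasurableSet A) :
    Measure.map γ ((volume.restrict I).withDensity d) A = ∫⁻ x in γ ⁻¹' A ∩ I, d x := by
  rw [Measure.map_apply_of_aemeasurable (hγ.mono_ac (withDensity_absolutelyContinuous _ _)) hA,
    withDensity_apply' _ _, Measure.restrict_restrict₀ (hγ.nullMeasurableSet_preimage hA)]

/-- On a regular arc a limit measure is given by the jump of `w'/w`. -/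
theorem IsLimitMeasure.restrict_arc {μ : Measure ℂ} (hμ : Q.IsLimitMeasure μ) {γ : ℝ → ℂ} {s t : ℝ}
    (hγ : Q.IsArc γ s t) : μ.restrict (γ '' Set.Ioo s t) = Q.arcMeasure γ s t := by
  have hA := hγ.measurableSet_image
  have h0 : (Q.arcMeasure γ s t).restrict (γ '' Set.Ioo s t) = Q.arcMeasure γ s t := by
    refine Measure.restrict_eq_self_of_ae_mem ?_
    rw [ae_iff]
    change Q.arcMeasure γ s t (γ '' Set.Ioo s t)ᶜ = 0
    rw [arcMeasure, map_withDensity_apply hγ.aemeasurable _ hA.compl]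
    have : γ ⁻¹' (γ '' Set.Ioo s t)ᶜ ∩ Set.Ioo s t = ∅ := by
      ext x
      simp only [Set.mem_inter_iff, Set.mem_preimage, Set.mem_compl_iff, Set.mem_empty_iff_false,
        iff_false, not_and]
      exact fun h hx => h ⟨x, hx, rfl⟩
    rw [this, Measure.restrict_empty, lintegral_zero_measure]
  rw [← h0]
  refine restrict_eq_of_locally_eq ?_
  rintro _ ⟨x₀, hx₀, rfl⟩
  obtain ⟨δ₀, H, ψ, Sp, Sm, c₀⟩ := hγ.exists_chart hx₀
  have hδ₀ := c₀.pos
  obtain ⟨C, hC⟩ := c₀.exists_arcDensity_le hγ (half_lt_self hδ₀)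
  set δ := δ₀ / 2 with hδ
  have c := c₀.shrink (half_pos hδ₀) (half_le_self hδ₀.le)
  have hx₀' : |x₀ - x₀| < δ := by rw [sub_self, abs_zero]; exact c.pos
  refine ⟨H '' box x₀ δ, c.isOpen_image, ⟨x₀, ofReal_mem_box hx₀', c.real x₀ hx₀'⟩, ?_⟩
  have hO := c.isOpen_image.measurableSet
  have h1 := congrArg (fun ν => Measure.restrict ν (γ '' Set.Ioo s t))
    (c.restrict_eq_map hγ hμ hC)
  simp only [Measure.restrict_restrict hA] at h1
  rw [h1]
  set J : Set ℝ := {x | |x - x₀| < δ} with hJ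
  have hJo : IsOpen J := isOpen_lt (by fun_prop) continuous_const
  have hJsub : J ⊆ Set.Ioo s t := fun x hx => c.mem x hx
  ext B hB
  rw [Measure.restrict_apply hB, Measure.restrict_apply hB, arcMeasure,
    map_withDensity_apply hγ.aemeasurable _ (hB.inter (hA.inter hO)),
    map_withDensity_apply
      (hγ.aemeasurable.mono_measure (Measure.restrict_mono hJsub le_rfl)) _
      (hB.inter (hA.inter hO))]
  congr 2
  ext x
  refine ⟨fun h => ⟨h.1, hJsub h.2⟩, fun h => ⟨h.1, ?_⟩⟩
  obtain ⟨⟨-, hxA, ζ, hζ, hζx⟩, hxI⟩ := h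
  have him : ζ.im = 0 := by
    rw [← c.gam ζ hζ, hζx]
    obtain ⟨U, -, hU⟩ := hγ.image_eq
    rw [hU] at hxA
    exact hxA.1
  have hre : |ζ.re - x₀| < δ := hζ.1
  have hζre : ζ = (ζ.re : ℂ) := by apply Complex.ext <;> simp [him]
  rw [hζre, c.real _ hre] at hζx
  rw [← hγ.injOn (hJsub hre) hxI hζx]
  exact hre

/-- `μ` is carried by the regular arcs of `Γ`, and is given on each of them by the jump of
`w'/w`. -/
structure IsJump (Q : Pencil N m) (μ : Measure ℂ) : Prop where
  finite : IsFiniteMeasure μ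
  carried : μ Q.Gamᶜ = 0
  exceptional : μ Q.Exc = 0
  density : ∀ (γ : ℝ → ℂ) (s t : ℝ), Q.IsArc γ s t →
    ∃ (Lplus Lminus : ℝ → ℂ) (d : ℝ → ℝ≥0),
      (∀ x ∈ Set.Ioo s t,
        HasSideLimit (logDeriv Q.w) γ 1 x (Lplus x) ∧
        HasSideLimit (logDeriv Q.w) γ (-1) x (Lminus x) ∧
        ((d x : ℝ) : ℂ) =
          1 / (2 * (Real.pi : ℂ) * Complex.I) * (Lplus x - Lminus x) * deriv γ x) ∧
      μ.restrict (γ '' Set.Ioo s t) =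
        Measure.map γ ((volume.restrict (Set.Ioo s t)).withDensity fun x => (d x : ℝ≥0∞))

theorem IsLimitMeasure.isJump {μ : Measure ℂ} (hμ : Q.IsLimitMeasure μ) : Q.IsJump μ where
  finite := hμ.finite
  carried := hμ.carried
  exceptional := by
    rw [← Set.biUnion_of_singleton Q.Exc, measure_biUnion_null_iff Q.countable_exc]
    exact fun x _ => hμ.atom x
  density γ s t hγ := by
    refine ⟨sideLim (logDeriv Q.w) γ 1, sideLim (logDeriv Q.w) γ (-1), Q.arcDensity γ,
      fun x hx => ?_, hμ.restrict_arc hγ⟩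
    obtain ⟨δ, H, ψ, Sp, Sm, c⟩ := hγ.exists_chart hx
    have hxx : |x - x| < δ := by simpa using c.pos
    have hl := c.hasSideLimit_left hxx (hγ.analytic x hx)
    have hr := c.hasSideLimit_right hxx (hγ.analytic x hx)
    rw [c.arcDensity_eq hxx (hγ.analytic x hx), hl.sideLim_eq, hr.sideLim_eq]
    exact ⟨hl, hr, rfl⟩

theorem IsJump.restrict_arc {μ : Measure ℂ} (hμ : Q.IsJump μ) {γ : ℝ → ℂ} {s t : ℝ}
    (hγ : Q.IsArc γ s t) : μ.restrict (γ '' Set.Ioo s t) = Q.arcMeasure γ s t := by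
  obtain ⟨Lp, Lm, d, h, hres⟩ := hμ.density γ s t hγ
  rw [hres, arcMeasure]
  congr 1
  refine withDensity_congr_ae ?_
  filter_upwards [ae_restrict_mem measurableSet_Ioo] with x hx
  obtain ⟨h1, h2, h3⟩ := h x hx
  rw [arcDensity, h1.sideLim_eq, h2.sideLim_eq, ← h3, Complex.ofReal_re, Real.toNNReal_coe]

/-- The regular arcs are relatively open in `Γ`, so a measure carried by them is determined by its
restrictions to them. -/
theorem IsJump.unique {μ ν : Measure ℂ} (hμ : Q.IsJump μ) (hν : Q.IsJump ν) : μ = ν := by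
  have := hμ.finite
  have := hν.finite
  have hself : ∀ κ : Measure ℂ, Q.IsJump κ → κ.restrict (Q.Gam \ Q.Exc) = κ := by
    intro κ hκ
    refine Measure.restrict_eq_self_of_ae_mem ?_
    rw [ae_iff]
    refine measure_mono_null (fun x hx => ?_) (measure_union_null hκ.carried hκ.exceptional)
    by_cases h : x ∈ Q.Gam
    · exact Or.inr (by_contra fun h' => hx ⟨h, h'⟩)
    · exact Or.inl h
  rw [← hself μ hμ, ← hself ν hν]
  refine restrict_eq_of_locally_eq fun x hx => ?_
  have hex : ∃ (γ : ℝ → ℂ) (s t : ℝ), Q.IsArc γ s t ∧ x ∈ γ '' Set.Ioo s t := by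
    by_contra h
    exact hx.2 ⟨hx.1, h⟩
  obtain ⟨γ, s, t, hγ, hxγ⟩ := hex
  obtain ⟨U, hU, himg⟩ := hγ.image_eq
  refine ⟨U, hU, (himg ▸ hxγ : x ∈ Q.Gam ∩ U).2, ?_⟩
  have hA : MeasurableSet (Q.Gam \ Q.Exc) :=
    Q.isClosed_Gam.measurableSet.diff Q.countable_exc.measurableSet
  have key : ∀ κ : Measure ℂ, Q.IsJump κ → κ.restrict ((Q.Gam \ Q.Exc) ∩ U) =
      (Q.arcMeasure γ s t).restrict (Q.Gam \ Q.Exc) := by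
    intro κ hκ
    rw [← hκ.restrict_arc hγ, Measure.restrict_restrict hA, himg]
    congr 1
    ext z
    simp only [Set.mem_inter_iff, Set.mem_sdiff]
    tauto
  rw [key μ hμ, key ν hν]

end Pencil

/-! ### Limits of the zero sets and of the counting measures -/

/-- The Cauchy transform of a finite measure is holomorphic on every ball of measure zero. -/
theorem differentiableOn_cauchyTransform {μ : Measure ℂ} [IsFiniteMeasure μ] {c : ℂ} {ε : ℝ}
    (h0 : μ (Metric.ball c ε) = 0) : DifferentiableOn ℂ (cauchyTransform μ) (Metric.ball c ε) := by
  intro z₀ hz₀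
  obtain ⟨r, hr, hball⟩ := Metric.isOpen_iff.1 Metric.isOpen_ball z₀ hz₀
  have hae : ∀ᵐ x ∂μ, ∀ z ∈ Metric.ball z₀ (r / 2), r / 2 ≤ ‖z - x‖ := by
    have h1 : ∀ᵐ x ∂μ, x ∉ Metric.ball c ε := by
      exact measure_eq_zero_iff_ae_notMem.1 h0
    filter_upwards [h1] with x hx z hz
    by_contra! h
    refine hx (hball ?_)
    rw [mem_ball_iff_norm] at hz ⊢
    calc ‖x - z₀‖ = ‖(z - z₀) - (z - x)‖ := by congr 1; ring
      _ ≤ ‖z - z₀‖ + ‖z - x‖ := norm_sub_le _ _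
      _ < r := by linarith
  have hr2 : 0 < r / 2 := half_pos hr
  have hm : ∀ z : ℂ, AEStronglyMeasurable (fun x => 1 / (z - x)) μ := fun z =>
    (measurable_const.div (measurable_const.sub measurable_id)).aestronglyMeasurable
  have key := hasDerivAt_integral_of_dominated_loc_of_deriv_le (μ := μ)
    (F := fun z x : ℂ => 1 / (z - x)) (F' := fun z x : ℂ => -1 / (z - x) ^ 2)
    (bound := fun _ => 1 / (r / 2) ^ 2) (s := Metric.ball z₀ (r / 2)) (x₀ := z₀)
    (Metric.ball_mem_nhds _ hr2) (Eventually.of_forall hm) ?_ ?_ ?_ (integrable_const _) ?_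
  · exact key.2.differentiableAt.differentiableWithinAt
  · refine (integrable_const (1 / (r / 2))).mono' (hm z₀) ?_
    filter_upwards [hae] with x hx
    rw [norm_div, norm_one]
    exact one_div_le_one_div_of_le hr2 (hx z₀ (Metric.mem_ball_self hr2))
  · exact (measurable_const.div
      ((measurable_const.sub measurable_id).pow_const 2)).aestronglyMeasurable
  · filter_upwards [hae] with x hx z hz
    rw [norm_div, norm_neg, norm_one, norm_pow]
    exact one_div_le_one_div_of_le (by positivity) (pow_le_pow_left₀ hr2.le (hx z hz) 2)
  · filter_upwards [hae] with x hx z hz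
    have hne : z - x ≠ 0 := by
      intro h
      have := hx z hz
      rw [h, norm_zero] at this
      linarith
    have := ((hasDerivAt_id z).sub_const x).fun_inv hne
    simpa [one_div] using this

theorem setLiminf_subset_setLimsup (S : ℕ → Set ℂ) : setLiminf S ⊆ setLimsup S := by
  rintro x ⟨u, hu, hx⟩
  obtain ⟨n₀, hn₀⟩ := eventually_atTop.1 hu
  refine ⟨fun i => i + n₀, fun i => u (i + n₀), fun i j h => by simpa using h,
    fun i => hn₀ _ (Nat.le_add_left _ _), (tendsto_add_atTop_iff_nat n₀).2 hx⟩

theorem mem_setLiminf {S : ℕ → Set ℂ} {x : ℂ}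
    (h : ∀ ε > 0, ∀ᶠ n in atTop, ∃ z ∈ S n, dist z x < ε) : x ∈ setLiminf S := by
  have h1 : ∀ n, ∃ z, (S n).Nonempty → z ∈ S n ∧ dist x z < Metric.infDist x (S n) + 1 / (n + 1) := by
    intro n
    by_cases hn : (S n).Nonempty
    · obtain ⟨z, hz, hd⟩ := (Metric.infDist_lt_iff hn).1
        (lt_add_of_pos_right (Metric.infDist x (S n)) (Nat.one_div_pos_of_nat (α := ℝ) (n := n)))
      exact ⟨z, fun _ => ⟨hz, hd⟩⟩
    · exact ⟨0, fun h => absurd h hn⟩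
  choose u hu using h1
  refine ⟨u, ?_, ?_⟩
  · filter_upwards [h 1 one_pos] with n hn
    obtain ⟨z, hz, -⟩ := hn
    exact (hu n ⟨z, hz⟩).1
  · rw [Metric.tendsto_atTop']
    intro ε hε
    have h2 : ∀ᶠ n : ℕ in atTop, 1 / ((n : ℝ) + 1) < ε / 2 :=
      tendsto_one_div_add_atTop_nhds_zero_nat.eventually_lt_const (half_pos hε)
    obtain ⟨n₀, hn₀⟩ := eventually_atTop.1 ((h (ε / 2) (half_pos hε)).and h2)
    refine ⟨n₀, fun n hn => ?_⟩
    obtain ⟨⟨z, hz, hd⟩, hlt⟩ := hn₀ n hn.le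
    have h3 := (hu n ⟨z, hz⟩).2
    have h4 := Metric.infDist_le_dist_of_mem (x := x) hz
    rw [dist_comm] at hd
    rw [dist_comm]
    linarith

namespace Pencil

variable {N m : ℕ} {Q : Pencil N m} {D : ℕ → ℂ[X]}

/-- Off `Γ` the determinants are locally zero-free. -/
theorem setLimsup_subset_gam (hD : ∀ n lam, (D n).eval lam = (polyToeplitz m n (Q.f lam)).det) :
    setLimsup (fun n => {lam | (D n).eval lam = 0}) ⊆ Q.Gam := by
  rintro x ⟨k, u, hk, hu, hx⟩
  by_contra hG
  obtain ⟨ε, hε, hev⟩ := exists_ball_eval_ne_zero hD hG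
  have h1 := hx.eventually (Metric.ball_mem_nhds x hε)
  obtain ⟨i, hi, hi'⟩ := (h1.and (hk.tendsto_atTop.eventually hev)).exists
  exact hi' (u i) hi (hu i)

open scoped ContDiff in
/-- Zeros of the determinants accumulate at every point of `Γ`: along a subsequence without zeros
in a ball, the Cauchy transform of a limit measure would continue `w'/w` across `Γ`. -/
theorem eventually_exists_zero (hD : ∀ n lam, (D n).eval lam = (polyToeplitz m n (Q.f lam)).det)
    {lam₀ : ℂ} (hG : lam₀ ∈ Q.Gam) {ε : ℝ} (hε : 0 < ε) :
    ∀ᶠ n in atTop, ∃ z ∈ {lam | (D n).eval lam = 0}, dist z lam₀ < ε := by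
  by_contra hcon
  rw [not_eventually] at hcon
  set T : Set ℕ := {n | ¬∃ z ∈ {lam | (D n).eval lam = 0}, dist z lam₀ < ε} with hT
  have hne : (atTop ⊓ 𝓟 T).NeBot := frequently_mem_iff_neBot.1 hcon
  set 𝒰 := Ultrafilter.of (atTop ⊓ 𝓟 T) with h𝒰
  have hle : (𝒰 : Filter ℕ) ≤ atTop ⊓ 𝓟 T := Ultrafilter.of_le _
  obtain ⟨μ, hμ, hlim⟩ := exists_isLimitMeasure hD 𝒰 (hle.trans inf_le_left)
  have := hμ.finite
  have hTev : ∀ᶠ n in (𝒰 : Filter ℕ), n ∈ T := hle (mem_inf_of_right (mem_principal_self T))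
  have hμ0 : μ (Metric.ball lam₀ ε) = 0 := by
    have h1 : μ.restrict (Metric.ball lam₀ ε) = (0 : Measure ℂ).restrict (Metric.ball lam₀ ε) := by
      refine restrict_eq_of_integral_eq Metric.isOpen_ball fun φ hφ hc hs => ?_
      have h2 := hlim (fun z => (φ z : ℂ)) (Complex.continuous_ofReal.comp hφ.continuous) (by
        obtain ⟨C, hC⟩ := hc.exists_bound_of_continuous hφ.continuous
        exact ⟨C, fun x => by simpa using hC x⟩)
      have h3 : Tendsto (fun n => ∫ x, (φ x : ℂ) ∂(countMeas n (D n))) 𝒰 (𝓝 0) := by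
        refine tendsto_const_nhds.congr' ?_
        filter_upwards [hTev] with n hn
        rw [integral_countMeas]
        have h4 : (D n).roots.map (fun z => (φ z : ℂ)) = (D n).roots.map fun _ => 0 := by
          refine Multiset.map_congr rfl fun z hz => ?_
          have h5 : z ∉ tsupport φ := fun h =>
            hn ⟨z, (Polynomial.mem_roots'.1 hz).2, by simpa using hs h⟩
          rw [image_eq_zero_of_notMem_tsupport h5, Complex.ofReal_zero]
        rw [h4]
        simp
      have h6 := tendsto_nhds_unique h2 h3
      have h7 : ∫ z, (φ z : ℂ) ∂μ = ((∫ z, φ z ∂μ : ℝ) : ℂ) := integral_ofReal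
      rw [h7] at h6
      rw [integral_zero_measure]
      exact_mod_cast h6
    rw [← Measure.restrict_eq_zero, h1, Measure.restrict_zero]
  refine Q.no_continuation hG Metric.isOpen_ball (Metric.mem_ball_self hε)
    (differentiableOn_cauchyTransform hμ0).neg fun lam _ hlam => ?_
  rw [Pi.neg_apply, hμ.cauchy lam hlam, neg_neg]

theorem setLiminf_eq_gam (hD : ∀ n lam, (D n).eval lam = (polyToeplitz m n (Q.f lam)).det) :
    setLiminf (fun n => {lam | (D n).eval lam = 0}) = Q.Gam :=
  ((setLiminf_subset_setLimsup _).trans (setLimsup_subset_gam hD)).antisymm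
    fun _ hx => mem_setLiminf fun _ hε => eventually_exists_zero hD hx hε

theorem setLimsup_eq_gam (hD : ∀ n lam, (D n).eval lam = (polyToeplitz m n (Q.f lam)).det) :
    setLimsup (fun n => {lam | (D n).eval lam = 0}) = Q.Gam :=
  (setLimsup_subset_gam hD).antisymm
    ((setLiminf_eq_gam hD).symm.subset.trans (setLiminf_subset_setLimsup _))

theorem existsUnique_isJump (hD : ∀ n lam, (D n).eval lam = (polyToeplitz m n (Q.f lam)).det) :
    ∃! μ, Q.IsJump μ := by
  obtain ⟨μ, hμ, -⟩ := exists_isLimitMeasure hD (Ultrafilter.of atTop) (Ultrafilter.of_le _)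
  exact ⟨μ, hμ.isJump, fun ν hν => hν.unique hμ.isJump⟩

/-- All limits of the counting measures along ultrafilters coincide, so the whole sequence
converges. -/
theorem tendsto_integral_countMeas
    (hD : ∀ n lam, (D n).eval lam = (polyToeplitz m n (Q.f lam)).det) {μ : Measure ℂ}
    (hμ : Q.IsJump μ) (φ : ℂ →ᵇ ℂ) :
    Tendsto (fun n => ∫ x, φ x ∂(countMeas n (D n))) atTop (𝓝 (∫ x, φ x ∂μ)) := by
  rw [tendsto_iff_ultrafilter]
  intro 𝒰 h𝒰
  obtain ⟨ν, hν, hlim⟩ := exists_isLimitMeasure hD 𝒰 h𝒰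
  rw [hμ.unique hν.isJump]
  exact hlim φ φ.continuous ⟨‖φ‖, φ.norm_coe_le_norm⟩

end Pencil

/-! ### The pencil of a banded symbol -/

theorem coeff_T_mul {R : Type*} [CommRing R] (a : R[T;T⁻¹]) (n j : ℤ) :
    (LaurentPolynomial.T n * a).coeff j = a.coeff (j - n) := by
  rw [LaurentPolynomial.T, AddMonoidAlgebra.coeff_single_mul_eq_mul_coeff (j - n)
    (fun m' _ => by omega), one_mul]

theorem coeff_trunc (a : ℂ[T;T⁻¹]) (n : ℕ) : (LaurentPolynomial.trunc a).coeff n = a.coeff n := by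
  simp [LaurentPolynomial.trunc]

theorem coeff_sub_C (a : ℂ[T;T⁻¹]) (lam : ℂ) (j : ℤ) :
    (a - LaurentPolynomial.C lam).coeff j = a.coeff j - if j = 0 then lam else 0 := by
  rw [← LaurentPolynomial.C_apply, AddMonoidAlgebra.coeff_sub, Finsupp.sub_apply]

theorem coeff_algPoly (a : ℂ[T;T⁻¹]) (q : ℕ) (lam : ℂ) (l : ℕ) :
    (algPoly a q lam).coeff l = a.coeff ((l : ℤ) - q) - if l = q then lam else 0 := by
  rw [algPoly, coeff_trunc, coeff_T_mul, coeff_sub_C]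
  congr 1
  simp only [sub_eq_zero, Nat.cast_inj]

theorem algPoly_eq (a : ℂ[T;T⁻¹]) (q : ℕ) (lam : ℂ) :
    algPoly a q lam = algPoly a q 0 - Polynomial.C lam * Polynomial.X ^ q := by
  ext l
  rw [Polynomial.coeff_sub, Polynomial.coeff_C_mul_X_pow, coeff_algPoly, coeff_algPoly]
  simp

/-- The solutions of `a(z) = λ`, numbered from `0` by nondecreasing absolute value. -/
def solFin (a : ℂ[T;T⁻¹]) (q N : ℕ) (lam : ℂ) (i : Fin N) : ℂ :=
  (sortedSolutions a q lam).getD i 0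

section

variable {a : ℂ[T;T⁻¹]} {p q : ℕ}

theorem natDegree_algPoly (hp : 1 ≤ p) (hband : ∀ j : ℤ, a.coeff j ≠ 0 → -(q : ℤ) ≤ j ∧ j ≤ (p : ℤ))
    (hap : a.coeff (p : ℤ) ≠ 0) (lam : ℂ) :
    (algPoly a q lam).natDegree = p + q ∧ (algPoly a q lam).leadingCoeff = a.coeff (p : ℤ) := by
  have hc : (algPoly a q lam).coeff (p + q) = a.coeff (p : ℤ) := by
    rw [coeff_algPoly, if_neg (by omega), sub_zero]
    congr 1
    push_cast
    ring
  have hdeg : (algPoly a q lam).natDegree = p + q := by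
    refine Polynomial.natDegree_eq_of_le_of_coeff_ne_zero ?_ (hc ▸ hap)
    rw [Polynomial.natDegree_le_iff_coeff_eq_zero]
    intro l hl
    rw [coeff_algPoly, if_neg (by omega), sub_zero]
    by_contra h
    have := (hband _ h).2
    omega
  exact ⟨hdeg, by rw [Polynomial.leadingCoeff, hdeg, hc]⟩

theorem sortedSolutions_perm (a : ℂ[T;T⁻¹]) (q : ℕ) (lam : ℂ) :
    (sortedSolutions a q lam).Perm (algPoly a q lam).roots.toList :=
  List.perm_insertionSort _ _

theorem coe_sortedSolutions (a : ℂ[T;T⁻¹]) (q : ℕ) (lam : ℂ) :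
    (sortedSolutions a q lam : Multiset ℂ) = (algPoly a q lam).roots := by
  rw [Multiset.coe_eq_coe.2 (sortedSolutions_perm a q lam), Multiset.coe_toList]

theorem length_sortedSolutions (hp : 1 ≤ p)
    (hband : ∀ j : ℤ, a.coeff j ≠ 0 → -(q : ℤ) ≤ j ∧ j ≤ (p : ℤ))
    (hap : a.coeff (p : ℤ) ≠ 0) (lam : ℂ) : (sortedSolutions a q lam).length = p + q := by
  rw [← (natDegree_algPoly hp hband hap lam).1, ← Multiset.coe_card, coe_sortedSolutions,
    ← (IsAlgClosed.splits (algPoly a q lam)).natDegree_eq_card_roots]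

theorem solFin_eq_get {lam : ℂ} (h : (sortedSolutions a q lam).length = p + q) (i : Fin (p + q)) :
    solFin a q (p + q) lam i = (sortedSolutions a q lam).get (Fin.cast h.symm i) := by
  rw [solFin, List.getD_eq_getElem _ _ (by rw [h]; exact i.2)]
  rfl

theorem ofFn_solFin {lam : ℂ} (h : (sortedSolutions a q lam).length = p + q) :
    List.ofFn (solFin a q (p + q) lam) = sortedSolutions a q lam := by
  conv_rhs => rw [← List.ofFn_get (sortedSolutions a q lam)]
  rw [List.ofFn_congr h]
  congr 1
  funext i
  exact solFin_eq_get h i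

theorem monotone_norm_solFin {lam : ℂ} (h : (sortedSolutions a q lam).length = p + q) :
    Monotone fun i => ‖solFin a q (p + q) lam i‖ := by
  have : Std.Total (fun x y : ℂ => ‖x‖ ≤ ‖y‖) := ⟨fun x y => le_total _ _⟩
  have : IsTrans ℂ (fun x y : ℂ => ‖x‖ ≤ ‖y‖) := ⟨fun x y z h1 h2 => h1.trans h2⟩
  have hs : (sortedSolutions a q lam).Pairwise (fun x y => ‖x‖ ≤ ‖y‖) :=
    List.pairwise_insertionSort _ _
  rw [List.pairwise_iff_get] at hs
  intro i j hij
  rcases hij.eq_or_lt with rfl | hlt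
  · exact le_rfl
  · simp only [solFin_eq_get h]
    exact hs _ _ hlt

theorem algPoly_factor (hp : 1 ≤ p)
    (hband : ∀ j : ℤ, a.coeff j ≠ 0 → -(q : ℤ) ≤ j ∧ j ≤ (p : ℤ))
    (hap : a.coeff (p : ℤ) ≠ 0) (lam : ℂ) :
    algPoly a q lam = Polynomial.C (a.coeff (p : ℤ)) *
      ∏ i, (Polynomial.X - Polynomial.C (solFin a q (p + q) lam i)) := by
  conv_lhs => rw [(IsAlgClosed.splits (algPoly a q lam)).eq_prod_roots]
  rw [(natDegree_algPoly hp hband hap lam).2, ← coe_sortedSolutions,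
    ← ofFn_solFin (length_sortedSolutions hp hband hap lam), Multiset.map_coe, Multiset.prod_coe,
    List.map_ofFn, List.prod_ofFn]
  rfl

/-- Only `c = 1` satisfies `c ^ j = 1` for all exponents `j` of `a`. -/
theorem eq_one_of_zpow_eq_one (hgcd : a.coeff.support.gcd id = 1) {c : ℂ} (hc : c ≠ 0)
    (h : ∀ j : ℤ, a.coeff j ≠ 0 → c ^ j = 1) : c = 1 := by
  set u := Units.mk0 c hc with hu
  have h1 : (orderOf u : ℤ) ∣ a.coeff.support.gcd id := by
    refine Finset.dvd_gcd fun j hj => orderOf_dvd_iff_zpow_eq_one.2 (Units.ext ?_)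
    simpa [hu] using h j (Finsupp.mem_support_iff.1 hj)
  rw [hgcd] at h1
  have h2 : orderOf u = 1 := by
    have := Int.natAbs_dvd_natAbs.2 h1
    simpa using this
  have h3 := congrArg Units.val (orderOf_eq_one_iff.1 h2)
  simpa [hu] using h3

end

/-- The pencil `z^q (a(z) - λ)` of a banded symbol, with `q + k` small roots. -/
def symbolPencil (a : ℂ[T;T⁻¹]) (p q : ℕ) (hp : 1 ≤ p) (hq : 1 ≤ q)
    (hband : ∀ j : ℤ, a.coeff j ≠ 0 → -(q : ℤ) ≤ j ∧ j ≤ (p : ℤ))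
    (hap : a.coeff (p : ℤ) ≠ 0) (haq : a.coeff (-(q : ℤ)) ≠ 0)
    (hgcd : a.coeff.support.gcd id = 1)
    (k : ℤ) (hk : k ∈ Set.Icc (-(q : ℤ) + 1) ((p : ℤ) - 1)) : Pencil (p + q) (q + k).toNat where
  A := algPoly a q 0
  q := q
  root := solFin a q (p + q)
  m_pos := by have := hk.1; omega
  m_lt := by have := hk.2; omega
  q_pos := hq
  q_lt := by omega
  natDegree_A := (natDegree_algPoly hp hband hap 0).1
  coeff_zero_ne := by
    rw [coeff_algPoly]
    simpa using haq
  rigid c hc h := by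
    refine eq_one_of_zpow_eq_one hgcd hc fun j hj => ?_
    have h1 := (hband j hj).1
    obtain ⟨l, hl⟩ : ∃ l : ℕ, (l : ℤ) = j + q := ⟨(j + q).toNat, by omega⟩
    have h2 := h l (by rw [coeff_algPoly]; simpa [hl] using hj)
    rw [show j = (l : ℤ) - q by omega, zpow_sub₀ hc, zpow_natCast, zpow_natCast, h2,
      div_self (pow_ne_zero _ hc)]
  factor lam := by
    rw [← algPoly_eq, (natDegree_algPoly hp hband hap 0).2]
    exact algPoly_factor hp hband hap lam
  mono lam := monotone_norm_solFin (length_sortedSolutions hp hband hap lam)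

section

variable {a : ℂ[T;T⁻¹]} {p q : ℕ} (hp : 1 ≤ p) (hq : 1 ≤ q)
  (hband : ∀ j : ℤ, a.coeff j ≠ 0 → -(q : ℤ) ≤ j ∧ j ≤ (p : ℤ))
  (hap : a.coeff (p : ℤ) ≠ 0) (haq : a.coeff (-(q : ℤ)) ≠ 0)
  (hgcd : a.coeff.support.gcd id = 1)
  {k : ℤ} (hk : k ∈ Set.Icc (-(q : ℤ) + 1) ((p : ℤ) - 1))

theorem symbolPencil_gam :
    (symbolPencil a p q hp hq hband hap haq hgcd k hk).Gam = Gam a q k := by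
  have h1 : ((q : ℤ) + k - 1).toNat = (q + k).toNat - 1 := by omega
  have h2 : ((q : ℤ) + k + 1 - 1).toNat = (q + k).toNat := by omega
  unfold Pencil.Gam Gam sol
  rw [h1, h2]
  rfl

theorem symbolPencil_w :
    (symbolPencil a p q hp hq hband hap haq hgcd k hk).w = w a q k := by
  have := hk.1
  have := hk.2
  funext lam
  refine Finset.prod_bij (fun i _ => (i : ℤ) + 1) (fun i hi => ?_) (fun i _ j _ h => ?_)
    (fun j hj => ?_) fun i _ => ?_
  · simp only [Pencil.low, Finset.mem_filter, Finset.mem_univ, true_and] at hi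
    rw [Finset.mem_Icc]
    omega
  · exact Fin.ext (by omega)
  · rw [Finset.mem_Icc] at hj
    refine ⟨⟨(j - 1).toNat, by omega⟩, ?_, ?_⟩
    · simp only [Pencil.low, Finset.mem_filter, Finset.mem_univ, true_and]
      omega
    · simp only
      omega
  · rw [sol, add_sub_cancel_right, Int.toNat_natCast]
    rfl

theorem isBranchPoint_iff (lam : ℂ) :
    IsBranchPoint a q lam ↔ lam ∉ (symbolPencil a p q hp hq hband hap haq hgcd k hk).Simple := by
  classical
  have h := length_sortedSolutions hp hband hap lam
  have h1 : lam ∈ (symbolPencil a p q hp hq hband hap haq hgcd k hk).Simple ↔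
      (algPoly a q lam).roots.Nodup := by
    rw [← coe_sortedSolutions, Multiset.coe_nodup, ← ofFn_solFin h, List.nodup_ofFn]
    rfl
  rw [h1, Multiset.nodup_iff_count_le_one]
  simp [IsBranchPoint]

theorem isRegularArc_iff (γ : ℝ → ℂ) (s t : ℝ) :
    IsRegularArc a q k γ s t ↔ (symbolPencil a p q hp hq hband hap haq hgcd k hk).IsArc γ s t := by
  have hG := symbolPencil_gam hp hq hband hap haq hgcd hk
  constructor
  · intro h
    exact ⟨h.analytic, h.deriv_ne_zero, h.embedding, hG ▸ h.image_eq, fun x hx => by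
      by_contra h1
      exact h.not_branch x hx ((isBranchPoint_iff hp hq hband hap haq hgcd hk _).2 h1)⟩
  · intro h
    exact ⟨h.analytic, h.deriv_ne_zero, h.embedding, hG ▸ h.image_eq, fun x hx h1 =>
      (isBranchPoint_iff hp hq hband hap haq hgcd hk _).1 h1 (h.simple x hx)⟩

theorem symbolPencil_exc :
    (symbolPencil a p q hp hq hband hap haq hgcd k hk).Exc = exceptionalPoints a q k := by
  unfold Pencil.Exc exceptionalPoints
  simp only [isRegularArc_iff hp hq hband hap haq hgcd hk,
    symbolPencil_gam hp hq hband hap haq hgcd hk]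

theorem isJumpMeasure_iff (μ : Measure ℂ) :
    IsJumpMeasure a q k μ ↔ (symbolPencil a p q hp hq hband hap haq hgcd k hk).IsJump μ := by
  have hG := symbolPencil_gam hp hq hband hap haq hgcd hk
  have hE := symbolPencil_exc hp hq hband hap haq hgcd hk
  have hw := symbolPencil_w hp hq hband hap haq hgcd hk
  constructor
  · intro h
    refine ⟨h.finite, hG ▸ h.carried, hE ▸ h.exceptional, fun γ s t hγ => ?_⟩
    rw [hw]
    exact h.density γ s t ((isRegularArc_iff hp hq hband hap haq hgcd hk γ s t).2 hγ)
  · intro h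
    refine ⟨h.finite, hG ▸ h.carried, hE ▸ h.exceptional, fun γ s t hγ => ?_⟩
    rw [← hw]
    exact h.density γ s t ((isRegularArc_iff hp hq hband hap haq hgcd hk γ s t).1 hγ)

/-- Shifting the symbol by `z^{-k}` is the same as shifting the polynomial `A - λ X^q` by
`z^{-(q+k)}`. -/
theorem eval_P_eq_det_polyToeplitz (n : ℕ) (lam : ℂ) :
    (P a k n).eval lam = (polyToeplitz (q + k).toNat n
      ((symbolPencil a p q hp hq hband hap haq hgcd k hk).f lam)).det := by
  have := hk.1
  rw [eval_P]
  congr 1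
  ext i j
  have hf : (symbolPencil a p q hp hq hband hap haq hgcd k hk).f lam = algPoly a q lam :=
    (algPoly_eq a q lam).symm
  rw [hf, toeplitz, polyToeplitz, Matrix.of_apply, Matrix.of_apply, shiftedSymbol, coeff_T_mul,
    Polynomial.coeff_mul_X_pow']
  split_ifs with h
  · rw [algPoly, coeff_trunc, coeff_T_mul]
    congr 1
    omega
  · rw [coeff_sub_C, if_neg (by omega), sub_zero]
    by_contra h0
    have := (hband _ h0).1
    omega

end

end BandedToeplitz

end

theorem theorem3 (a : LaurentPolynomial ℂ) (p q : ℕ) (hp : 1 ≤ p) (hq : 1 ≤ q)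
    (hband : ∀ j : ℤ, a.coeff j ≠ 0 → -(q : ℤ) ≤ j ∧ j ≤ (p : ℤ))
    (hap : a.coeff (p : ℤ) ≠ 0) (haq : a.coeff (-(q : ℤ)) ≠ 0)
    (hgcd : a.coeff.support.gcd id = 1)
    (k : ℤ) (hk : k ∈ Set.Icc (-(q : ℤ) + 1) ((p : ℤ) - 1)) :
    BandedToeplitz.setLiminf (fun n => BandedToeplitz.genSpec a k n)
        = BandedToeplitz.Gam a q k ∧
    BandedToeplitz.setLimsup (fun n => BandedToeplitz.genSpec a k n)
        = BandedToeplitz.Gam a q k ∧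
    (∃! μ : Measure ℂ, BandedToeplitz.IsJumpMeasure a q k μ) ∧
    ∀ μ : Measure ℂ, BandedToeplitz.IsJumpMeasure a q k μ →
      ∀ φ : ℂ →ᵇ ℂ,
        Tendsto (fun n : ℕ => ∫ x, φ x ∂(BandedToeplitz.countingMeasure a k n)) atTop
          (𝓝 (∫ x, φ x ∂μ)) := by
  set Q := BandedToeplitz.symbolPencil a p q hp hq hband hap haq hgcd k hk with hQ
  have hG : Q.Gam = BandedToeplitz.Gam a q k :=
    BandedToeplitz.symbolPencil_gam hp hq hband hap haq hgcd hk
  have hD : ∀ n lam, (BandedToeplitz.P a k n).eval lam =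
      (BandedToeplitz.polyToeplitz (q + k).toNat n (Q.f lam)).det :=
    BandedToeplitz.eval_P_eq_det_polyToeplitz hp hq hband hap haq hgcd hk
  have hJ := BandedToeplitz.isJumpMeasure_iff hp hq hband hap haq hgcd hk
  refine ⟨(BandedToeplitz.Pencil.setLiminf_eq_gam hD).trans hG,
    (BandedToeplitz.Pencil.setLimsup_eq_gam hD).trans hG, ?_, fun μ hμ φ => ?_⟩
  · simpa only [hJ] using BandedToeplitz.Pencil.existsUnique_isJump hD
  · exact BandedToeplitz.Pencil.tendsto_integral_countMeas hD ((hJ μ).1 hμ) φ
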